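/- **Theorem 1.2.** Let $n\ge 3$ and let $V\in L^\infty(\mathbb{R}^n)$ be real-valued, $V=V_L+V_S$, where the following holds for some constants $r_0,C_1,C_2>0$ and $\delta,\beta>1$. The short-range part satisfies $|V_S(x)|\le C_1(|x|+1)^{-\delta}$. The long-range part $V_L$ is $C^1$ on $[r_0,+\infty)$ with respect to the radial variable $r=|x|$, and for $|x|\ge r_0$ it satisfies $V_L(x)\le p(|x|)$ and $\partial_rV_L(x)\le C_2(|x|+1)^{-\beta}$, where $p>0$ is a decreasing function with $p(r)\to0$ as $r\to\infty$. Let $P(h)=-h^2\Delta+V$, an operator on $L^2(\mathbb{R}^n)$ with domain the Sobolev space $H^2(\mathbb{R}^n)$. Fix $E>0$ and $s>1/2$, and put $$g_s^\pm(h,\theta)=\log\left\|(|x|+1)^{-s}(P(h)-E\pm i\theta)^{-1}(|x|+1)^{-s}\right\|_{L^2\to L^2}.$$ Suppose that either (a) $1<\delta\le 3$ and $\beta>1$, or (b) $\delta>3$ and $1<\beta<3$. Then there exist constants $C>0$ and $h_0>0$, independent of $h$ and $\theta$, such that for all $0<h\le h_0$ and all $0<\theta<1$ the resolvents $(P(h)-E\pm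 i\theta)^{-1}$ exist and $$g_s^\pm(h,\theta)\le\begin{cases}C\,h^{-\frac23-m_1}&\text{in case (a)},\\[2pt] C\,h^{-\frac43-\frac12(3-\beta)m_2}&\text{in case (b)},\end{cases}$$ where $m_1=\max\left\{\frac{7}{3(\delta-1)},\frac{4}{3(\beta-1)}\right\}\ge\frac76$ in case (a) and $m_2=\max\left\{\frac{1}{\delta-\beta},\frac{4}{3(\beta-1)}\right\}>\frac23$ in case (b). -/

import Mathlib

open MeasureTheory Filter Topology
open scoped ENNReal Laplacian SchwartzMap

noncomputable section

namespace SemiclassicalResolvent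

/-- Euclidean space `ℝⁿ`. -/
abbrev Rn (n : ℕ) : Type := EuclideanSpace ℝ (Fin n)

/-- The complex Hilbert space `L²(ℝⁿ)`. -/
abbrev L2 (n : ℕ) : Type := Lp ℂ 2 (volume : Measure (Rn n))

/-- The space `L^∞(ℝⁿ)` of real-valued essentially bounded functions. -/
abbrev LInfty (n : ℕ) : Type := Lp ℝ ∞ (volume : Measure (Rn n))

/-- Multiplication by a real-valued `L^∞` function, as a bounded operator on `L²(ℝⁿ)`. -/
def mulOp {n : ℕ} (w : LInfty n) : L2 n →L[ℂ] L2 n :=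
  LinearMap.mkContinuous
    { toFun := fun u => w • u
      map_add' := fun u v => Lp.add_smul w u v
      map_smul' := fun c u => by
        apply Lp.ext
        filter_upwards [Lp.coeFn_lpSMul (r := 2) w (c • u), Lp.coeFn_smul c u,
          Lp.coeFn_smul c (w • u : L2 n), Lp.coeFn_lpSMul (r := 2) w u] with x h1 h2 h3 h4
        rw [RingHom.id_apply, h1, h3, Pi.smul_apply, h4, Pi.smul_apply', Pi.smul_apply', h2,
          Pi.smul_apply, smul_comm] }
    ‖w‖ (fun u => Lp.norm_smul_le w u)

theorem coeFn_mulOp {n : ℕ} (w : LInfty n) (u : L2 n) :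
    mulOp w u =ᵐ[volume] fun x => ((w x : ℝ) : ℂ) * u x := by
  filter_upwards [Lp.coeFn_lpSMul (r := 2) w u] with x h
  change (w • u : L2 n) x = _
  rw [h, Pi.smul_apply', Complex.real_smul]

/-- The inclusion of `L²(ℝⁿ)` into tempered distributions is injective. -/
theorem toTemperedDistribution_injective {n : ℕ} {u v : L2 n}
    (h : (u : 𝓢'(Rn n, ℂ)) = (v : 𝓢'(Rn n, ℂ))) : u = v := by
  have hinj := LinearMap.ker_eq_bot.mp
    (Lp.ker_toTemperedDistributionCLM_eq_bot (E := Rn n) (F := ℂ) (μ := volume) (p := 2))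
  exact hinj h

/-- The Sobolev space `H²(ℝⁿ)`, as a subspace of `L²(ℝⁿ)`. -/
def H2 (n : ℕ) : Submodule ℂ (L2 n) where
  carrier := {u | TemperedDistribution.MemSobolev 2 2 (u : 𝓢'(Rn n, ℂ))}
  add_mem' := fun {u v} hu hv => by
    have h := TemperedDistribution.MemSobolev.add hu hv
    rw [← Lp.toTemperedDistributionCLM_apply, ← Lp.toTemperedDistributionCLM_apply,
      ← map_add] at h
    exact h
  zero_mem' := by
    have h := TemperedDistribution.memSobolev_fun_zero (Rn n) ℂ 2 2
    rw [← map_zero (Lp.toTemperedDistributionCLM ℂ (volume : Measure (Rn n)) 2)] at h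
    exact h
  smul_mem' := fun c u hu => by
    have h := TemperedDistribution.MemSobolev.smul c hu
    rw [← Lp.toTemperedDistributionCLM_apply, ← map_smul] at h
    exact h

theorem exists_laplacian {n : ℕ} (u : H2 n) :
    ∃ g : L2 n, Δ ((u : L2 n) : 𝓢'(Rn n, ℂ)) = (g : 𝓢'(Rn n, ℂ)) := by
  have hu : TemperedDistribution.MemSobolev 2 2 ((u : L2 n) : 𝓢'(Rn n, ℂ)) := u.2
  have h := hu.laplacian
  rw [sub_self] at h
  exact TemperedDistribution.memSobolev_zero_iff.mp h

/-- The distributional Laplacian `H²(ℝⁿ) → L²(ℝⁿ)`: `laplacianH2 n u` is the unique `L²` function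
representing the tempered distribution `Δ u`. -/
def laplacianH2 (n : ℕ) : H2 n →ₗ[ℂ] L2 n where
  toFun u := (exists_laplacian u).choose
  map_add' u v := by
    have key : ∀ w : H2 n, Lp.toTemperedDistributionCLM ℂ volume 2 (exists_laplacian w).choose
        = Δ (Lp.toTemperedDistributionCLM ℂ volume 2 (w : L2 n)) :=
      fun w => (exists_laplacian w).choose_spec.symm
    apply toTemperedDistribution_injective
    refine (key (u + v)).trans ((?_ : _ = _).trans (map_add
      (Lp.toTemperedDistributionCLM ℂ (volume : Measure (Rn n)) 2) _ _).symm)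
    rw [key, key, Submodule.coe_add, map_add]
    ext φ
    simp [TemperedDistribution.laplacian_apply_apply]
  map_smul' c u := by
    have key : ∀ w : H2 n, Lp.toTemperedDistributionCLM ℂ volume 2 (exists_laplacian w).choose
        = Δ (Lp.toTemperedDistributionCLM ℂ volume 2 (w : L2 n)) :=
      fun w => (exists_laplacian w).choose_spec.symm
    apply toTemperedDistribution_injective
    refine (key (c • u)).trans ((?_ : _ = _).trans (map_smul
      (Lp.toTemperedDistributionCLM ℂ (volume : Measure (Rn n)) 2) _ _).symm)
    rw [key, Submodule.coe_smul, map_smul]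
    ext φ
    simp [TemperedDistribution.laplacian_apply_apply]

theorem coe_laplacianH2 {n : ℕ} (u : H2 n) :
    (laplacianH2 n u : 𝓢'(Rn n, ℂ)) = Δ ((u : L2 n) : 𝓢'(Rn n, ℂ)) :=
  (exists_laplacian u).choose_spec.symm

/-- The semiclassical Schrödinger operator `P(h) = -h²Δ + V`, as an unbounded operator on
`L²(ℝⁿ)` with domain `H²(ℝⁿ)`. -/
def schrodinger {n : ℕ} (h : ℝ) (V : LInfty n) : L2 n →ₗ.[ℂ] L2 n where
  domain := H2 n
  toFun := -((h : ℂ) ^ 2) • laplacianH2 n + (mulOp V : L2 n →ₗ[ℂ] L2 n) ∘ₗ (H2 n).subtype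

/-- `R` is the resolvent `(A - z)⁻¹`: a bounded operator that maps into the domain of `A` and is
a two-sided inverse of `A - z`. (Such an `R` is unique.) -/
def IsResolvent {H : Type*} [NormedAddCommGroup H] [NormedSpace ℂ H]
    (A : H →ₗ.[ℂ] H) (z : ℂ) (R : H →L[ℂ] H) : Prop :=
  (∀ f : H, ∃ hf : R f ∈ A.domain, A ⟨R f, hf⟩ - z • R f = f) ∧
    ∀ u : A.domain, R (A u - z • (u : H)) = u

theorem memLp_weight {n : ℕ} {s : ℝ} (hs : 0 ≤ s) :
    MemLp (fun x : Rn n => (‖x‖ + 1) ^ (-s)) ∞ (volume : Measure (Rn n)) := by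
  refine memLp_top_of_bound (C := 1) ?_ (Eventually.of_forall fun x => ?_)
  · exact (Continuous.rpow_const (by fun_prop)
      fun x => Or.inl (by positivity)).aestronglyMeasurable
  · rw [Real.norm_of_nonneg (by positivity)]
    exact Real.rpow_le_one_of_one_le_of_nonpos (by linarith [norm_nonneg x]) (by linarith)

/-- Multiplication by the weight `(|x| + 1)^{-s}`, for `s ≥ 0`, on `L²(ℝⁿ)`. -/
def weightOp (n : ℕ) (s : ℝ) (hs : 0 ≤ s) : L2 n →L[ℂ] L2 n :=
  mulOp (memLp_weight (n := n) hs).toLp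

/-- There are constants `C, h₀ > 0`, independent of `h`, `θ` and of the sign, such that for
`0 < h ≤ h₀`, `0 < θ < 1` and both signs the resolvent `(P(h) - E ± iθ)⁻¹` exists and
`log ‖(|x|+1)^{-s} (P(h) - E ± iθ)⁻¹ (|x|+1)^{-s}‖ ≤ C h^{-κ}`. -/
def LogResolventBound {n : ℕ} (V : LInfty n) (E s : ℝ) (hs : 0 ≤ s) (κ : ℝ) : Prop :=
  ∃ C > 0, ∃ h₀ > 0, ∀ h : ℝ, 0 < h → h ≤ h₀ → ∀ θ : ℝ, 0 < θ → θ < 1 →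
    ∀ σ : ℝ, σ = 1 ∨ σ = -1 →
      ∃ R : L2 n →L[ℂ] L2 n,
        IsResolvent (schrodinger h V) ((E : ℂ) - σ * θ * Complex.I) R ∧
        Real.log ‖weightOp n s hs ∘L R ∘L weightOp n s hs‖ ≤ C * h ^ (-κ)

end SemiclassicalResolvent

end

/-!
The resolvent is bounded by a Carleman estimate with a radial multiplier `μ` and a radial phase `φ`.

**The potential.** Only the radial derivative of the long-range part is controlled, only for
`‖x‖ ≥ r₀`, and only from above. With a radial cut-off that vanishes at `r₀` and tends to `1` as
fast as the smaller of `r^(-δ)` and `r^(-β)`, the potential becomes `V = W + S` almost everywhere,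
with `|S| ≤ C (1+r)^(-δ)`, with `W` continuous along rays and below any positive bound at infinity,
and with `∂ᵣW` bounded above by `C (1+r)^(-β)` off the sphere of radius `r₀` (`exists_radialSplit`). The upper bound
suffices because `∂ᵣW` enters with the favourable sign when it is negative.

**The radial energy.** Along the ray in direction `ω` the function `r^((n-1)/2) e^(φ/h) v(rω)`
satisfies an ordinary differential equation in `r` with an angular term. The energy
`μ (h²|∂ᵣ ·|² + (E + φ'² - W)|·|² - angular energy)` vanishes at both ends of the ray, and its
derivative is bounded from below (`exists_hasDerivAt_rayEnergy`) as soon as the pointwise inequality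
`CarlemanWeight.Dominates` between the weight and the potential holds. The angular energy is written
with the infinitesimal rotations `xᵢ∂ⱼ - xⱼ∂ᵢ`. Its contribution to the derivative is nonnegative,
since `n ≥ 3` and `r μ' ≤ 2μ`, up to a remainder that is an exact derivative along rotations. That
remainder integrates to zero because rotations preserve the measure
(`integral_rotGen_deriv_eq_zero`), so no analysis on the sphere is needed. Integration
in polar coordinates (`integral_nonneg_of_rays`) yields `carleman_schwartz` for Schwartz functions,
and density of these in `H²` for the graph norm (`exists_schwartz_tendsto`) yields `carleman_H2`.

**The resolvent.** It exists for nonreal `z` because `-h²Δ + V` is symmetric on `H²`, the range of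
`P(h) - z` is closed, and a function orthogonal to it is an eigenvector in `H²` with nonreal
eigenvalue (`exists_isResolvent`). The Carleman estimate bounds the weighted norm of
`u = (P(h) - E ± iθ)⁻¹ (w f)`, where `w = (‖x‖+1)^(-s)`, up to an error of size `θ‖u‖²`. This is
`|Im ⟨u, w f⟩| ≤ ‖w u‖ ‖f‖`, and so it is absorbed by the weighted norm
(`exists_resolvent_norm_le`). The bound is `exp (2 sup φ / h)` times a power of `1/h`, and the power
disappears in the logarithm.

**The weight.** Let `a = h^(-m)` and `τ = τ₀ h^(-1/3)`. The phase has `φ' ≈ τ (1+r)^(-k)` for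
`r ≪ a` and flattens out at `r ≈ a`, so that `sup φ ≈ τ a^(1-k)`; the multiplier
`μ = 1 - (1 + (r² + 2r)/a²)^(-ε/2)` is comparable to `(r² + 2r)/a²` for `r ≪ a`, with
`μ' ≥ c r^(-1-ε)` at infinity. For `r ≪ a` the gain `φ'² μ'` beats the potential: the short-range term requires
`h φ'³ ≥ C (1+r)^(1-2δ)`, hence the factor `h^(-1/3)` and `3k ≤ 2δ - 1`. For `r ≳ a` the gain
`E μ'` wins if `m(δ-1) > 1` and `mk > 1/3` (`exists_dominating_weight`). The exponent is therefore
`4/3 + m(1-k)` (`logResolventBound_of_split`). For `δ ≤ 3` one takes `m = 2/(δ-1)` and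
`k = min (1/2) ((2δ-1)/3)`. For `δ > 3` one takes `m = 1` and `k` close enough to `1`.
-/

/-! ### Schwartz functions and the Sobolev space `H²` -/

namespace SemiclassicalResolvent

/-- A Schwartz function as an element of `L²`. -/
noncomputable abbrev toL2 {n : ℕ} (φ : 𝓢(Rn n, ℂ)) : L2 n := φ.toLp 2 volume

open TemperedDistribution in
/-- With the Fourier transform normalised by `e^(-2πi⟨x,ξ⟩)`, the symbol `1 + ‖ξ‖²` is that of
`1 - (2π)⁻² Δ`. -/
theorem besselPotential_two_apply {n : ℕ} (f : 𝓢'(Rn n, ℂ)) :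
    besselPotential (Rn n) ℂ 2 f = f - ((((2 * Real.pi) ^ 2)⁻¹ : ℝ) : ℂ) • Δ f := by
  have hsum := fourierMultiplierCLM_sum (E := Rn n) ℂ (s := Finset.univ)
    (g := fun i : Fin 2 => if i = 0 then (fun _ => (1 : ℂ)) else
      (fun x : Rn n => Complex.ofReal (‖x‖ ^ 2))) (by
      intro i _
      fin_cases i
      · exact Function.HasTemperateGrowth.const 1
      · simp only [Fin.mk_one, one_ne_zero, if_false]; fun_prop)
  have hb : (fun x : Rn n => (((1 + ‖x‖ ^ 2) ^ ((2 : ℝ) / 2) : ℝ) : ℂ)) = fun x =>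
      ∑ i : Fin 2, (if i = 0 then (fun _ => (1 : ℂ)) else
        (fun x : Rn n => Complex.ofReal (‖x‖ ^ 2))) x := by
    funext x
    simp
  rw [laplacian_eq_fourierMultiplierCLM, besselPotential, hb, hsum, Fin.sum_univ_two]
  simp only [if_true, one_ne_zero, if_false, fourierMultiplierCLM_const, one_smul]
  ext φ
  simp

theorem laplacianH2_eq_iff {n : ℕ} (u : H2 n) (g : L2 n) :
    laplacianH2 n u = g ↔ Δ ((u : L2 n) : 𝓢'(Rn n, ℂ)) = (g : 𝓢'(Rn n, ℂ)) := by
  rw [← coe_laplacianH2]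
  exact ⟨fun h => by rw [h], toTemperedDistribution_injective⟩

theorem mem_H2_of_laplacian_eq {n : ℕ} {u g : L2 n}
    (h : Δ (u : 𝓢'(Rn n, ℂ)) = (g : 𝓢'(Rn n, ℂ))) : u ∈ H2 n := by
  refine ⟨u - ((((2 * Real.pi) ^ 2)⁻¹ : ℝ) : ℂ) • g, ?_⟩
  rw [besselPotential_two_apply, h, ← Lp.toTemperedDistributionCLM_apply (p := 2),
    ← Lp.toTemperedDistributionCLM_apply (p := 2), ← Lp.toTemperedDistributionCLM_apply (p := 2),
    map_sub, map_smul]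

theorem laplacian_toLp {n : ℕ} (φ : 𝓢(Rn n, ℂ)) :
    Δ ((toL2 φ) : 𝓢'(Rn n, ℂ)) = (toL2 (Δ φ)) := by
  rw [Lp.toTemperedDistribution_toLp_eq, Lp.toTemperedDistribution_toLp_eq,
    TemperedDistribution.laplacian_toTemperedDistributionCLM_eq]

/-- A Schwartz function, as an element of the Sobolev space `H²`. -/
noncomputable def schwartzH2 {n : ℕ} (φ : 𝓢(Rn n, ℂ)) : H2 n :=
  ⟨toL2 φ, mem_H2_of_laplacian_eq (u := toL2 φ) (g := toL2 (Δ φ)) (laplacian_toLp φ)⟩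

theorem laplacianH2_schwartzH2 {n : ℕ} (φ : 𝓢(Rn n, ℂ)) :
    laplacianH2 n (schwartzH2 φ) = toL2 (Δ φ) :=
  (laplacianH2_eq_iff _ _).2 (laplacian_toLp φ)

/-- The inner product of `ℂ` as a real bilinear map. -/
noncomputable def innerBilin : ℂ →L[ℝ] ℂ →L[ℝ] ℂ :=
  (ContinuousLinearMap.mul ℝ ℂ).comp (Complex.conjCLE : ℂ →L[ℝ] ℂ)

theorem innerBilin_apply (z w : ℂ) : innerBilin z w = inner ℂ z w := by
  simp [innerBilin, mul_comm]

theorem inner_laplacian_toLp {n : ℕ} (φ ψ : 𝓢(Rn n, ℂ)) :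
    inner ℂ (toL2 (Δ φ)) (toL2 ψ) = inner ℂ (toL2 φ) (toL2 (Δ ψ)) := by
  rw [SchwartzMap.inner_toL2_toL2_eq _ _ volume, SchwartzMap.inner_toL2_toL2_eq _ _ volume]
  simpa only [innerBilin_apply] using
    (SchwartzMap.integral_bilinear_laplacian_right_eq_left (μ := volume) φ ψ innerBilin).symm

open scoped LineDeriv in
/-- Dirichlet energy of a Schwartz function, by integration by parts. -/
theorem inner_laplacian_self {n : ℕ} (φ : 𝓢(Rn n, ℂ)) :
    inner ℂ (toL2 φ) (toL2 (Δ φ)) =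
      -((∑ i, ∫ x, ‖fderiv ℝ φ x (EuclideanSpace.single i 1)‖ ^ 2 : ℝ) : ℂ) := by
  rw [SchwartzMap.inner_toL2_toL2_eq _ _ volume]
  simp_rw [SchwartzMap.laplacian_eq_sum (EuclideanSpace.basisFun (Fin n) ℝ), sum_apply,
    inner_sum]
  rw [integral_finsetSum]
  · push_cast
    rw [← Finset.sum_neg_distrib]
    refine Finset.sum_congr rfl fun i _ => ?_
    have := SchwartzMap.integral_bilinear_lineDerivOp_right_eq_neg_left (μ := volume) φ
      (∂_{EuclideanSpace.basisFun (Fin n) ℝ i} φ) innerBilin (EuclideanSpace.basisFun (Fin n) ℝ i)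
    simp only [innerBilin_apply] at this
    rw [this, ← integral_complex_ofReal]
    congr 1
    refine integral_congr_ae (Eventually.of_forall fun x => ?_)
    simp only
    rw [inner_self_eq_norm_sq_to_K, SchwartzMap.lineDerivOp_apply_eq_fderiv,
      EuclideanSpace.basisFun_apply]
    push_cast
    rfl
  · intro i _
    have := (SchwartzMap.pairing innerBilin φ
      (∂_{EuclideanSpace.basisFun (Fin n) ℝ i}
        (∂_{EuclideanSpace.basisFun (Fin n) ℝ i} φ))).integrable (μ := volume)
    refine this.congr (Eventually.of_forall fun x => ?_)
    simp [SchwartzMap.pairing_apply_apply, innerBilin_apply]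

theorem re_inner_laplacian_nonpos {n : ℕ} (φ : 𝓢(Rn n, ℂ)) :
    (inner ℂ (toL2 φ) (toL2 (Δ φ))).re ≤ 0 := by
  rw [inner_laplacian_self, Complex.neg_re, Complex.ofReal_re, neg_nonpos]
  exact Finset.sum_nonneg fun i _ => integral_nonneg fun x => by positivity

/-- `1 - cΔ` does not decrease the `L²` norm, because `-Δ` is nonnegative. -/
theorem norm_le_norm_sub_laplacian {n : ℕ} {c : ℝ} (hc : 0 ≤ c) (φ : 𝓢(Rn n, ℂ)) :
    ‖(toL2 φ)‖ ≤ ‖(toL2 φ) - (c : ℂ) • toL2 (Δ φ)‖ := by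
  set u : L2 n := toL2 φ
  set w : L2 n := toL2 (Δ φ)
  have h1 : (inner ℂ u (u - (c : ℂ) • w)).re = ‖u‖ ^ 2 - c * (inner ℂ u w).re := by
    rw [inner_sub_right, inner_smul_right, Complex.sub_re, inner_self_eq_norm_sq_to_K,
      Complex.re_ofReal_mul]
    norm_cast
  have h2 := (Complex.re_le_norm _).trans (norm_inner_le_norm (𝕜 := ℂ) u (u - (c : ℂ) • w))
  have h3 : (inner ℂ u w).re ≤ 0 := re_inner_laplacian_nonpos φ
  have h4 : ‖u‖ * ‖u‖ ≤ ‖u‖ * ‖u - (c : ℂ) • w‖ := by nlinarith [mul_nonneg hc (neg_nonneg.2 h3)]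
  by_contra hlt
  push Not at hlt
  have : 0 < ‖u‖ := (norm_nonneg _).trans_lt hlt
  nlinarith

/-- The distributional Laplacian is closed on `L²`. -/
theorem laplacian_eq_of_tendsto {n : ℕ} {u w : ℕ → L2 n} {u' w' : L2 n}
    (hu : Tendsto u atTop (𝓝 u')) (hw : Tendsto w atTop (𝓝 w'))
    (h : ∀ j, Δ (u j : 𝓢'(Rn n, ℂ)) = (w j : 𝓢'(Rn n, ℂ))) :
    Δ (u' : 𝓢'(Rn n, ℂ)) = (w' : 𝓢'(Rn n, ℂ)) := by
  have hcont := (Lp.toTemperedDistributionCLM ℂ (volume : Measure (Rn n)) 2).continuous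
  have h1 := ((LineDeriv.laplacianCLM ℂ (Rn n) 𝓢'(Rn n, ℂ)).continuous.tendsto _).comp
    ((hcont.tendsto u').comp hu)
  have h2 := (hcont.tendsto _).comp hw
  have := tendsto_nhds_unique (h1.congr fun j => ?_) h2
  · rw [TemperedDistribution.laplacianCLM_apply] at this
    exact this
  · simp only [Function.comp]
    rw [TemperedDistribution.laplacianCLM_apply, Lp.toTemperedDistributionCLM_apply, h,
      Lp.toTemperedDistributionCLM_apply]

open TemperedDistribution in
/-- Schwartz functions are dense in `H²` for the graph norm of the Laplacian. -/
theorem exists_schwartz_tendsto {n : ℕ} (u : H2 n) :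
    ∃ v : ℕ → 𝓢(Rn n, ℂ), Tendsto (fun j => (toL2 (v j))) atTop (𝓝 u) ∧
      Tendsto (fun j => (toL2 (Δ (v j)))) atTop (𝓝 (laplacianH2 n u)) := by
  set c : ℝ := ((2 * Real.pi) ^ 2)⁻¹
  have hc : 0 < c := by positivity
  obtain ⟨F, hF⟩ : MemSobolev 2 2 ((u : L2 n) : 𝓢'(Rn n, ℂ)) := u.2
  have hF' : F = u - (c : ℂ) • laplacianH2 n u := by
    apply toTemperedDistribution_injective
    rw [← hF, besselPotential_two_apply, ← coe_laplacianH2,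
      ← Lp.toTemperedDistributionCLM_apply (p := 2), ← Lp.toTemperedDistributionCLM_apply (p := 2),
      ← Lp.toTemperedDistributionCLM_apply (p := 2), map_sub, map_smul]
  obtain ⟨f, hf⟩ : ∃ f : ℕ → 𝓢(Rn n, ℂ), Tendsto (fun j => (toL2 (f j))) atTop (𝓝 F) := by
    have hd := SchwartzMap.denseRange_toLpCLM (E := Rn n) (F := ℂ) (p := 2) (μ := volume) (by simp)
    obtain ⟨x, hx, hlim⟩ := mem_closure_iff_seq_limit.1 (hd F)
    choose f hf using hx
    refine ⟨f, ?_⟩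
    convert! hlim using 2 with j
    rw [← hf]; rfl
  -- `u` lies in `H²` iff `F = (1 - cΔ)u` lies in `L²`: approximate `F`, then
  -- invert `1 - cΔ` on Schwartz functions with the Bessel potential of order `-2`
  have hinv : ∀ g : 𝓢(Rn n, ℂ), ∃ w : 𝓢(Rn n, ℂ), (toL2 w) - (c : ℂ) • toL2 (Δ w) = toL2 g := by
    intro g
    refine ⟨SchwartzMap.fourierMultiplierCLM ℂ
      (fun x : Rn n => (((1 + ‖x‖ ^ 2) ^ ((-2 : ℝ) / 2) : ℝ) : ℂ)) g, ?_⟩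
    set w := SchwartzMap.fourierMultiplierCLM ℂ
      (fun x : Rn n => (((1 + ‖x‖ ^ 2) ^ ((-2 : ℝ) / 2) : ℝ) : ℂ)) g with hw
    have h1 : besselPotential (Rn n) ℂ (-2) (g : 𝓢'(Rn n, ℂ)) = (w : 𝓢'(Rn n, ℂ)) := by
      rw [besselPotential, fourierMultiplierCLM_toTemperedDistributionCLM_eq (by fun_prop)]
    apply toTemperedDistribution_injective
    rw [besselPotential_neg_apply_eq_iff, besselPotential_two_apply] at h1
    rw [← Lp.toTemperedDistributionCLM_apply (p := 2), map_sub, map_smul]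
    simp only [Lp.toTemperedDistributionCLM_apply, Lp.toTemperedDistribution_toLp_eq]
    rw [← h1, laplacian_toTemperedDistributionCLM_eq]
  choose w hw using hinv
  have hsub : ∀ a b : 𝓢(Rn n, ℂ), ‖(toL2 (w a)) - toL2 (w b)‖ ≤
      ‖(toL2 a) - toL2 b‖ := by
    intro a b
    have hlin : ∀ p q : 𝓢(Rn n, ℂ), (toL2 (p - q)) = toL2 p - toL2 q := fun p q =>
      map_sub (SchwartzMap.toLpCLM ℂ ℂ 2 (volume : Measure (Rn n))) p q
    have hΔ : Δ (w a - w b) = Δ (w a) - Δ (w b) := by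
      rw [← SchwartzMap.laplacianCLM_eq (𝕜 := ℂ), map_sub, SchwartzMap.laplacianCLM_eq,
        SchwartzMap.laplacianCLM_eq]
    have := norm_le_norm_sub_laplacian hc.le (w a - w b)
    rw [hΔ, hlin, hlin] at this
    refine this.trans_eq ?_
    rw [← hw a, ← hw b, smul_sub]
    congr 1
    abel
  have hcau : CauchySeq fun j => (toL2 (w (f j))) := by
    rw [Metric.cauchySeq_iff']
    intro ε hε
    obtain ⟨N, hN⟩ := Metric.cauchySeq_iff'.1 hf.cauchySeq ε hε
    refine ⟨N, fun m hm => ?_⟩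
    rw [dist_eq_norm]
    refine (hsub _ _).trans_lt ?_
    rw [← dist_eq_norm]
    exact hN m hm
  obtain ⟨u', hu'⟩ := cauchySeq_tendsto_of_complete hcau
  have hΔ : Tendsto (fun j => (toL2 (Δ (w (f j))))) atTop
      (𝓝 ((c : ℂ)⁻¹ • (u' - F))) := by
    have := (hu'.sub hf).const_smul ((c : ℂ)⁻¹)
    refine this.congr fun j => ?_
    rw [← hw (f j), sub_sub_cancel, smul_smul, inv_mul_cancel₀ (by exact_mod_cast hc.ne'), one_smul]
  have hlim : Δ (u' : 𝓢'(Rn n, ℂ)) = (((c : ℂ)⁻¹ • (u' - F) : L2 n) : 𝓢'(Rn n, ℂ)) :=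
    laplacian_eq_of_tendsto hu' hΔ fun j => laplacian_toLp _
  have huu : u' = u := by
    apply toTemperedDistribution_injective
    have hb : besselPotential (Rn n) ℂ 2 (u' : 𝓢'(Rn n, ℂ)) = F := by
      rw [besselPotential_two_apply, hlim,
        ← Lp.toTemperedDistributionCLM_apply (p := 2),
        ← Lp.toTemperedDistributionCLM_apply (p := 2),
        ← Lp.toTemperedDistributionCLM_apply (p := 2), ← map_smul, ← map_sub, smul_smul,
        mul_inv_cancel₀ (by exact_mod_cast hc.ne'), one_smul, sub_sub_cancel]
    rw [← besselPotential_neg_apply_eq_iff] at hb hF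
    rw [← hb, ← hF]
  refine ⟨fun j => w (f j), huu ▸ hu', ?_⟩
  convert! hΔ using 2
  rw [huu, hF', sub_sub_cancel, smul_smul, inv_mul_cancel₀ (by exact_mod_cast hc.ne'), one_smul]

theorem inner_laplacianH2 {n : ℕ} (u v : H2 n) :
    inner ℂ (laplacianH2 n u) (v : L2 n) = inner ℂ (u : L2 n) (laplacianH2 n v) := by
  obtain ⟨a, ha, ha'⟩ := exists_schwartz_tendsto u
  obtain ⟨b, hb, hb'⟩ := exists_schwartz_tendsto v
  exact tendsto_nhds_unique ((ha'.inner hb).congr fun j => inner_laplacian_toLp _ _) (ha.inner hb')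

end SemiclassicalResolvent


/-! ### Existence of the resolvent off the real axis -/

namespace SemiclassicalResolvent

/-- `P(h) = -h²Δ + V` as a linear map on `H²`. -/
noncomputable def schrodingerH2 {n : ℕ} (h : ℝ) (V : LInfty n) : H2 n →ₗ[ℂ] L2 n :=
  -((h : ℂ) ^ 2) • laplacianH2 n + (mulOp V : L2 n →ₗ[ℂ] L2 n) ∘ₗ (H2 n).subtype

theorem schrodingerH2_apply {n : ℕ} (h : ℝ) (V : LInfty n) (u : H2 n) :
    schrodingerH2 h V u = -((h : ℂ) ^ 2) • laplacianH2 n u + mulOp V (u : L2 n) := rfl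

theorem inner_mulOp {n : ℕ} (w : LInfty n) (u v : L2 n) :
    inner ℂ (mulOp w u) v = inner ℂ u (mulOp w v) := by
  rw [L2.inner_def, L2.inner_def]
  refine integral_congr_ae ?_
  filter_upwards [coeFn_mulOp w u, coeFn_mulOp w v] with x h1 h2
  rw [h1, h2]
  simp only [RCLike.inner_apply, map_mul, Complex.conj_ofReal]
  ring

theorem inner_schrodingerH2 {n : ℕ} (h : ℝ) (V : LInfty n) (u v : H2 n) :
    inner ℂ (schrodingerH2 h V u) (v : L2 n) = inner ℂ (u : L2 n) (schrodingerH2 h V v) := by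
  rw [schrodingerH2_apply, schrodingerH2_apply, inner_add_left, inner_add_right, inner_smul_left,
    inner_smul_right, inner_mulOp, inner_laplacianH2]
  simp

/-- The imaginary part of the quadratic form of `P(h) - z` is `-Im z ‖u‖²`. -/
theorem im_inner_schrodinger_sub {n : ℕ} (h : ℝ) (V : LInfty n) (z : ℂ) (u : H2 n) :
    (inner ℂ (u : L2 n) (schrodingerH2 h V u - z • (u : L2 n))).im = -z.im * ‖(u : L2 n)‖ ^ 2 := by
  have h1 : (inner ℂ (u : L2 n) (schrodingerH2 h V u)).im = 0 := by
    have := inner_schrodingerH2 h V u u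
    rw [← inner_conj_symm] at this
    exact Complex.conj_eq_iff_im.1 this
  rw [inner_sub_right, inner_smul_right, Complex.sub_im, h1, inner_self_eq_norm_sq_to_K]
  simp [← Complex.ofReal_pow]

/-- `P(h) - z` is bounded below by `|Im z|`, because `P(h)` is symmetric. -/
theorem abs_im_mul_norm_le {n : ℕ} (h : ℝ) (V : LInfty n) (z : ℂ) (u : H2 n) :
    |z.im| * ‖(u : L2 n)‖ ≤ ‖schrodingerH2 h V u - z • (u : L2 n)‖ := by
  have h1 := im_inner_schrodinger_sub h V z u
  have h2 := (Complex.abs_im_le_norm _).trans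
    (norm_inner_le_norm (𝕜 := ℂ) (u : L2 n) (schrodingerH2 h V u - z • (u : L2 n)))
  rw [h1, abs_mul, abs_neg, abs_of_nonneg (sq_nonneg ‖(u : L2 n)‖)] at h2
  by_contra hlt
  push Not at hlt
  have : 0 < ‖(u : L2 n)‖ := by
    rcases (norm_nonneg (u : L2 n)).eq_or_lt with h0 | h0
    · rw [← h0, mul_zero] at hlt
      exact absurd hlt (norm_nonneg _).not_gt
    · exact h0
  nlinarith

/-- Complex conjugation of Schwartz functions. -/
noncomputable def conjSchwartz {n : ℕ} (ψ : 𝓢(Rn n, ℂ)) : 𝓢(Rn n, ℂ) :=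
  ψ.postcompCLM (Complex.conjCLE : ℂ →L[ℝ] ℂ)

theorem laplacian_conjSchwartz {n : ℕ} (ψ : 𝓢(Rn n, ℂ)) :
    Δ (conjSchwartz ψ) = conjSchwartz (Δ ψ) := by
  ext x
  rw [SchwartzMap.laplacian_apply]
  have h1 : (conjSchwartz ψ : Rn n → ℂ) = (Complex.conjCLE : ℂ →L[ℝ] ℂ) ∘ ψ := by
    funext y; simp [conjSchwartz]
  rw [h1, ContDiffAt.laplacian_CLM_comp_left]
  · simp [conjSchwartz, SchwartzMap.laplacian_apply]
  · exact (ψ.smooth 2).contDiffAt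

/-- The `L²` inner product with `ψ̄` is the distributional pairing with `ψ`. -/
theorem inner_toL2_conjSchwartz {n : ℕ} (ψ : 𝓢(Rn n, ℂ)) (v : L2 n) :
    inner ℂ (toL2 (conjSchwartz ψ)) v = (v : 𝓢'(Rn n, ℂ)) ψ := by
  rw [Lp.toTemperedDistribution_apply, L2.inner_def]
  refine integral_congr_ae ?_
  filter_upwards [(conjSchwartz ψ).coeFn_toLp 2 volume] with x hx
  rw [hx]
  simp [conjSchwartz, mul_comm]

/-- If `v ∈ L²` is orthogonal to the range of `P(h) - z`, then `P(h) v = z̄ v` as distributions. As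
`Δ v` is then in `L²`, it follows that `v ∈ H²`. -/
theorem laplacian_of_orthogonal {n : ℕ} {h : ℝ} (hh : h ≠ 0) (V : LInfty n) (z : ℂ) (v : L2 n)
    (hv : ∀ u : H2 n, inner ℂ (schrodingerH2 h V u - z • (u : L2 n)) v = 0) :
    Δ (v : 𝓢'(Rn n, ℂ)) =
      ((((h : ℂ) ^ 2)⁻¹ • (mulOp V v - (starRingEnd ℂ z) • v) : L2 n) : 𝓢'(Rn n, ℂ)) := by
  have hh' : (h : ℂ) ^ 2 ≠ 0 := by exact_mod_cast pow_ne_zero 2 hh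
  ext ψ
  rw [TemperedDistribution.laplacian_apply_apply, ← inner_toL2_conjSchwartz,
    ← inner_toL2_conjSchwartz, ← laplacian_conjSchwartz]
  have := hv (schwartzH2 (conjSchwartz ψ))
  rw [schrodingerH2_apply, laplacianH2_schwartzH2, inner_sub_left, inner_add_left, inner_smul_left,
    inner_smul_left, inner_mulOp] at this
  rw [inner_smul_right, inner_sub_right, inner_smul_right, eq_inv_mul_iff_mul_eq₀ hh']
  simp only [map_neg, map_pow, Complex.conj_ofReal] at this
  change _ + inner ℂ (toL2 (conjSchwartz ψ)) _ - _ * inner ℂ (toL2 (conjSchwartz ψ)) v = 0 at this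
  linear_combination -this

/-- For nonreal `z` the resolvent `(P(h) - z)⁻¹` exists: the range of `P(h) - z` is closed by the
bound `abs_im_mul_norm_le` and dense because the adjoint has no kernel. -/
theorem exists_isResolvent {n : ℕ} {h : ℝ} (hh : h ≠ 0) (V : LInfty n) {z : ℂ} (hz : z.im ≠ 0) :
    ∃ R : L2 n →L[ℂ] L2 n, IsResolvent (schrodinger h V) z R := by
  have hh' : (h : ℂ) ^ 2 ≠ 0 := by exact_mod_cast pow_ne_zero 2 hh
  have hz' : 0 < |z.im| := abs_pos.2 hz
  let T : H2 n →ₗ[ℂ] L2 n := schrodingerH2 h V - z • (H2 n).subtype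
  have hT : ∀ u : H2 n, T u = schrodingerH2 h V u - z • (u : L2 n) := fun u => rfl
  have hbound : ∀ u : H2 n, ‖(u : L2 n)‖ ≤ |z.im|⁻¹ * ‖T u‖ := fun u => by
    rw [← div_eq_inv_mul, le_div_iff₀' hz', hT]
    exact abs_im_mul_norm_le h V z u
  have hinj : Function.Injective T := by
    rw [injective_iff_map_eq_zero]
    intro u hu
    have := hbound u
    rw [hu, norm_zero, mul_zero] at this
    exact Subtype.ext (norm_le_zero_iff.1 this)
  have hclosed : IsClosed (LinearMap.range T : Set (L2 n)) := by
    rw [← isSeqClosed_iff_isClosed]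
    intro f f' hf hlim
    choose u hu using hf
    have hcau : CauchySeq fun j => (u j : L2 n) := by
      rw [Metric.cauchySeq_iff']
      intro ε hε
      obtain ⟨N, hN⟩ := Metric.cauchySeq_iff'.1 hlim.cauchySeq (|z.im| * ε) (by positivity)
      refine ⟨N, fun m hm => ?_⟩
      have h1 := hbound (u m - u N)
      rw [map_sub, hu, hu, ← dist_eq_norm, Submodule.coe_sub, ← dist_eq_norm] at h1
      calc _ ≤ _ := h1
        _ < |z.im|⁻¹ * (|z.im| * ε) := by gcongr; exact hN m hm
        _ = ε := by field_simp
    obtain ⟨u', hu'⟩ := cauchySeq_tendsto_of_complete hcau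
    have hlap : ∀ j, laplacianH2 n (u j) =
        ((h : ℂ) ^ 2)⁻¹ • (mulOp V (u j : L2 n) - z • (u j : L2 n) - f j) := by
      intro j
      rw [eq_inv_smul_iff₀ hh', ← hu j, hT, schrodingerH2_apply, neg_smul]
      abel
    have hΔ : Tendsto (fun j => laplacianH2 n (u j)) atTop
        (𝓝 (((h : ℂ) ^ 2)⁻¹ • (mulOp V u' - z • u' - f'))) := by
      simp_rw [hlap]
      exact (((((mulOp V).continuous.tendsto u').comp hu').sub (hu'.const_smul z)).sub
        hlim).const_smul _
    have hΔ' := laplacian_eq_of_tendsto hu' hΔ fun j => (coe_laplacianH2 (u j)).symm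
    refine ⟨⟨u', mem_H2_of_laplacian_eq hΔ'⟩, ?_⟩
    rw [hT, schrodingerH2_apply, (laplacianH2_eq_iff ⟨u', mem_H2_of_laplacian_eq hΔ'⟩ _).2 hΔ',
      smul_smul, neg_mul, mul_inv_cancel₀ hh', neg_one_smul]
    simp only
    abel
  have hdense : LinearMap.range T = ⊤ := by
    have : (LinearMap.range T).topologicalClosure = LinearMap.range T :=
      hclosed.submodule_topologicalClosure_eq
    rw [← this, Submodule.topologicalClosure_eq_top_iff, Submodule.eq_bot_iff]
    intro v hv
    have hort : ∀ u : H2 n, inner ℂ (schrodingerH2 h V u - z • (u : L2 n)) v = 0 := fun u =>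
      (Submodule.mem_orthogonal _ v).1 hv _ ⟨u, hT u⟩
    have hΔ := laplacian_of_orthogonal hh V z v hort
    have h1 := abs_im_mul_norm_le h V (starRingEnd ℂ z) ⟨v, mem_H2_of_laplacian_eq hΔ⟩
    rw [schrodingerH2_apply, (laplacianH2_eq_iff ⟨v, mem_H2_of_laplacian_eq hΔ⟩ _).2 hΔ,
      smul_smul, neg_mul, mul_inv_cancel₀ hh', neg_one_smul] at h1
    simp only [neg_sub, sub_add_cancel, sub_self, norm_zero, Complex.conj_im, abs_neg] at h1
    have : ‖v‖ ≤ 0 := by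
      by_contra hlt
      push Not at hlt
      exact absurd h1 (by positivity : 0 < |z.im| * ‖v‖).not_ge
    exact norm_le_zero_iff.1 this
  let e : H2 n ≃ₗ[ℂ] L2 n := LinearEquiv.ofBijective T ⟨hinj, LinearMap.range_eq_top.1 hdense⟩
  have he : ∀ u, e u = T u := fun u => rfl
  refine ⟨LinearMap.mkContinuous ((H2 n).subtype ∘ₗ e.symm.toLinearMap) |z.im|⁻¹ fun f => ?_,
    fun f => ⟨(e.symm f).2, ?_⟩, fun u => ?_⟩
  · have := hbound (e.symm f)
    rwa [← he, e.apply_symm_apply] at this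
  · exact (hT (e.symm f)).symm.trans (e.apply_symm_apply f)
  · exact congrArg Subtype.val (e.symm_apply_apply u)

end SemiclassicalResolvent


/-! ### Polar coordinates and rotations -/

namespace SemiclassicalResolvent

/-- The radial part `volumeIoiPow k` of Lebesgue measure in polar coordinates is `r^k dr`. -/
theorem integral_volumeIoiPow (k : ℕ) (F : ℝ → ℝ) :
    ∫ r : Set.Ioi (0 : ℝ), F r ∂(Measure.volumeIoiPow k) =
      ∫ r in Set.Ioi (0 : ℝ), r ^ k * F r := by
  simp only [Measure.volumeIoiPow, ENNReal.ofReal]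
  rw [integral_withDensity_eq_integral_smul,
    integral_subtype_comap measurableSet_Ioi fun a : ℝ => Real.toNNReal (a ^ k) • F a,
    setIntegral_congr_fun measurableSet_Ioi fun x hx => ?_]
  · rw [NNReal.smul_def, Real.coe_toNNReal _ (pow_nonneg hx.out.le _), smul_eq_mul]
  · exact (measurable_subtype_coe.pow_const _).real_toNNReal

theorem integrable_volumeIoiPow_iff (k : ℕ) (F : ℝ → ℝ) :
    Integrable (fun r : Set.Ioi (0 : ℝ) => F r) (Measure.volumeIoiPow k) ↔
      IntegrableOn (fun r => r ^ k * F r) (Set.Ioi 0) := by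
  rw [integrableOn_iff_comap_subtypeVal measurableSet_Ioi, Measure.volumeIoiPow,
    integrable_withDensity_iff_integrable_smul']
  · refine integrable_congr (Eventually.of_forall ?_)
    rintro ⟨x, hx : 0 < x⟩
    simp [ENNReal.toReal_ofReal (pow_nonneg hx.le k)]
  · fun_prop
  · simp

theorem ae_volumeIoiPow {k : ℕ} {p : ℝ → Prop}
    (h : ∀ᵐ r : Set.Ioi (0 : ℝ) ∂(Measure.volumeIoiPow k), p r) :
    ∀ᵐ r ∂(volume.restrict (Set.Ioi (0 : ℝ))), p r := by
  rw [Measure.volumeIoiPow, ae_withDensity_iff (by fun_prop)] at h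
  rw [ae_restrict_iff_subtype measurableSet_Ioi]
  filter_upwards [h] with r hr
  exact hr (by simpa using pow_pos r.2 k)

variable {n : ℕ}

/-- The surface measure of the unit sphere of `ℝⁿ`. -/
noncomputable abbrev sphereMeasure (n : ℕ) : Measure (Metric.sphere (0 : Rn n) 1) :=
  (volume : Measure (Rn n)).toSphere

theorem polar_measurePreserving (hn : 1 ≤ n) :
    MeasurePreserving (fun x : ({0}ᶜ : Set (Rn n)) => homeomorphUnitSphereProd (Rn n) x)
      ((volume : Measure (Rn n)).comap Subtype.val)
      ((sphereMeasure n).prod (Measure.volumeIoiPow (n - 1))) := by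
  have : Nonempty (Fin n) := ⟨⟨0, hn⟩⟩
  simpa using (volume : Measure (Rn n)).measurePreserving_homeomorphUnitSphereProd

theorem smul_polar (x : ({0}ᶜ : Set (Rn n))) :
    ((homeomorphUnitSphereProd (Rn n) x).2 : ℝ) • ((homeomorphUnitSphereProd (Rn n) x).1 : Rn n)
      = x := by
  have := homeomorphUnitSphereProd_symm_apply_coe (Rn n) (homeomorphUnitSphereProd (Rn n) x)
  rw [Homeomorph.symm_apply_apply] at this
  exact this.symm

theorem restrict_compl_zero (hn : 1 ≤ n) :
    (volume : Measure (Rn n)).restrict {0}ᶜ = volume := by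
  have : Nonempty (Fin n) := ⟨⟨0, hn⟩⟩
  exact restrict_compl_singleton 0

/-- A property that holds almost everywhere in `ℝⁿ` holds almost everywhere on almost every ray. -/
theorem ae_ray_of_ae (hn : 1 ≤ n) {p : Rn n → Prop} (h : ∀ᵐ x, p x) :
    ∀ᵐ ω : Metric.sphere (0 : Rn n) 1 ∂(sphereMeasure n),
      ∀ᵐ r ∂(volume.restrict (Set.Ioi (0 : ℝ))), p (r • (ω : Rn n)) := by
  have h1 : ∀ᵐ x : ({0}ᶜ : Set (Rn n)) ∂(volume.comap Subtype.val), p x := by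
    rw [← ae_restrict_iff_subtype (measurableSet_singleton (0 : Rn n)).compl,
      restrict_compl_zero hn]
    exact h
  have h2 : ∀ᵐ z ∂((sphereMeasure n).prod (Measure.volumeIoiPow (n - 1))),
      p ((z.2 : ℝ) • (z.1 : Rn n)) := by
    rw [← (polar_measurePreserving hn).map_eq,
      (Homeomorph.measurableEmbedding _).ae_map_iff]
    filter_upwards [h1] with x hx
    rwa [smul_polar]
  filter_upwards [Measure.ae_ae_of_ae_prod h2] with ω hω
  exact ae_volumeIoiPow (p := fun r => p (r • (ω : Rn n))) hω

/-- Integration in polar coordinates: nonnegative ray integrals give a nonnegative integral. The ray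
integrals have to be considered only where they converge, which is almost everywhere. -/
theorem integral_nonneg_of_rays (hn : 1 ≤ n) {J : Rn n → ℝ} (hJ : Integrable J)
    (h : ∀ᵐ ω : Metric.sphere (0 : Rn n) 1 ∂(sphereMeasure n),
      IntegrableOn (fun r : ℝ => r ^ (n - 1) * J (r • (ω : Rn n))) (Set.Ioi 0) →
      0 ≤ ∫ r in Set.Ioi (0 : ℝ), r ^ (n - 1) * J (r • (ω : Rn n))) :
    0 ≤ ∫ x, J x := by
  have hmp := polar_measurePreserving hn
  have hemb : MeasurableEmbedding
      (fun x : ({0}ᶜ : Set (Rn n)) => homeomorphUnitSphereProd (Rn n) x) :=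
    Homeomorph.measurableEmbedding _
  set H : Metric.sphere (0 : Rn n) 1 × Set.Ioi (0 : ℝ) → ℝ :=
    fun z => J ((z.2 : ℝ) • (z.1 : Rn n)) with hH
  have hHJ : ∀ x : ({0}ᶜ : Set (Rn n)), H (homeomorphUnitSphereProd (Rn n) x) = J x := fun x => by
    simp only [hH, smul_polar]
  have h1 : ∫ x, J x = ∫ z, H z ∂((sphereMeasure n).prod (Measure.volumeIoiPow (n - 1))) := by
    rw [← hmp.integral_comp hemb]
    simp only [hHJ]
    rw [integral_subtype_comap (measurableSet_singleton (0 : Rn n)).compl J, restrict_compl_zero hn]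
  have h2 : Integrable H ((sphereMeasure n).prod (Measure.volumeIoiPow (n - 1))) := by
    rw [← hmp.integrable_comp_emb hemb]
    have : H ∘ (fun x : ({0}ᶜ : Set (Rn n)) => homeomorphUnitSphereProd (Rn n) x) =
        J ∘ Subtype.val := by
      funext x; exact hHJ x
    rw [this, ← integrableOn_iff_comap_subtypeVal (measurableSet_singleton (0 : Rn n)).compl,
      IntegrableOn, restrict_compl_zero hn]
    exact hJ
  rw [h1, integral_prod _ h2]
  refine integral_nonneg_of_ae ?_
  filter_upwards [h, h2.prod_right_ae] with ω hω hi
  have hi' := (integrable_volumeIoiPow_iff (n - 1) fun r => J (r • (ω : Rn n))).1 hi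
  have := hω hi'
  rwa [← integral_volumeIoiPow (n - 1) fun r => J (r • (ω : Rn n))] at this

/-- If a measure preserving flow transports `F` with derivative `F'` along the orbits, then
`∫ F' = 0`. -/
theorem integral_flow_deriv_eq_zero {R : ℝ → Rn n → Rn n} (hR0 : ∀ x, R 0 x = x)
    (hRc : Continuous fun p : ℝ × Rn n => R p.1 p.2)
    (hRm : ∀ t, MeasurePreserving (R t)) {F F' : Rn n → ℝ} (hF : Integrable F)
    (hF' : Integrable F') (hF'm : Measurable F')
    (hd : ∀ᵐ x, ∀ t, HasDerivAt (fun t => F (R t x)) (F' (R t x)) t)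
    (hc : ∀ᵐ x, Continuous fun t => F' (R t x)) : ∫ x, F' x = 0 := by
  have hcomp : ∀ t (G : Rn n → ℝ), AEStronglyMeasurable G volume →
      ∫ x, G (R t x) = ∫ x, G x := by
    intro t G hG
    have := integral_map (hRm t).aemeasurable (f := G) (by rwa [(hRm t).map_eq])
    rw [(hRm t).map_eq] at this
    exact this.symm
  have hint : Integrable (fun p : ℝ × Rn n => F' (R p.1 p.2))
      ((volume.restrict (Set.Ioc (0 : ℝ) 1)).prod volume) := by
    refine (integrable_prod_iff (hF'm.comp hRc.measurable).aestronglyMeasurable).2 ?_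
    refine ⟨Eventually.of_forall fun t => (hRm t).integrable_comp_of_integrable hF', ?_⟩
    have : (fun t => ∫ y, ‖F' (R t y)‖) = fun _ => ∫ y, ‖F' y‖ := by
      funext t
      exact hcomp t _ hF'.norm.aestronglyMeasurable
    change Integrable (fun t => ∫ y, ‖F' (R t y)‖) _
    rw [this]
    exact integrable_const _
  have h1 : ∫ t in Set.Ioc (0 : ℝ) 1, ∫ x, F' (R t x) = ∫ x, F' x := by
    have e : (fun t => ∫ x, F' (R t x)) = fun _ => ∫ x, F' x :=
      funext fun t => hcomp t F' hF'.aestronglyMeasurable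
    rw [e]
    simp
  have h2 : ∫ t in Set.Ioc (0 : ℝ) 1, ∫ x, F' (R t x) = 0 := by
    rw [integral_integral_swap hint]
    have : ∀ᵐ x, ∫ t in Set.Ioc (0 : ℝ) 1, F' (R t x) = F (R 1 x) - F x := by
      filter_upwards [hd, hc] with x hx hx'
      rw [← intervalIntegral.integral_of_le zero_le_one,
        intervalIntegral.integral_eq_sub_of_hasDerivAt (fun t _ => hx t)
          (hx'.intervalIntegrable _ _), hR0]
    have hF1 : Integrable fun x => F (R 1 x) := (hRm 1).integrable_comp_of_integrable hF
    rw [integral_congr_ae this, integral_sub hF1 hF, hcomp 1 F hF.aestronglyMeasurable, sub_self]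
  -- both computations evaluate the space-time integral of `F'` over `0 ≤ t ≤ 1`
  rw [← h1, h2]

/-- The infinitesimal rotation `x ↦ xᵢ eⱼ - xⱼ eᵢ`. -/
noncomputable def rotGen (i j : Fin n) : Rn n →L[ℝ] Rn n :=
  (EuclideanSpace.proj i).smulRight (EuclideanSpace.single j (1 : ℝ)) -
    (EuclideanSpace.proj j).smulRight (EuclideanSpace.single i (1 : ℝ))

theorem rotGen_apply (i j : Fin n) (x : Rn n) :
    rotGen i j x = x i • EuclideanSpace.single j (1 : ℝ) - x j • EuclideanSpace.single i (1 : ℝ) :=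
  rfl

theorem inner_rotGen_self (i j : Fin n) (x : Rn n) : inner ℝ x (rotGen i j x) = 0 := by
  rw [rotGen_apply, inner_sub_right, inner_smul_right, inner_smul_right,
    EuclideanSpace.inner_single_right, EuclideanSpace.inner_single_right]
  simp
  ring

theorem norm_rotGen_le (i j : Fin n) (x : Rn n) : ‖rotGen i j x‖ ≤ 2 * ‖x‖ := by
  rw [rotGen_apply]
  refine (norm_sub_le _ _).trans ?_
  simp only [norm_smul, PiLp.norm_single, norm_one, mul_one]
  linarith [PiLp.norm_apply_le x i, PiLp.norm_apply_le x j]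

/-- The rotation by the angle `t` in the `(i, j)`-plane, as a linear map. -/
noncomputable def rotFlow (i j : Fin n) (t : ℝ) : Rn n →L[ℝ] Rn n :=
  ContinuousLinearMap.id ℝ _ + Real.sin t • rotGen i j - (1 - Real.cos t) •
    ((EuclideanSpace.proj i).smulRight (EuclideanSpace.single i (1 : ℝ)) +
    (EuclideanSpace.proj j).smulRight (EuclideanSpace.single j (1 : ℝ)))

theorem rotFlow_apply (i j : Fin n) (t : ℝ) (x : Rn n) :
    rotFlow i j t x = x + Real.sin t • rotGen i j x - (1 - Real.cos t) •
      (x i • EuclideanSpace.single i (1 : ℝ) + x j • EuclideanSpace.single j (1 : ℝ)) := rfl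

theorem hasDerivAt_rotFlow {i j : Fin n} (hij : i ≠ j) (t : ℝ) (x : Rn n) :
    HasDerivAt (fun t => rotFlow i j t x) (rotGen i j (rotFlow i j t x)) t := by
  have h := (((Real.hasDerivAt_sin t).smul_const (rotGen i j x)).const_add x).sub
    (((Real.hasDerivAt_cos t).const_sub 1).smul_const
      (x i • EuclideanSpace.single i (1 : ℝ) + x j • EuclideanSpace.single j (1 : ℝ)))
  refine h.congr_deriv ?_
  rw [rotFlow_apply]
  ext k
  simp only [rotGen_apply, PiLp.add_apply, PiLp.sub_apply, PiLp.smul_apply, smul_eq_mul,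
    PiLp.single_apply]
  have hji := hij.symm
  by_cases hki : k = i <;> by_cases hkj : k = j <;> simp_all <;> ring

theorem norm_rotFlow {i j : Fin n} (hij : i ≠ j) (t : ℝ) (x : Rn n) :
    ‖rotFlow i j t x‖ = ‖x‖ := by
  have hd : ∀ t, HasDerivAt (fun t => ‖rotFlow i j t x‖ ^ 2) 0 t := fun t => by
    have := (hasDerivAt_rotFlow hij t x).norm_sq
    rwa [inner_rotGen_self, mul_zero] at this
  have h := is_const_of_deriv_eq_zero (fun t => (hd t).differentiableAt) (fun t => (hd t).deriv) t 0
  have h0 : rotFlow i j 0 x = x := by simp [rotFlow_apply]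
  rw [h0] at h
  exact (sq_eq_sq₀ (norm_nonneg _) (norm_nonneg _)).1 h

theorem measurePreserving_rotFlow {i j : Fin n} (hij : i ≠ j) (t : ℝ) :
    MeasurePreserving (fun x => rotFlow i j t x) := by
  let e : Rn n →ₗᵢ[ℝ] Rn n := ⟨(rotFlow i j t).toLinearMap, norm_rotFlow hij t⟩
  exact (e.toLinearIsometryEquiv rfl).measurePreserving

/-- The derivative of an integrable function along a rotation field has integral zero. The
derivative is required away from the origin only. -/
theorem integral_rotGen_deriv_eq_zero (hn : 1 ≤ n) {i j : Fin n} (hij : i ≠ j) {F F' : Rn n → ℝ}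
    (hF : Integrable F) (hF' : Integrable F') (hF'm : Measurable F')
    (hF'c : ContinuousOn F' {0}ᶜ)
    (hd : ∀ x : Rn n, x ≠ 0 → ∀ c : ℝ → Rn n, (∀ t, ‖c t‖ = ‖x‖) → ∀ t,
      HasDerivAt c (rotGen i j (c t)) t → HasDerivAt (fun t => F (c t)) (F' (c t)) t) :
    ∫ x, F' x = 0 := by
  have hne : ∀ᵐ x : Rn n, x ≠ 0 := by
    have : Nonempty (Fin n) := ⟨⟨0, hn⟩⟩
    exact compl_mem_ae_iff.2 (measure_singleton (0 : Rn n))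
  have hcont : Continuous fun p : ℝ × Rn n => rotFlow i j p.1 p.2 := by
    simp only [rotFlow_apply]
    fun_prop
  refine integral_flow_deriv_eq_zero (R := fun t x => rotFlow i j t x) (fun x => ?_) hcont
    (measurePreserving_rotFlow hij) hF hF' hF'm ?_ ?_
  · simp [rotFlow_apply]
  · filter_upwards [hne] with x hx t
    exact hd x hx (fun t => rotFlow i j t x) (fun t => norm_rotFlow hij t x) t
      (hasDerivAt_rotFlow hij t x)
  · filter_upwards [hne] with x hx
    refine hF'c.comp_continuous (by fun_prop) fun t => ?_
    rw [Set.mem_compl_singleton_iff, ← norm_ne_zero_iff, norm_rotFlow hij]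
    exact norm_ne_zero_iff.2 hx

end SemiclassicalResolvent


/-! ### The algebra of the radial energy -/

namespace SemiclassicalResolvent

variable {n : ℕ}

/-- The derivative of the radial energy, rewritten with the help of the equation. Here `a + bi`,
`a₁ + b₁i`, `a₂ + b₂i` are the function and its first two radial derivatives, `ν = 1/r`, and `γ`
is the logarithmic derivative of the square root of the density `ρ`. The variables `gr + gi i`,
`lr + li i`, `Nl` and `Pl` stand for the inhomogeneity, the angular Laplacian, the angular energy
and its radial derivative. The value of `m = n - 1` enters through the constant `c`, the
potential `m (m - 2) / 4` created by the substitution `r^(m/2) v`. -/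
theorem energy_deriv_identity
    {a b a₁ b₁ a₂ b₂ gr gi lr li Nl Pl ν γ γ' h E w w' S τ μ μ' ρ m φ' φ'' c : ℝ}
    (hφ' : φ' = h * (γ - m / 2 * ν)) (hφ'' : φ'' = h * (γ' + m / 2 * ν ^ 2))
    (hc : c = m * (m - 2) / 4)
    (hre : h ^ 2 * a₂ = (w + S - E) * a - τ * b - gr - h ^ 2 * (m * ν * a₁ + ν ^ 2 * lr))
    (him : h ^ 2 * b₂ = (w + S - E) * b + τ * a - gi - h ^ 2 * (m * ν * b₁ + ν ^ 2 * li)) :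
    (μ' * ρ + μ * (2 * γ * ρ)) * (h ^ 2 * ((γ * a + a₁) ^ 2 + (γ * b + b₁) ^ 2) +
        (E + φ' ^ 2 - w) * (a ^ 2 + b ^ 2) - ν ^ 2 * h ^ 2 * (Nl + c * (a ^ 2 + b ^ 2))) +
      μ * ρ * (2 * h ^ 2 * ((γ * a + a₁) * (γ' * a + γ * a₁ + a₂) +
        (γ * b + b₁) * (γ' * b + γ * b₁ + b₂)) + (2 * φ' * φ'' - w') * (a ^ 2 + b ^ 2) +
        (E + φ' ^ 2 - w) * (2 * (a * a₁ + b * b₁)) +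
        2 * ν ^ 3 * h ^ 2 * (Nl + c * (a ^ 2 + b ^ 2)) -
        ν ^ 2 * h ^ 2 * (Pl + 2 * c * (a * a₁ + b * b₁))) =
    ρ * (μ' * (h ^ 2 * ((γ * a + a₁) ^ 2 + (γ * b + b₁) ^ 2) +
          (E + φ' ^ 2 - w) * (a ^ 2 + b ^ 2)) +
        (2 * μ * ν - μ') * ν ^ 2 * h ^ 2 * (Nl + c * (a ^ 2 + b ^ 2)) +
        4 * h * μ * φ' * ((γ * a + a₁) ^ 2 + (γ * b + b₁) ^ 2) +
        2 * μ * φ' * φ'' * (a ^ 2 + b ^ 2) - μ * w' * (a ^ 2 + b ^ 2) +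
        2 * μ * (h * φ'' + S) * (a * (γ * a + a₁) + b * (γ * b + b₁)) -
        2 * τ * μ * (b * (γ * a + a₁) - a * (γ * b + b₁)) -
        2 * μ * (gr * (γ * a + a₁) + gi * (γ * b + b₁)) -
        μ * ν ^ 2 * h ^ 2 *
          (2 * (lr * (γ * a + a₁) + li * (γ * b + b₁)) + Pl + 2 * γ * Nl)) := by
  subst hφ' hφ'' hc
  linear_combination (2 * μ * ρ * (γ * a + a₁)) * hre + (2 * μ * ρ * (γ * b + b₁)) * him

/-- Absorption of the error terms in the derivative of the radial energy; `x` and `t` stand for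
the norms of the function and of its conjugated radial derivative. -/
theorem energy_absorb {x t p q g₁ e h E w w' S Sb τ μ μ' φ' φ'' : ℝ} (hh : 0 < h) (hμ : 0 < μ)
    (hμ' : 0 < μ') (hφ' : 0 ≤ φ')
    (hS : |S| ≤ Sb) {G : ℝ} (hp : |p| ≤ x * t) (hq : |q| ≤ x * t) (hG : |G| ≤ (g₁ + e) * t)
    (key : E / 4 * μ' + w * μ' + μ * w' +
      2 * (μ * (|φ''| + Sb / h)) ^ 2 / (μ' + 4 * φ' * μ / h) ≤
      E * μ' + φ' ^ 2 * μ' + 2 * μ * φ' * φ'') :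
    E / 4 * μ' * x ^ 2 - 2 / h ^ 2 * (μ ^ 2 / μ') * g₁ ^ 2 - 2 * μ * (e + |τ| * x) * t ≤
      μ' * (h ^ 2 * t ^ 2 + (E + φ' ^ 2 - w) * x ^ 2) + 4 * h * μ * φ' * t ^ 2 +
        2 * μ * φ' * φ'' * x ^ 2 - μ * w' * x ^ 2 + 2 * μ * (h * φ'' + S) * p -
        2 * τ * μ * q - 2 * μ * G := by
  set B : ℝ := μ' + 4 * φ' * μ / h with hB
  have hBpos : 0 < B := by positivity
  have hBμ : μ' ≤ B := by
    have : 0 ≤ 4 * φ' * μ / h := by positivity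
    linarith
  set D : ℝ := μ * (|φ''| + Sb / h) with hD
  have hBt : μ' * (h ^ 2 * t ^ 2) + 4 * h * μ * φ' * t ^ 2 = B * (h * t) ^ 2 := by
    rw [hB]; field_simp
  have hSb : 0 ≤ Sb := (abs_nonneg S).trans hS
  -- the gain `B (ht)²` is spent in two halves: on the cross term with `φ''` and `S`, and on `g₁`
  have h1 : -(2 * D * x * (h * t)) ≤ 2 * μ * (h * φ'' + S) * p := by
    have : |2 * μ * (h * φ'' + S) * p| ≤ 2 * μ * (h * |φ''| + Sb) * (x * t) := by
      rw [abs_mul, abs_mul, abs_of_pos (by positivity : 0 < 2 * μ)]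
      gcongr
      exact (abs_add_le _ _).trans (add_le_add (by rw [abs_mul, abs_of_pos hh]) hS)
    have h2 : 2 * D * x * (h * t) = 2 * μ * (h * |φ''| + Sb) * (x * t) := by
      rw [hD]; field_simp
    rw [h2]
    exact (abs_le.1 this).1
  have h3 : 2 * D * x * (h * t) ≤ B / 2 * (h * t) ^ 2 + 2 * D ^ 2 / B * x ^ 2 := by
    have : 0 ≤ (B * (h * t) - 2 * D * x) ^ 2 / (2 * B) := by positivity
    have e1 : (B * (h * t) - 2 * D * x) ^ 2 / (2 * B) =
        B / 2 * (h * t) ^ 2 + 2 * D ^ 2 / B * x ^ 2 - 2 * D * x * (h * t) := by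
      field_simp; ring
    linarith
  have h4 : 2 * μ * g₁ * t ≤ B / 2 * (h * t) ^ 2 + 2 / h ^ 2 * (μ ^ 2 / μ') * g₁ ^ 2 := by
    have : 0 ≤ (B * (h * t) - 2 * (μ * g₁ / h)) ^ 2 / (2 * B) := by positivity
    have e1 : (B * (h * t) - 2 * (μ * g₁ / h)) ^ 2 / (2 * B) =
        B / 2 * (h * t) ^ 2 + 2 / h ^ 2 * (μ ^ 2 / B) * g₁ ^ 2 - 2 * μ * g₁ * t := by
      field_simp; ring
    have : 2 / h ^ 2 * (μ ^ 2 / B) * g₁ ^ 2 ≤ 2 / h ^ 2 * (μ ^ 2 / μ') * g₁ ^ 2 := by gcongr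
    linarith
  have h5 : -(2 * μ * (|τ| * x) * t) ≤ -(2 * τ * μ * q) := by
    have : |2 * τ * μ * q| ≤ 2 * μ * (|τ| * x) * t := by
      rw [abs_mul, abs_mul, abs_mul, abs_of_pos hμ, abs_two]
      calc 2 * |τ| * μ * |q| ≤ 2 * |τ| * μ * (x * t) := by gcongr
        _ = _ := by ring
    linarith [(abs_le.1 this).2]
  have h6 : -(2 * μ * (g₁ + e) * t) ≤ -(2 * μ * G) := by
    have := mul_le_mul_of_nonneg_left (le_abs_self G |>.trans hG) (by positivity : 0 ≤ 2 * μ)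
    linarith
  have h7 := mul_le_mul_of_nonneg_right key (sq_nonneg x)
  nlinarith [h1, h3, h4, h5, h6, h7, hBt]

/-- The sum of all squared infinitesimal rotations, in terms of the trace and the radial part. -/
theorem sum_rotGen_hessian (H : Rn n →L[ℝ] Rn n →L[ℝ] ℂ) (L : Rn n →L[ℝ] ℂ) (x : Rn n) :
    ∑ i, ∑ j, (H (rotGen i j x) (rotGen i j x) + L (rotGen i j (rotGen i j x))) =
      2 * (‖x‖ ^ 2 * ∑ k, H (EuclideanSpace.single k 1) (EuclideanSpace.single k 1) - H x x -
        (n - 1) * L x) := by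
  have hx : x = ∑ k, x k • EuclideanSpace.single k (1 : ℝ) := by
    ext i
    simp [Pi.single_apply]
  set e : Fin n → Rn n := fun k => EuclideanSpace.single k (1 : ℝ) with he
  have hL : L x = ∑ k, x k * L (e k) := by
    conv_lhs => rw [hx]
    simp [he]
  have hHx : H x x = ∑ i, ∑ j, x i * (x j * H (e i) (e j)) := by
    have : ∀ y, H y x = ∑ j, x j * H y (e j) := fun y => by
      conv_lhs => rw [hx]
      simp [he]
    rw [this]
    have h2 : ∀ j, H x (e j) = ∑ i, x i * H (e i) (e j) := fun j => by
      conv_lhs => rw [hx]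
      simp [he]
    simp_rw [h2, Finset.mul_sum]
    rw [Finset.sum_comm]
    refine Finset.sum_congr rfl fun i _ => Finset.sum_congr rfl fun j _ => by ring
  have hnorm : ((‖x‖ ^ 2 : ℝ) : ℂ) = ∑ k, (x k : ℂ) ^ 2 := by
    rw [EuclideanSpace.norm_sq_eq]
    simp [sq_abs]
  have h1 : ∀ i j, H (rotGen i j x) (rotGen i j x) =
      (x i : ℂ) ^ 2 * H (e j) (e j) + (x j : ℂ) ^ 2 * H (e i) (e i)
        - x i * (x j * H (e i) (e j)) - x j * (x i * H (e j) (e i)) := by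
    intro i j
    rw [rotGen_apply]
    simp [he]
    ring
  have h2 : ∀ i j, L (rotGen i j (rotGen i j x)) =
      2 * (if i = j then (x i : ℂ) * L (e i) else 0) - x j * L (e j) - x i * L (e i) := by
    intro i j
    rw [rotGen_apply, rotGen_apply]
    by_cases hij : i = j
    · subst hij
      simp [he]
      ring
    · have hji : j ≠ i := fun h => hij h.symm
      simp [he, hij, hji]
  simp_rw [h1, h2]
  simp only [Finset.sum_add_distrib, Finset.sum_sub_distrib, ← Finset.mul_sum, Finset.sum_const,
    Finset.card_univ, Fintype.card_fin, Finset.sum_ite_eq, Finset.mem_univ, if_true,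
    ← Finset.sum_mul, nsmul_eq_mul]
  rw [hHx, hL]
  have hnorm' : (‖x‖ : ℂ) ^ 2 = ∑ k, (x k : ℂ) ^ 2 := by rw [← hnorm]; push_cast; rfl
  rw [hnorm']
  have hsw : ∑ i, (x i : ℂ) * ∑ j, x j * H (e i) (e j) =
      ∑ i, ∑ j, (x i : ℂ) * (x j * H (e i) (e j)) := by
    simp_rw [Finset.mul_sum]
  have hsw' : ∑ i, ∑ j, (x j : ℂ) * (x i * H (e j) (e i)) =
      ∑ i, ∑ j, (x i : ℂ) * (x j * H (e i) (e j)) :=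
    Finset.sum_comm
  have hn : ∑ i, (x i : ℂ) * (n * L (e i)) = n * ∑ i, (x i : ℂ) * L (e i) := by
    rw [Finset.mul_sum]
    exact Finset.sum_congr rfl fun i _ => by ring
  rw [hsw, hsw', hn]
  ring

end SemiclassicalResolvent


/-! ### The radial energy along a ray -/

namespace SemiclassicalResolvent

variable {n : ℕ}

/-- The radial multiplier `mu` and the radial phase `phi` of the Carleman estimate, with the
derivatives and the bounds that are used. They are defined for `r > 0` only. The constant `M` bounds
`mu`, `phi'` and `mu / r`, the constant `Φ` bounds the phase, and `c₁` is such that `mu'` is at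
least `c₁` times the square of the weight `(r+1)^(-s)` of the resolvent estimate. The condition
`mu' r ≤ 2 mu` gives the angular energy a favourable sign. -/
structure CarlemanWeight (s M c₁ Φ : ℝ) where
  (mu mu' phi phi' phi'' : ℝ → ℝ)
  hasDerivAt_mu : ∀ r, 0 < r → HasDerivAt mu (mu' r) r
  hasDerivAt_phi : ∀ r, 0 < r → HasDerivAt phi (phi' r) r
  hasDerivAt_phi' : ∀ r, 0 < r → HasDerivAt phi' (phi'' r) r
  mu_pos : ∀ r, 0 < r → 0 < mu r
  mu_le : ∀ r, 0 < r → mu r ≤ M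
  mu_le_mul : ∀ r, 0 < r → mu r ≤ M * r
  mu'_lower : ∀ r, 0 < r → c₁ * ((r + 1) ^ (-s)) ^ 2 ≤ mu' r
  mu'_mul_le : ∀ r, 0 < r → mu' r * r ≤ 2 * mu r
  phi_nonneg : ∀ r, 0 < r → 0 ≤ phi r
  phi_le : ∀ r, 0 < r → phi r ≤ Φ
  phi'_nonneg : ∀ r, 0 < r → 0 ≤ phi' r
  phi'_le : ∀ r, 0 < r → phi' r ≤ M

/-- The Hessian of a Schwartz function. -/
noncomputable abbrev hess (v : 𝓢(Rn n, ℂ)) (x : Rn n) : Rn n →L[ℝ] Rn n →L[ℝ] ℂ :=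
  fderiv ℝ (fderiv ℝ v) x

theorem hasFDerivAt_fderiv (v : 𝓢(Rn n, ℂ)) (x : Rn n) :
    HasFDerivAt (fderiv ℝ v) (hess v x) x :=
  (((v.smooth 2).fderiv_right (m := 1) (by norm_num)).differentiable (by norm_num) x).hasFDerivAt

theorem hess_symm (v : 𝓢(Rn n, ℂ)) (x y z : Rn n) : hess v x y z = hess v x z y :=
  ((v.smooth 2).contDiffAt.isSymmSndFDerivAt (by simp)).eq y z

open scoped LineDeriv in
theorem laplacian_apply_eq_sum_hess (v : 𝓢(Rn n, ℂ)) (x : Rn n) :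
    Δ v x = ∑ k, hess v x (EuclideanSpace.single k 1) (EuclideanSpace.single k 1) := by
  rw [SchwartzMap.laplacian_eq_sum (EuclideanSpace.basisFun (Fin n) ℝ), sum_apply]
  refine Finset.sum_congr rfl fun k _ => ?_
  rw [SchwartzMap.lineDerivOp_apply_eq_fderiv, EuclideanSpace.basisFun_apply]
  have : (⇑(∂_{EuclideanSpace.single k (1 : ℝ)} v : 𝓢(Rn n, ℂ)) : Rn n → ℂ) =
      fun y => fderiv ℝ v y (EuclideanSpace.single k 1) := by
    funext y
    exact SchwartzMap.lineDerivOp_apply_eq_fderiv _ _ _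
  rw [this, ((hasFDerivAt_fderiv v x).clm_apply (hasFDerivAt_const _ x)).fderiv]
  simp

/-- The derivative of `v` along an infinitesimal rotation. -/
noncomputable def rotD (i j : Fin n) (v : 𝓢(Rn n, ℂ)) (x : Rn n) : ℂ :=
  fderiv ℝ v x (rotGen i j x)

/-- The second derivative of `v` along an infinitesimal rotation. -/
noncomputable def rotD2 (i j : Fin n) (v : 𝓢(Rn n, ℂ)) (x : Rn n) : ℂ :=
  hess v x (rotGen i j x) (rotGen i j x) + fderiv ℝ v x (rotGen i j (rotGen i j x))

/-- The radial derivative of `rotD i j v`. -/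
noncomputable def rotDr (i j : Fin n) (v : 𝓢(Rn n, ℂ)) (x : Rn n) : ℂ :=
  ‖x‖⁻¹ • (hess v x x (rotGen i j x) + fderiv ℝ v x (rotGen i j x))

/-- The sum of the squares of all rotation fields is twice the spherical Laplacian. -/
theorem sum_rotD2 (v : 𝓢(Rn n, ℂ)) (x : Rn n) :
    ∑ i, ∑ j, rotD2 i j v x =
      2 * (‖x‖ ^ 2 * Δ v x - hess v x x x - (n - 1) * fderiv ℝ v x x) := by
  rw [laplacian_apply_eq_sum_hess]
  exact sum_rotGen_hessian _ _ _

variable {s M c₁ Φ : ℝ}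

/-- The logarithmic derivative of `r^((n-1)/2) e^(phi/h)`. -/
noncomputable def CarlemanWeight.gamma (w : CarlemanWeight s M c₁ Φ) (n : ℕ) (h r : ℝ) : ℝ :=
  (n - 1) / 2 * r⁻¹ + w.phi' r / h

/-- The radial derivative of `v` conjugated by `r^((n-1)/2) e^(phi/h)`. -/
noncomputable def CarlemanWeight.radD (w : CarlemanWeight s M c₁ Φ) (h : ℝ) (v : 𝓢(Rn n, ℂ))
    (x : Rn n) : ℂ :=
  w.gamma n h ‖x‖ • v x + ‖x‖⁻¹ • fderiv ℝ v x x

/-- The angular remainder of the radial energy, an exact derivative along a rotation. -/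
noncomputable def CarlemanWeight.rotRem (w : CarlemanWeight s M c₁ Φ) (h : ℝ) (v : 𝓢(Rn n, ℂ))
    (i j : Fin n) (x : Rn n) : ℝ :=
  inner ℝ (w.radD h v x) (rotD2 i j v x) +
    inner ℝ (rotD i j v x) (w.gamma n h ‖x‖ • rotD i j v x + rotDr i j v x)

/-- The radial energy of the conjugated function along the ray in the direction `ω`, multiplied
by `mu`. -/
noncomputable def CarlemanWeight.rayEnergy (w : CarlemanWeight s M c₁ Φ) (h E : ℝ) (W : Rn n → ℝ)
    (v : 𝓢(Rn n, ℂ)) (ω : Rn n) (r : ℝ) : ℝ :=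
  w.mu r * (r ^ (n - 1) * Real.exp (2 * w.phi r / h)) *
    (h ^ 2 * ‖w.radD h v (r • ω)‖ ^ 2 + (E + w.phi' r ^ 2 - W (r • ω)) * ‖v (r • ω)‖ ^ 2 -
      r⁻¹ ^ 2 * h ^ 2 * (1 / 2 * ∑ i, ∑ j, ‖rotD i j v (r • ω)‖ ^ 2 +
        ((n : ℝ) - 1) * (n - 1 - 2) / 4 * ‖v (r • ω)‖ ^ 2))

theorem complex_inner_eq (z w : ℂ) : inner ℝ z w = z.re * w.re + z.im * w.im := by
  rw [Complex.inner]
  simp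
  ring

theorem complex_norm_sq_eq (z : ℂ) : ‖z‖ ^ 2 = z.re ^ 2 + z.im ^ 2 := by
  rw [← Complex.normSq_eq_norm_sq, Complex.normSq_apply]
  ring

/-- Lower bound of the derivative of the radial energy, for an approximate solution `v` whose
inhomogeneity is bounded by `g₁ + e`. The term `g₁` is to be paid for with the gain in the radial
derivative; `e` is an error that need not decay. -/
theorem exists_hasDerivAt_rayEnergy (hn : 3 ≤ n) (w : CarlemanWeight s M c₁ Φ) (hc₁ : 0 < c₁)
    {h E : ℝ} (hh : 0 < h) {W : Rn n → ℝ} (v : 𝓢(Rn n, ℂ)) {ω : Rn n} (hω : ‖ω‖ = 1) {r : ℝ}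
    (hr : 0 < r) {W' : ℝ} (hW : HasDerivAt (fun r => W (r • ω)) W' r) {S Sb τ g₁ e : ℝ}
    (hS : |S| ≤ Sb)
    (hg : ‖-(h : ℂ) ^ 2 * Δ v (r • ω) +
      (((W (r • ω) + S - E : ℝ) : ℂ) + τ * Complex.I) * v (r • ω)‖ ≤ g₁ + e)
    (key : E / 4 * w.mu' r + W (r • ω) * w.mu' r + w.mu r * W' +
      2 * (w.mu r * (|w.phi'' r| + Sb / h)) ^ 2 / (w.mu' r + 4 * w.phi' r * w.mu r / h) ≤
      E * w.mu' r + w.phi' r ^ 2 * w.mu' r + 2 * w.mu r * w.phi' r * w.phi'' r) :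
    ∃ D, HasDerivAt (w.rayEnergy h E W v ω) D r ∧
      -D ≤ r ^ (n - 1) * Real.exp (2 * w.phi r / h) *
        (-(E / 4 * w.mu' r * ‖v (r • ω)‖ ^ 2) + 2 / h ^ 2 * (w.mu r ^ 2 / w.mu' r) * g₁ ^ 2 +
          2 * w.mu r * (e + |τ| * ‖v (r • ω)‖) * ‖w.radD h v (r • ω)‖ +
          w.mu r * r⁻¹ ^ 2 * h ^ 2 * ∑ i, ∑ j, w.rotRem h v i j (r • ω)) := by
  have hnorm : ∀ t, 0 < t → ‖t • ω‖ = t := fun t ht => by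
    rw [norm_smul, hω, mul_one, Real.norm_of_nonneg ht.le]
  have hline : ∀ t : ℝ, HasDerivAt (fun t : ℝ => t • ω) ω t := fun t => by
    simpa using (hasDerivAt_id t).smul_const ω
  have hX : HasDerivAt (fun t : ℝ => v (t • ω)) (fderiv ℝ v (r • ω) ω) r :=
    (v.differentiableAt.hasFDerivAt).comp_hasDerivAt r (hline r)
  have hX1 : HasDerivAt (fun t : ℝ => fderiv ℝ v (t • ω) ω) (hess v (r • ω) ω ω) r := by
    have := (hasFDerivAt_fderiv v (r • ω)).comp_hasDerivAt r (hline r)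
    simpa using this.clm_apply (hasDerivAt_const r ω)
  have hl : ∀ i j, HasDerivAt (fun t : ℝ => rotD i j v (t • ω)) (rotDr i j v (r • ω)) r := by
    intro i j
    have h1 := (hasFDerivAt_fderiv v (r • ω)).comp_hasDerivAt r (hline r)
    have h2 : HasDerivAt (fun t : ℝ => rotGen i j (t • ω)) (rotGen i j ω) r :=
      (rotGen i j).hasFDerivAt.comp_hasDerivAt r (hline r)
    refine (h1.clm_apply h2).congr_deriv ?_
    rw [rotDr, hnorm r hr]
    simp only [map_smul, smul_apply, smul_add, smul_smul, Function.comp]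
    rw [inv_mul_cancel₀ hr.ne', one_smul, ← mul_assoc, inv_mul_cancel₀ hr.ne', one_mul]
  set γ := w.gamma n h with hγ
  have hγ' : HasDerivAt γ (-((n - 1) / 2 * r⁻¹ ^ 2) + w.phi'' r / h) r := by
    have := ((hasDerivAt_inv hr.ne').const_mul (((n : ℝ) - 1) / 2)).add
      ((w.hasDerivAt_phi' r hr).div_const h)
    refine this.congr_deriv ?_
    rw [inv_pow]
    ring
  have hρ : HasDerivAt (fun t => t ^ (n - 1) * Real.exp (2 * w.phi t / h))
      (2 * γ r * (r ^ (n - 1) * Real.exp (2 * w.phi r / h))) r := by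
    have h1 := (hasDerivAt_pow (n - 1) r).mul
      ((((w.hasDerivAt_phi r hr).const_mul 2).div_const h).exp)
    refine h1.congr_deriv ?_
    obtain ⟨k, rfl⟩ : ∃ k, n = k + 2 := ⟨n - 2, by omega⟩
    simp only [hγ, CarlemanWeight.gamma]
    have hk : k + 2 - 1 = k + 1 := rfl
    rw [hk, Nat.add_sub_cancel]
    push_cast
    field_simp
    ring
  set x : Rn n := r • ω with hx
  set X := v x with hXdef
  set X₁ := fderiv ℝ v x ω with hX₁def
  set X₂ := hess v x ω ω with hX₂def
  set Z := w.radD h v x with hZdef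
  set g : ℂ := -(h : ℂ) ^ 2 * Δ v x + (((W x + S - E : ℝ) : ℂ) + τ * Complex.I) * X with hgdef
  set Λ : ℂ := 1 / 2 * ∑ i, ∑ j, rotD2 i j v x with hΛ
  set m : ℝ := (n : ℝ) - 1 with hm
  set Pl : ℝ := ∑ i, ∑ j, inner ℝ (rotD i j v x) (rotDr i j v x) with hPl
  set N : ℝ → ℝ := fun t => 1 / 2 * ∑ i, ∑ j, ‖rotD i j v (t • ω)‖ ^ 2 with hN
  have hre' : ∀ {f : ℝ → ℂ} {f' : ℂ}, HasDerivAt f f' r → HasDerivAt (fun t => (f t).re) f'.re r :=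
    fun hf => Complex.reCLM.hasFDerivAt.comp_hasDerivAt r hf
  have him' : ∀ {f : ℝ → ℂ} {f' : ℂ}, HasDerivAt f f' r → HasDerivAt (fun t => (f t).im) f'.im r :=
    fun hf => Complex.imCLM.hasFDerivAt.comp_hasDerivAt r hf
  have hNd : HasDerivAt N Pl r := by
    have h1 : HasDerivAt (fun t => ∑ i, ∑ j, ‖rotD i j v (t • ω)‖ ^ 2)
        (∑ i, ∑ j, 2 * inner ℝ (rotD i j v x) (rotDr i j v x)) r :=
      HasDerivAt.fun_sum fun i _ => HasDerivAt.fun_sum fun j _ => (hl i j).norm_sq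
    refine (h1.const_mul (1 / 2)).congr_deriv ?_
    simp only [← Finset.mul_sum]
    rw [hPl]
    ring
  have hradD : ∀ t, 0 < t → w.radD h v (t • ω) = γ t • v (t • ω) + fderiv ℝ v (t • ω) ω := by
    intro t ht
    rw [CarlemanWeight.radD, hnorm t ht, (fderiv ℝ v (t • ω)).map_smul, smul_smul,
      inv_mul_cancel₀ ht.ne', one_smul]
  have hZ : Z = γ r • X + X₁ := hradD r hr
  have hZre : Z.re = γ r * X.re + X₁.re := by rw [hZ]; simp
  have hZim : Z.im = γ r * X.im + X₁.im := by rw [hZ]; simp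
  -- the equation in polar form, with the angular part `Λ` expressed by rotation fields
  have hodd : (h : ℂ) ^ 2 * X₂ = ((W x + S - E : ℝ) + τ * Complex.I) * X - g -
      (h : ℂ) ^ 2 * (m * (r : ℂ)⁻¹ * X₁ + (r : ℂ)⁻¹ ^ 2 * Λ) := by
    have h1 : fderiv ℝ v x x = r * X₁ := by
      conv_lhs => rw [hx, map_smul]
      rw [Complex.real_smul]
    have h2 : hess v x x x = r ^ 2 * X₂ := by
      have : hess v x (r • ω) (r • ω) = r ^ 2 * X₂ := by
        simp only [map_smul, smul_apply, Complex.real_smul]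
        ring
      exact this
    have hr' : (r : ℂ) ≠ 0 := by exact_mod_cast hr.ne'
    rw [hΛ, sum_rotD2, h1, h2, hgdef, hx, hnorm r hr, hm]
    push_cast
    field_simp
    ring
  have hre := congrArg Complex.re hodd
  have him := congrArg Complex.im hodd
  have hcast : (h : ℂ) ^ 2 * X₂ = ((h ^ 2 : ℝ) : ℂ) * X₂ := by push_cast; rfl
  have hcast' : (h : ℂ) ^ 2 * (m * (r : ℂ)⁻¹ * X₁ + (r : ℂ)⁻¹ ^ 2 * Λ) =
      ((h ^ 2 : ℝ) : ℂ) * (((m * r⁻¹ : ℝ) : ℂ) * X₁ + ((r⁻¹ ^ 2 : ℝ) : ℂ) * Λ) := by push_cast; rfl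
  rw [hcast, hcast'] at hre him
  simp only [Complex.sub_re, Complex.sub_im, Complex.mul_re, Complex.mul_im, Complex.add_re,
    Complex.add_im, Complex.ofReal_re,
    Complex.ofReal_im, Complex.I_re, Complex.I_im, mul_zero, mul_one, zero_mul, sub_zero,
    add_zero, zero_add, sub_self] at hre him
  have hφ' : w.phi' r = h * (γ r - m / 2 * r⁻¹) := by
    rw [hγ, CarlemanWeight.gamma, ← hm]; field_simp; ring
  set γ' : ℝ := -((n - 1) / 2 * r⁻¹ ^ 2) + w.phi'' r / h with hγ'def
  have hφ'' : w.phi'' r = h * (γ' + m / 2 * r⁻¹ ^ 2) := by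
    rw [hγ'def, ← hm]; field_simp; ring
  have hid := energy_deriv_identity (a := X.re) (b := X.im) (a₁ := X₁.re) (b₁ := X₁.im)
    (a₂ := X₂.re) (b₂ := X₂.im) (gr := g.re) (gi := g.im) (lr := Λ.re) (li := Λ.im) (Nl := N r)
    (Pl := Pl) (ν := r⁻¹) (γ := γ r) (γ' := γ') (h := h) (E := E) (w := W x) (w' := W') (S := S)
    (τ := τ) (μ := w.mu r) (μ' := w.mu' r)
    (ρ := r ^ (n - 1) * Real.exp (2 * w.phi r / h)) (m := m) hφ' hφ'' rfl
    (by linear_combination hre) (by linear_combination him)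
  have ha := hre' hX
  have hb := him' hX
  have ha₁ := hre' hX1
  have hb₁ := him' hX1
  have hXsq := (ha.pow 2).add (hb.pow 2)
  have hZsq := (((hγ'.mul ha).add ha₁).pow 2).add (((hγ'.mul hb).add hb₁).pow 2)
  have hpot := ((((w.hasDerivAt_phi' r hr).pow 2).const_add E).sub hW).mul hXsq
  have hang := ((((hasDerivAt_inv hr.ne').pow 2).mul_const (h ^ 2)).mul
    (hNd.add (hXsq.const_mul (m * (m - 2) / 4))))
  have hF := ((w.hasDerivAt_mu r hr).mul hρ).mul (((hZsq.const_mul (h ^ 2)).add hpot).sub hang)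
  refine ⟨_, (hF.congr_of_eventuallyEq ?_).congr_deriv (Eq.trans ?_ hid), ?_⟩
  · filter_upwards [lt_mem_nhds hr] with t ht
    simp only [CarlemanWeight.rayEnergy, hradD t ht, complex_norm_sq_eq (v _),
      complex_norm_sq_eq (_ + _)]
    simp [hN, ← hm]
  · simp only [Pi.mul_apply, Pi.add_apply, Pi.sub_apply, Pi.pow_apply]
    rw [show (r ^ 2)⁻¹ = r⁻¹ ^ 2 from (inv_pow r 2).symm]
    simp only [← hx, ← hXdef]
    push_cast
    ring
  have hnZ : (γ r * X.re + X₁.re) ^ 2 + (γ r * X.im + X₁.im) ^ 2 = ‖Z‖ ^ 2 := by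
    rw [complex_norm_sq_eq, hZre, hZim]
  have hnX : X.re ^ 2 + X.im ^ 2 = ‖X‖ ^ 2 := (complex_norm_sq_eq X).symm
  have hrem : ∑ i, ∑ j, w.rotRem h v i j x =
      2 * (Λ.re * Z.re + Λ.im * Z.im) + Pl + 2 * γ r * N r := by
    have e1 : 2 * (Λ.re * Z.re + Λ.im * Z.im) = ∑ i, ∑ j, inner ℝ Z (rotD2 i j v x) := by
      have : (2 : ℝ) • Λ = ∑ i, ∑ j, rotD2 i j v x := by
        rw [hΛ, Complex.real_smul]; push_cast; ring
      simp_rw [← inner_sum]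
      rw [← this, inner_smul_right, complex_inner_eq]
      ring
    have e2 : 2 * γ r * N r = ∑ i, ∑ j, γ r * ‖rotD i j v x‖ ^ 2 := by
      simp_rw [← Finset.mul_sum]
      rw [hN]
      ring
    rw [e1, e2, hPl]
    simp only [← Finset.sum_add_distrib]
    refine Finset.sum_congr rfl fun i _ => Finset.sum_congr rfl fun j _ => ?_
    rw [CarlemanWeight.rotRem, inner_add_right, inner_smul_right, real_inner_self_eq_norm_sq]
    have : ‖x‖ = r := hnorm r hr
    rw [this]
    ring
  have hcs : ∀ z₁ z₂ : ℂ, |z₁.re * z₂.re + z₁.im * z₂.im| ≤ ‖z₁‖ * ‖z₂‖ := fun z₁ z₂ => by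
    rw [← complex_inner_eq]
    exact abs_real_inner_le_norm _ _
  have hμ' : 0 < w.mu' r := lt_of_lt_of_le (by positivity) (w.mu'_lower r hr)
  have habs := energy_absorb (x := ‖X‖) (t := ‖Z‖) (g₁ := g₁) (e := e) (τ := τ)
    (p := X.re * Z.re + X.im * Z.im) (q := X.im * Z.re - X.re * Z.im)
    (G := g.re * Z.re + g.im * Z.im) hh (w.mu_pos r hr) hμ' (w.phi'_nonneg r hr) hS
    (hcs X Z) (by
      have := hcs (-(Complex.I * X)) Z
      simp only [norm_neg, Complex.norm_mul, Complex.norm_I, one_mul, Complex.neg_re,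
        Complex.neg_im, Complex.mul_re, Complex.mul_im, Complex.I_re, Complex.I_im] at this
      convert! this using 2
      ring)
    ((hcs g Z).trans (by gcongr)) key
  -- the angular energy contributes with the favourable sign: `mu' r ≤ 2 mu` and `n ≥ 3`
  have hdrop : 0 ≤ (2 * w.mu r * r⁻¹ - w.mu' r) * r⁻¹ ^ 2 * h ^ 2 *
      (N r + m * (m - 2) / 4 * ‖X‖ ^ 2) := by
    have h1 : 0 ≤ 2 * w.mu r * r⁻¹ - w.mu' r := by
      rw [sub_nonneg, ← div_eq_mul_inv, le_div_iff₀ hr]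
      exact w.mu'_mul_le r hr
    have h2 : 0 ≤ m * (m - 2) / 4 := by
      have : (3 : ℝ) ≤ n := by exact_mod_cast hn
      have h3 : 0 ≤ m := by linarith
      have h4 : 0 ≤ m - 2 := by linarith
      positivity
    have h3 : 0 ≤ N r := by
      rw [hN]
      positivity
    positivity
  rw [hrem, ← mul_neg]
  refine mul_le_mul_of_nonneg_left ?_ (by positivity)
  rw [hnZ, hnX, ← hZre, ← hZim]
  linarith

end SemiclassicalResolvent


/-! ### Bounds and continuity of the terms of the energy -/

namespace SemiclassicalResolvent

variable {n : ℕ}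

theorem SchwartzMap.exists_norm_le_inv_pow {F : Type*} [NormedAddCommGroup F] [NormedSpace ℝ F]
    (v : 𝓢(Rn n, F)) (k : ℕ) : ∃ C, ∀ x, ‖v x‖ ≤ C * ((1 + ‖x‖) ^ k)⁻¹ := by
  refine ⟨2 ^ k * ((Finset.Iic (k, 0)).sup fun m => SchwartzMap.seminorm ℝ m.1 m.2) v,
    fun x => ?_⟩
  have h := SchwartzMap.one_add_le_sup_seminorm_apply (𝕜 := ℝ) (m := (k, 0)) le_rfl le_rfl v x
  rw [norm_iteratedFDeriv_zero] at h
  rw [← div_eq_mul_inv, le_div_iff₀ (by positivity), mul_comm]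
  exact h

theorem exists_schwartz_decay (v : 𝓢(Rn n, ℂ)) (k : ℕ) : ∃ C, 0 ≤ C ∧ ∀ x,
    ‖v x‖ ≤ C * ((1 + ‖x‖) ^ k)⁻¹ ∧ ‖fderiv ℝ v x‖ ≤ C * ((1 + ‖x‖) ^ k)⁻¹ ∧
      ‖hess v x‖ ≤ C * ((1 + ‖x‖) ^ k)⁻¹ := by
  obtain ⟨C₀, h₀⟩ := SchwartzMap.exists_norm_le_inv_pow v k
  obtain ⟨C₁, h₁⟩ := SchwartzMap.exists_norm_le_inv_pow (SchwartzMap.fderivCLM ℝ _ _ v) k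
  obtain ⟨C₂, h₂⟩ := SchwartzMap.exists_norm_le_inv_pow
    (SchwartzMap.fderivCLM ℝ _ _ (SchwartzMap.fderivCLM ℝ _ _ v)) k
  have hv : (⇑(SchwartzMap.fderivCLM ℝ (Rn n) ℂ v)) = fderiv ℝ v := by
    funext x
    exact SchwartzMap.fderivCLM_apply ..
  refine ⟨max 0 (max C₀ (max C₁ C₂)), le_max_left _ _, fun x => ⟨?_, ?_, ?_⟩⟩
  · refine (h₀ x).trans ?_
    gcongr
    simp
  · rw [← hv]
    refine (h₁ x).trans ?_
    gcongr
    simp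
  · have : hess v x = SchwartzMap.fderivCLM ℝ _ _ (SchwartzMap.fderivCLM ℝ _ _ v) x := by
      rw [SchwartzMap.fderivCLM_apply, hv]
    rw [this]
    refine (h₂ x).trans ?_
    gcongr
    simp

/-- If `F` vanishes at both ends of the half-line and `-F' ≤ G` off one point, then `∫ G ≥ 0`. The
derivative need not be integrable. -/
theorem integral_nonneg_of_neg_deriv_le {F G : ℝ → ℝ} {r₀ C : ℝ} (hr₀ : 0 < r₀)
    (hc : ContinuousOn F (Set.Ioi 0))
    (hd : ∀ r, 0 < r → r ≠ r₀ → ∃ D, HasDerivAt F D r ∧ -D ≤ G r)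
    (hG : IntegrableOn G (Set.Ioi 0)) (hF : ∀ r, 0 < r → |F r| ≤ C * (r / (1 + r) ^ 2)) :
    0 ≤ ∫ r in Set.Ioi (0 : ℝ), G r := by
  have hstep : ∀ a b, 0 < a → a ≤ b → (∀ r ∈ Set.Ioo a b, r ≠ r₀) →
      F a - F b ≤ ∫ r in a..b, G r := by
    intro a b ha hab hne
    have h := intervalIntegral.sub_le_integral_of_hasDeriv_right_of_le (g := fun r => -F r)
      (g' := fun r => -deriv F r) (φ := G) hab
      ((hc.mono fun r hr => ha.trans_le hr.1).neg) (fun r hr => ?_)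
      (hG.mono_set fun r hr => ha.trans_le hr.1) (fun r hr => ?_)
    · linarith
    · obtain ⟨D, hD, -⟩ := hd r (ha.trans hr.1) (hne r hr)
      rw [hD.deriv]
      exact hD.neg.hasDerivWithinAt
    · obtain ⟨D, hD, hDG⟩ := hd r (ha.trans hr.1) (hne r hr)
      rwa [hD.deriv]
  have hint : ∀ a b, 0 < a → 0 < b → IntervalIntegrable G volume a b := fun a b ha hb => by
    refine (hG.mono_set fun r hr => ?_).intervalIntegrable
    exact (lt_min ha hb).trans_le hr.1
  -- the exceptional point is handled by splitting the interval there
  have hmain : ∀ a b, 0 < a → a ≤ r₀ → r₀ ≤ b → F a - F b ≤ ∫ r in Set.Ioc a b, G r := by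
    intro a b ha har hrb
    rw [← intervalIntegral.integral_of_le (har.trans hrb),
      ← intervalIntegral.integral_add_adjacent_intervals (hint a r₀ ha hr₀)
        (hint r₀ b hr₀ (hr₀.trans_le hrb))]
    linarith [hstep a r₀ ha har fun r hr => hr.2.ne,
      hstep r₀ b hr₀ hrb fun r hr => hr.1.ne']
  set a : ℕ → ℝ := fun j => r₀ * (1 / ((j : ℝ) + 1)) with ha
  set b : ℕ → ℝ := fun j => r₀ + j with hb
  have ha0 : Tendsto a atTop (𝓝 0) := by
    simpa [ha] using tendsto_one_div_add_atTop_nhds_zero_nat.const_mul r₀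
  have hb0 : Tendsto b atTop atTop := tendsto_atTop_add_const_left _ _ tendsto_natCast_atTop_atTop
  have hapos : ∀ j, 0 < a j := fun j => by positivity
  have hbpos : ∀ j, 0 < b j := fun j => by positivity
  have hcov : AECover (volume.restrict (Set.Ioi (0 : ℝ))) atTop fun j => Set.Ioc (a j) (b j) :=
    (aecover_Ioi_of_Ioi ha0).inter ((aecover_Iic hb0).restrict)
  have hlim := hcov.integral_tendsto_of_countably_generated hG
  have hφ : Tendsto (fun j => -(C * (a j / (1 + a j) ^ 2)) - C * (b j / (1 + b j) ^ 2)) atTop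
      (𝓝 (-(C * (0 / (1 + 0) ^ 2)) - C * 0)) := by
    refine Tendsto.sub (Tendsto.neg (Tendsto.const_mul _ ?_)) (Tendsto.const_mul _ ?_)
    · exact ha0.div ((ha0.const_add 1).pow 2) (by norm_num)
    · refine squeeze_zero (fun j => by have := hbpos j; positivity) (fun j => ?_)
        hb0.inv_tendsto_atTop
      have := hbpos j
      rw [Pi.inv_apply, div_le_iff₀ (by positivity), inv_mul_eq_div, le_div_iff₀ this]
      nlinarith
  simp only [zero_div, mul_zero, neg_zero, sub_zero] at hφ
  refine le_of_tendsto_of_tendsto' hφ hlim fun j => ?_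
  have hsub : Set.Ioc (a j) (b j) ∩ Set.Ioi 0 = Set.Ioc (a j) (b j) :=
    Set.inter_eq_left.2 fun r hr => (hapos j).trans hr.1
  rw [Measure.restrict_restrict measurableSet_Ioc, hsub]
  refine le_trans ?_ (hmain (a j) (b j) (hapos j) ?_ ?_)
  · linarith [(abs_le.1 (hF _ (hapos j))).1, (abs_le.1 (hF _ (hbpos j))).2]
  · have : 1 / ((j : ℝ) + 1) ≤ 1 := by
      rw [div_le_one (by positivity)]
      linarith [(Nat.cast_nonneg j : (0 : ℝ) ≤ j)]
    simp only [ha]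
    nlinarith
  · simp [hb]

variable {s M c₁ Φ : ℝ}

theorem CarlemanWeight.M_nonneg (w : CarlemanWeight s M c₁ Φ) : 0 ≤ M :=
  (w.mu_pos 1 one_pos).le.trans (w.mu_le 1 one_pos)

theorem CarlemanWeight.mu_mul_inv_le (w : CarlemanWeight s M c₁ Φ) {r : ℝ} (hr : 0 < r) :
    w.mu r * r⁻¹ ≤ M := by
  rw [← div_eq_mul_inv, div_le_iff₀ hr]
  exact w.mu_le_mul r hr

theorem CarlemanWeight.gamma_nonneg (w : CarlemanWeight s M c₁ Φ) (hn : 1 ≤ n) {h r : ℝ}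
    (hh : 0 < h) (hr : 0 < r) : 0 ≤ w.gamma n h r := by
  have : (1 : ℝ) ≤ n := by exact_mod_cast hn
  have := w.phi'_nonneg r hr
  have h2 : (0 : ℝ) ≤ (n - 1) / 2 := by linarith
  rw [CarlemanWeight.gamma]
  positivity

theorem CarlemanWeight.gamma_le (w : CarlemanWeight s M c₁ Φ) {h r : ℝ}
    (hh : 0 < h) (hr : 0 < r) : w.gamma n h r ≤ n * r⁻¹ + M / h := by
  have := w.phi'_le r hr
  have h2 : (0 : ℝ) ≤ n := by positivity
  rw [CarlemanWeight.gamma]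
  gcongr
  linarith

theorem CarlemanWeight.norm_radD_le (w : CarlemanWeight s M c₁ Φ) (hn : 1 ≤ n) {h : ℝ}
    (hh : 0 < h) (v : 𝓢(Rn n, ℂ)) {x : Rn n} (hx : x ≠ 0) :
    ‖w.radD h v x‖ ≤ (n * ‖x‖⁻¹ + M / h) * ‖v x‖ + ‖fderiv ℝ v x‖ := by
  have hx' : 0 < ‖x‖ := norm_pos_iff.2 hx
  rw [CarlemanWeight.radD]
  refine (norm_add_le _ _).trans ?_
  rw [norm_smul, norm_smul, Real.norm_of_nonneg (w.gamma_nonneg hn hh hx'), norm_inv, norm_norm]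
  refine add_le_add (by gcongr; exact w.gamma_le hh hx') ?_
  rw [inv_mul_le_iff₀ hx', mul_comm]
  exact (fderiv ℝ v x).le_opNorm x

theorem norm_rotD_le (i j : Fin n) (v : 𝓢(Rn n, ℂ)) (x : Rn n) :
    ‖rotD i j v x‖ ≤ 2 * ‖x‖ * ‖fderiv ℝ v x‖ := by
  refine ((fderiv ℝ v x).le_opNorm _).trans ?_
  rw [mul_comm]
  gcongr
  exact norm_rotGen_le i j x

theorem norm_hess_apply_le (v : 𝓢(Rn n, ℂ)) (x y z : Rn n) :
    ‖hess v x y z‖ ≤ ‖hess v x‖ * ‖y‖ * ‖z‖ :=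
  ContinuousLinearMap.le_opNorm₂ (hess v x) y z

theorem norm_rotD2_le (i j : Fin n) (v : 𝓢(Rn n, ℂ)) (x : Rn n) :
    ‖rotD2 i j v x‖ ≤ 4 * ‖x‖ ^ 2 * ‖hess v x‖ + 4 * ‖x‖ * ‖fderiv ℝ v x‖ := by
  have h1 := norm_rotGen_le i j x
  have h2 := norm_rotGen_le i j (rotGen i j x)
  refine (norm_add_le _ _).trans (add_le_add ?_ ?_)
  · calc _ ≤ ‖hess v x‖ * ‖rotGen i j x‖ * ‖rotGen i j x‖ := norm_hess_apply_le ..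
      _ ≤ ‖hess v x‖ * (2 * ‖x‖) * (2 * ‖x‖) := by gcongr
      _ = _ := by ring
  · calc _ ≤ ‖fderiv ℝ v x‖ * ‖rotGen i j (rotGen i j x)‖ := ContinuousLinearMap.le_opNorm _ _
      _ ≤ ‖fderiv ℝ v x‖ * (2 * (2 * ‖x‖)) := by gcongr; exact h2.trans (by gcongr)
      _ = _ := by ring

theorem norm_rotDr_le (i j : Fin n) (v : 𝓢(Rn n, ℂ)) {x : Rn n} (hx : x ≠ 0) :
    ‖rotDr i j v x‖ ≤ 2 * ‖x‖ * ‖hess v x‖ + 2 * ‖fderiv ℝ v x‖ := by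
  have hx' : 0 < ‖x‖ := norm_pos_iff.2 hx
  have h1 := norm_rotGen_le i j x
  rw [rotDr, norm_smul, norm_inv, norm_norm, inv_mul_le_iff₀ hx']
  refine (norm_add_le _ _).trans ?_
  rw [mul_add]
  refine add_le_add ?_ ?_
  · calc _ ≤ ‖hess v x‖ * ‖x‖ * ‖rotGen i j x‖ := norm_hess_apply_le ..
      _ ≤ ‖hess v x‖ * ‖x‖ * (2 * ‖x‖) := by gcongr
      _ = _ := by ring
  · calc _ ≤ ‖fderiv ℝ v x‖ * ‖rotGen i j x‖ := ContinuousLinearMap.le_opNorm _ _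
      _ ≤ ‖fderiv ℝ v x‖ * (2 * ‖x‖) := by gcongr
      _ = _ := by ring

/-- The radial density multiplying the angular remainder. -/
noncomputable def CarlemanWeight.kappa (w : CarlemanWeight s M c₁ Φ) (h r : ℝ) : ℝ :=
  Real.exp (2 * w.phi r / h) * (w.mu r * r⁻¹ ^ 2 * h ^ 2)

theorem CarlemanWeight.kappa_nonneg (w : CarlemanWeight s M c₁ Φ) {h r : ℝ} (hr : 0 < r) :
    0 ≤ w.kappa h r := by
  have := (w.mu_pos r hr).le
  rw [CarlemanWeight.kappa]
  positivity

theorem CarlemanWeight.exp_le (w : CarlemanWeight s M c₁ Φ) {h r : ℝ} (hh : 0 < h) (hr : 0 < r) :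
    Real.exp (2 * w.phi r / h) ≤ Real.exp (2 * Φ / h) := by
  have := w.phi_le r hr
  gcongr

theorem CarlemanWeight.kappa_le (w : CarlemanWeight s M c₁ Φ) {h r : ℝ} (hh : 0 < h)
    (hr : 0 < r) : w.kappa h r ≤ Real.exp (2 * Φ / h) * (M * h ^ 2) * r⁻¹ := by
  have h1 := w.mu_mul_inv_le hr
  have h2 := w.exp_le hh hr
  have h3 := (w.mu_pos r hr).le
  calc w.kappa h r = Real.exp (2 * w.phi r / h) * (w.mu r * r⁻¹ * h ^ 2) * r⁻¹ := by
        rw [CarlemanWeight.kappa]; ring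
    _ ≤ _ := by gcongr

theorem continuousOn_comp_norm {f : ℝ → ℝ} (hf : ContinuousOn f (Set.Ioi 0)) :
    ContinuousOn (fun x : Rn n => f ‖x‖) {0}ᶜ :=
  hf.comp continuous_norm.continuousOn fun _ hx => norm_pos_iff.2 hx

theorem CarlemanWeight.continuousOn_mu (w : CarlemanWeight s M c₁ Φ) :
    ContinuousOn w.mu (Set.Ioi 0) :=
  fun r hr => (w.hasDerivAt_mu r hr).continuousAt.continuousWithinAt

theorem CarlemanWeight.continuousOn_phi (w : CarlemanWeight s M c₁ Φ) :
    ContinuousOn w.phi (Set.Ioi 0) :=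
  fun r hr => (w.hasDerivAt_phi r hr).continuousAt.continuousWithinAt

theorem CarlemanWeight.continuousOn_phi' (w : CarlemanWeight s M c₁ Φ) :
    ContinuousOn w.phi' (Set.Ioi 0) :=
  fun r hr => (w.hasDerivAt_phi' r hr).continuousAt.continuousWithinAt

theorem continuousOn_inv_Ioi : ContinuousOn (fun r : ℝ => r⁻¹) (Set.Ioi 0) :=
  continuousOn_inv₀.mono fun _ hr => ne_of_gt hr

theorem CarlemanWeight.continuousOn_gamma (w : CarlemanWeight s M c₁ Φ) (n : ℕ) (h : ℝ) :
    ContinuousOn (w.gamma n h) (Set.Ioi 0) :=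
  (continuousOn_const.mul continuousOn_inv_Ioi).add (w.continuousOn_phi'.div_const h)

theorem CarlemanWeight.continuousOn_kappa (w : CarlemanWeight s M c₁ Φ) (h : ℝ) :
    ContinuousOn (w.kappa h) (Set.Ioi 0) :=
  ((continuousOn_const.mul w.continuousOn_phi).div_const h).rexp.mul
    ((w.continuousOn_mu.mul (continuousOn_inv_Ioi.pow 2)).mul continuousOn_const)

theorem continuous_fderiv_schwartz (v : 𝓢(Rn n, ℂ)) : Continuous (fderiv ℝ v) :=
  continuous_iff_continuousAt.2 fun x => (hasFDerivAt_fderiv v x).continuousAt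

theorem continuous_hess (v : 𝓢(Rn n, ℂ)) : Continuous (hess v) := by
  have h : ContDiff ℝ 1 (fderiv ℝ v) := (v.smooth 2).fderiv_right (by norm_num)
  exact h.continuous_fderiv (by norm_num)

theorem continuous_rotD (i j : Fin n) (v : 𝓢(Rn n, ℂ)) : Continuous (rotD i j v) :=
  (continuous_fderiv_schwartz v).clm_apply (rotGen i j).continuous

theorem continuous_rotD2 (i j : Fin n) (v : 𝓢(Rn n, ℂ)) : Continuous (rotD2 i j v) :=
  (((continuous_hess v).clm_apply (rotGen i j).continuous).clm_apply
    (rotGen i j).continuous).add ((continuous_fderiv_schwartz v).clm_apply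
      ((rotGen i j).continuous.comp (rotGen i j).continuous))

theorem continuousOn_norm_inv : ContinuousOn (fun x : Rn n => ‖x‖⁻¹) {0}ᶜ :=
  continuousOn_comp_norm continuousOn_inv_Ioi

theorem continuousOn_rotDr (i j : Fin n) (v : 𝓢(Rn n, ℂ)) : ContinuousOn (rotDr i j v) {0}ᶜ :=
  continuousOn_norm_inv.smul
    ((((continuous_hess v).clm_apply continuous_id).clm_apply (rotGen i j).continuous).add
      (continuous_rotD i j v)).continuousOn

theorem CarlemanWeight.continuousOn_radD (w : CarlemanWeight s M c₁ Φ) (h : ℝ)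
    (v : 𝓢(Rn n, ℂ)) : ContinuousOn (w.radD h v) {0}ᶜ :=
  ((continuousOn_comp_norm (w.continuousOn_gamma n h)).smul v.continuous.continuousOn).add
    (continuousOn_norm_inv.smul
      ((continuous_fderiv_schwartz v).clm_apply continuous_id).continuousOn)

theorem CarlemanWeight.continuousOn_rotRem (w : CarlemanWeight s M c₁ Φ) (h : ℝ)
    (v : 𝓢(Rn n, ℂ)) (i j : Fin n) : ContinuousOn (w.rotRem h v i j) {0}ᶜ :=
  (ContinuousOn.inner (𝕜 := ℝ) (w.continuousOn_radD h v)
    (continuous_rotD2 i j v).continuousOn).add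
    (ContinuousOn.inner (𝕜 := ℝ) (continuous_rotD i j v).continuousOn
      (((continuousOn_comp_norm (w.continuousOn_gamma n h)).smul
        (continuous_rotD i j v).continuousOn).add (continuousOn_rotDr i j v)))

end SemiclassicalResolvent


/-! ### The angular remainder has integral zero -/

namespace SemiclassicalResolvent

variable {n : ℕ} {s M c₁ Φ : ℝ}

/-- The integrable function that dominates the angular terms: they have a singularity of order
`‖x‖⁻¹` at the origin and decay rapidly. -/
theorem integrable_inv_norm_mul_decay (hn : 2 ≤ n) :
    Integrable (fun x : Rn n => (‖x‖⁻¹ + 1) * (‖x‖ + 1) * (((1 + ‖x‖) ^ (n + 4))⁻¹) ^ 2) := by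
  have : Nonempty (Fin n) := ⟨⟨0, by omega⟩⟩
  have : Nontrivial (Rn n) := inferInstance
  refine (integrable_fun_norm_addHaar (volume : Measure (Rn n))
    (f := fun r => (r⁻¹ + 1) * (r + 1) * (((1 + r) ^ (n + 4))⁻¹) ^ 2)).2 ?_
  have hint : IntegrableOn (fun r : ℝ => (1 + ‖r‖) ^ (-2 : ℝ)) (Set.Ioi 0) :=
    (integrable_one_add_norm (by simp)).integrableOn
  refine hint.mono' ?_ ?_
  · refine ContinuousOn.aestronglyMeasurable (fun r (hr : 0 < r) => ?_) measurableSet_Ioi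
    refine ContinuousAt.continuousWithinAt ?_
    have h1 : r ≠ 0 := hr.ne'
    have h2 : (1 + r) ^ (n + 4) ≠ 0 := by positivity
    fun_prop (disch := assumption)
  · refine (ae_restrict_iff' measurableSet_Ioi).2 (Eventually.of_forall fun r (hr : 0 < r) => ?_)
    rw [Real.norm_of_nonneg hr.le, Real.norm_of_nonneg (by positivity), finrank_euclideanSpace,
      Fintype.card_fin, Real.rpow_neg (by positivity), smul_eq_mul]
    obtain ⟨k, rfl⟩ : ∃ k, n = k + 2 := ⟨n - 2, by omega⟩
    have e1 : r ^ (k + 2 - 1) * ((r⁻¹ + 1) * (r + 1) * (((1 + r) ^ (k + 2 + 4))⁻¹) ^ 2) =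
        r ^ k * (1 + r) ^ 2 * (((1 + r) ^ (k + 2 + 4))⁻¹) ^ 2 := by
      have : k + 2 - 1 = k + 1 := rfl
      rw [this]
      field_simp
      ring
    rw [e1]
    have h3 : r ^ k ≤ (1 + r) ^ k := by gcongr; linarith
    have h4 : (1 : ℝ) ≤ (1 + r) ^ (k + 8) := one_le_pow₀ (by linarith)
    calc r ^ k * (1 + r) ^ 2 * (((1 + r) ^ (k + 2 + 4))⁻¹) ^ 2
        ≤ (1 + r) ^ k * (1 + r) ^ 2 * (((1 + r) ^ (k + 2 + 4))⁻¹) ^ 2 := by gcongr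
      _ = ((1 + r) ^ 2)⁻¹ * ((1 + r) ^ (k + 8))⁻¹ := by field_simp; ring
      _ ≤ ((1 + r) ^ 2)⁻¹ * 1 := by gcongr; exact inv_le_one_of_one_le₀ h4
      _ = _ := by rw [mul_one]; norm_cast

theorem CarlemanWeight.norm_radD_le_of_le (w : CarlemanWeight s M c₁ Φ) (hn : 1 ≤ n) {h : ℝ}
    (hh : 0 < h) (v : 𝓢(Rn n, ℂ)) {x : Rn n} (hx : x ≠ 0) {D : ℝ} (h0 : ‖v x‖ ≤ D)
    (h1 : ‖fderiv ℝ v x‖ ≤ D) :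
    ‖w.radD h v x‖ ≤ (n + M / h + 1) * (‖x‖⁻¹ + 1) * D := by
  have hM := w.M_nonneg
  have hx' : 0 < ‖x‖ := norm_pos_iff.2 hx
  have hD : 0 ≤ D := (norm_nonneg _).trans h0
  refine (w.norm_radD_le hn hh v hx).trans ?_
  calc _ ≤ (n * ‖x‖⁻¹ + M / h) * D + D := by gcongr
    _ ≤ _ := by
      have : 0 ≤ ((M / h + 1) * ‖x‖⁻¹ + n) * D := by positivity
      linarith

/-- The angular remainder drops out after integration: `kappa * rotRem` is the derivative along the
`(i, j)`-rotation of `kappa * ⟨radD, rotD⟩`, since `kappa` is radial and rotations commute with the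
radial derivative. -/
theorem CarlemanWeight.integrable_and_integral_kappa_rotRem (w : CarlemanWeight s M c₁ Φ)
    (hn : 3 ≤ n) {h : ℝ} (hh : 0 < h) (v : 𝓢(Rn n, ℂ)) (i j : Fin n) :
    Integrable (fun x => w.kappa h ‖x‖ * w.rotRem h v i j x) ∧
      ∫ x, w.kappa h ‖x‖ * w.rotRem h v i j x = 0 := by
  have hn1 : 1 ≤ n := by omega
  have hM := w.M_nonneg
  have : Nonempty (Fin n) := ⟨⟨0, hn1⟩⟩
  have hne : ∀ᵐ x : Rn n, x ≠ 0 := compl_mem_ae_iff.2 (measure_singleton (0 : Rn n))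
  obtain ⟨C, hC, hdec⟩ := exists_schwartz_decay v (n + 4)
  set A : ℝ := n + M / h + 1 with hA
  have hA0 : 0 ≤ A := by positivity
  set K : ℝ := Real.exp (2 * Φ / h) * (M * h ^ 2) with hK
  have hK0 : 0 ≤ K := by positivity
  have hbd := (integrable_inv_norm_mul_decay (n := n) (by omega)).const_mul (8 * K * A * C ^ 2)
  have hFm : ContinuousOn (fun x => w.kappa h ‖x‖ * inner ℝ (w.radD h v x) (rotD i j v x)) {0}ᶜ :=
    (continuousOn_comp_norm (w.continuousOn_kappa h)).mul
      (ContinuousOn.inner (𝕜 := ℝ) (w.continuousOn_radD h v) (continuous_rotD i j v).continuousOn)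
  have hF'm : ContinuousOn (fun x => w.kappa h ‖x‖ * w.rotRem h v i j x) {0}ᶜ :=
    (continuousOn_comp_norm (w.continuousOn_kappa h)).mul (w.continuousOn_rotRem h v i j)
  have hFmeas := measurable_of_continuousOn_compl_singleton _ hFm
  have hF'meas := measurable_of_continuousOn_compl_singleton _ hF'm
  have hFi : Integrable (fun x => w.kappa h ‖x‖ * inner ℝ (w.radD h v x) (rotD i j v x)) := by
    refine hbd.mono' hFmeas.aestronglyMeasurable ?_
    filter_upwards [hne] with x hx
    have hr : 0 < ‖x‖ := norm_pos_iff.2 hx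
    obtain ⟨h0, h1, h2⟩ := hdec x
    set D := C * ((1 + ‖x‖) ^ (n + 4))⁻¹ with hD
    have hD0 : 0 ≤ D := by positivity
    have hκ := w.kappa_le hh hr
    have hκ0 := w.kappa_nonneg (h := h) hr
    have hZ := w.norm_radD_le_of_le hn1 hh v hx h0 h1
    have hl : ‖rotD i j v x‖ ≤ 2 * ‖x‖ * D := (norm_rotD_le i j v x).trans (by gcongr)
    rw [norm_mul, Real.norm_of_nonneg hκ0]
    calc w.kappa h ‖x‖ * ‖inner ℝ (w.radD h v x) (rotD i j v x)‖
        ≤ (K * ‖x‖⁻¹) * ((A * (‖x‖⁻¹ + 1) * D) * (2 * ‖x‖ * D)) := by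
          gcongr
          exact (norm_inner_le_norm _ _).trans (by gcongr)
      _ = 2 * K * A * (‖x‖⁻¹ + 1) * D ^ 2 := by field_simp
      _ ≤ 8 * K * A * ((‖x‖⁻¹ + 1) * (‖x‖ + 1)) * D ^ 2 := by
          have : 0 ≤ K * A * (‖x‖⁻¹ + 1) * (6 + 8 * ‖x‖) * D ^ 2 := by positivity
          linarith
      _ = _ := by rw [hD]; ring
  have hF'i : Integrable (fun x => w.kappa h ‖x‖ * w.rotRem h v i j x) := by
    refine hbd.mono' hF'meas.aestronglyMeasurable ?_
    filter_upwards [hne] with x hx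
    have hr : 0 < ‖x‖ := norm_pos_iff.2 hx
    obtain ⟨h0, h1, h2⟩ := hdec x
    set D := C * ((1 + ‖x‖) ^ (n + 4))⁻¹ with hD
    have hD0 : 0 ≤ D := by positivity
    have hκ := w.kappa_le hh hr
    have hκ0 := w.kappa_nonneg (h := h) hr
    have hZ := w.norm_radD_le_of_le hn1 hh v hx h0 h1
    have hl : ‖rotD i j v x‖ ≤ 2 * ‖x‖ * D := (norm_rotD_le i j v x).trans (by gcongr)
    have hl2 : ‖rotD2 i j v x‖ ≤ 4 * ‖x‖ ^ 2 * D + 4 * ‖x‖ * D :=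
      (norm_rotD2_le i j v x).trans (by gcongr)
    have hlr : ‖rotDr i j v x‖ ≤ 2 * ‖x‖ * D + 2 * D :=
      (norm_rotDr_le i j v hx).trans (by gcongr)
    have hγ0 := w.gamma_nonneg (n := n) hn1 hh hr
    have hγ := w.gamma_le (n := n) hh hr
    have hrem : ‖w.rotRem h v i j x‖ ≤ (A * (‖x‖⁻¹ + 1) * D) * (4 * ‖x‖ ^ 2 * D + 4 * ‖x‖ * D) +
        (2 * ‖x‖ * D) * ((n * ‖x‖⁻¹ + M / h) * (2 * ‖x‖ * D) + (2 * ‖x‖ * D + 2 * D)) := by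
      refine (norm_add_le _ _).trans (add_le_add ?_ ?_)
      · exact (norm_inner_le_norm _ _).trans (by gcongr)
      · refine (norm_inner_le_norm _ _).trans ?_
        gcongr
        refine (norm_add_le _ _).trans (add_le_add ?_ hlr)
        rw [norm_smul, Real.norm_of_nonneg hγ0]
        gcongr
    rw [norm_mul, Real.norm_of_nonneg hκ0]
    calc w.kappa h ‖x‖ * ‖w.rotRem h v i j x‖
        ≤ (K * ‖x‖⁻¹) * ((A * (‖x‖⁻¹ + 1) * D) * (4 * ‖x‖ ^ 2 * D + 4 * ‖x‖ * D) +
        (2 * ‖x‖ * D) * ((n * ‖x‖⁻¹ + M / h) * (2 * ‖x‖ * D) + (2 * ‖x‖ * D + 2 * D))) := by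
          gcongr
      _ = K * D ^ 2 * (4 * A * (‖x‖⁻¹ + 1) * (‖x‖ + 1) +
          4 * (n + 1 + (M / h + 1) * ‖x‖)) := by field_simp; ring
      _ ≤ K * D ^ 2 * (4 * A * (‖x‖⁻¹ + 1) * (‖x‖ + 1) +
          4 * A * (‖x‖⁻¹ + 1) * (‖x‖ + 1)) := by
          have h3 : 0 ≤ M / h + n * ‖x‖ + A * ‖x‖⁻¹ * (‖x‖ + 1) := by positivity
          gcongr K * D ^ 2 * (_ + ?_)
          rw [hA] at h3 ⊢
          linarith
      _ = _ := by rw [hD]; ring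
  refine ⟨hF'i, ?_⟩
  by_cases hij : i = j
  · subst hij
    have : ∀ x, rotGen i i x = 0 := fun x => by rw [rotGen_apply, sub_self]
    simp [CarlemanWeight.rotRem, rotD2, rotD, this]
  refine integral_rotGen_deriv_eq_zero hn1 hij hFi hF'i hF'meas hF'm ?_
  intro x hx c hc t hct
  have h1 : HasDerivAt (fun t => fderiv ℝ v (c t)) (hess v (c t) (rotGen i j (c t))) t :=
    (hasFDerivAt_fderiv v (c t)).comp_hasDerivAt t hct
  have h0 : HasDerivAt (fun t => v (c t)) (rotD i j v (c t)) t :=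
    v.differentiableAt.hasFDerivAt.comp_hasDerivAt t hct
  have hA : HasDerivAt (fun t => rotGen i j (c t)) (rotGen i j (rotGen i j (c t))) t :=
    (rotGen i j).hasFDerivAt.comp_hasDerivAt t hct
  have hZ : HasDerivAt (fun t => w.radD h v (c t))
      (w.gamma n h ‖c t‖ • rotD i j v (c t) + rotDr i j v (c t)) t := by
    have h2 := (h0.const_smul (w.gamma n h ‖x‖)).add
      ((h1.clm_apply hct).const_smul ‖x‖⁻¹)
    have e : (fun t => w.radD h v (c t)) = fun t => w.gamma n h ‖x‖ • v (c t) +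
        ‖x‖⁻¹ • fderiv ℝ v (c t) (c t) := by
      funext t
      rw [CarlemanWeight.radD, hc t]
    rw [e]
    refine h2.congr_deriv ?_
    rw [rotDr, hc t, hess_symm]
  have hl : HasDerivAt (fun t => rotD i j v (c t)) (rotD2 i j v (c t)) t := h1.clm_apply hA
  have h3 := (hZ.inner ℝ hl).const_mul (w.kappa h ‖x‖)
  have e : (fun t => w.kappa h ‖c t‖ * inner ℝ (w.radD h v (c t)) (rotD i j v (c t))) =
      fun t => w.kappa h ‖x‖ * inner ℝ (w.radD h v (c t)) (rotD i j v (c t)) := by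
    funext t
    rw [hc t]
  rw [e]
  refine h3.congr_deriv ?_
  rw [CarlemanWeight.rotRem, hc t, real_inner_comm (rotD i j v (c t))]

end SemiclassicalResolvent


/-! ### The Carleman estimate for Schwartz functions -/

namespace SemiclassicalResolvent

variable {n : ℕ} {s M c₁ Φ : ℝ}

/-- A splitting of a potential into a part `W`, bounded almost everywhere, that is continuous along
rays and differentiable along them with derivative `dW` except at the radius `r₀`, and a part `S`
bounded by the radial function `Sb`. -/
structure RadialSplit (r₀ K : ℝ) (Sb : ℝ → ℝ) (W dW S : Rn n → ℝ) : Prop where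
  pos : 0 < r₀
  continuousOn : ∀ ω : Rn n, ‖ω‖ = 1 → ContinuousOn (fun r : ℝ => W (r • ω)) (Set.Ioi 0)
  hasDerivAt : ∀ ω : Rn n, ‖ω‖ = 1 → ∀ r, 0 < r → r ≠ r₀ →
    HasDerivAt (fun r : ℝ => W (r • ω)) (dW (r • ω)) r
  abs_le : ∀ x, |S x| ≤ Sb ‖x‖
  bounded : ∀ᵐ x, |W x| ≤ K

/-- The pointwise inequality between weight and potential behind the Carleman estimate. -/
def CarlemanWeight.Dominates (w : CarlemanWeight s M c₁ Φ) (h E r₀ : ℝ) (Sb : ℝ → ℝ)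
    (W dW : Rn n → ℝ) : Prop :=
  ∀ (x : Rn n) (r : ℝ), ‖x‖ = r → 0 < r → r ≠ r₀ →
    E / 4 * w.mu' r + W x * w.mu' r + w.mu r * dW x +
      2 * (w.mu r * (|w.phi'' r| + Sb r / h)) ^ 2 / (w.mu' r + 4 * w.phi' r * w.mu r / h) ≤
      E * w.mu' r + w.phi' r ^ 2 * w.mu' r + 2 * w.mu r * w.phi' r * w.phi'' r

/-- By continuity along rays, the almost everywhere bound holds at every point of almost every
ray. -/
theorem RadialSplit.ae_ray_le {r₀ K : ℝ} {Sb : ℝ → ℝ} {W dW S : Rn n → ℝ}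
    (hW : RadialSplit r₀ K Sb W dW S) (hn : 1 ≤ n) :
    ∀ᵐ ω : Metric.sphere (0 : Rn n) 1 ∂(sphereMeasure n), ∀ r : ℝ, 0 < r →
      |W (r • (ω : Rn n))| ≤ K := by
  filter_upwards [ae_ray_of_ae hn hW.bounded] with ω hω r hr
  have hω1 : ‖(ω : Rn n)‖ = 1 := by simp
  by_contra! hlt
  have hopen : IsOpen (Set.Ioi 0 ∩ (fun r : ℝ => |W (r • (ω : Rn n))|) ⁻¹' Set.Ioi K) :=
    (hW.continuousOn ω hω1).abs.isOpen_inter_preimage isOpen_Ioi isOpen_Ioi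
  rw [ae_restrict_iff' measurableSet_Ioi] at hω
  have h0 : volume (Set.Ioi 0 ∩ (fun r : ℝ => |W (r • (ω : Rn n))|) ⁻¹' Set.Ioi K) = 0 := by
    rw [← compl_mem_ae_iff]
    filter_upwards [hω] with t ht hmem
    exact absurd (ht hmem.1) (not_le.2 hmem.2)
  rw [hopen.measure_eq_zero_iff volume] at h0
  exact Set.notMem_empty r (h0 ▸ ⟨hr, hlt⟩)

/-- The energy vanishes at both ends of a ray: at the origin because `mu` does and `n ≥ 3`
compensates the singularity of the angular terms, at infinity because `v` is a Schwartz function. -/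
theorem CarlemanWeight.exists_abs_rayEnergy_le (w : CarlemanWeight s M c₁ Φ) (hn : 3 ≤ n) {h E : ℝ}
    (hh : 0 < h) (hE : 0 ≤ E) (v : 𝓢(Rn n, ℂ)) {W : Rn n → ℝ} {K : ℝ} {ω : Rn n} (hω : ‖ω‖ = 1)
    (hW : ∀ r : ℝ, 0 < r → |W (r • ω)| ≤ K) :
    ∃ C, ∀ r, 0 < r → |w.rayEnergy h E W v ω r| ≤ C * (r / (1 + r) ^ 2) := by
  have hM := w.M_nonneg
  obtain ⟨C, hC, hdec⟩ := exists_schwartz_decay v (n + 4)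
  set A : ℝ := n + M / h + 1 with hA
  have hA0 : 0 ≤ A := by positivity
  set Q : ℝ := Real.exp (2 * Φ / h) with hQ
  set B : ℝ := h ^ 2 * A ^ 2 + (E + M ^ 2 + K) + h ^ 2 * (4 * n ^ 2) with hB
  have hK : 0 ≤ K := (abs_nonneg _).trans (hW 1 one_pos)
  have hB0 : 0 ≤ B := by positivity
  refine ⟨M * Q * B * C ^ 2, fun r hr => ?_⟩
  have hnr : ‖r • ω‖ = r := by rw [norm_smul, hω, mul_one, Real.norm_of_nonneg hr.le]
  have hx : r • ω ≠ 0 := norm_pos_iff.1 (by rw [hnr]; exact hr)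
  obtain ⟨h0, h1, h2⟩ := hdec (r • ω)
  set D := C * ((1 + ‖r • ω‖) ^ (n + 4))⁻¹ with hD
  have hD0 : 0 ≤ D := by positivity
  have hZ := w.norm_radD_le_of_le (by omega) hh v hx h0 h1
  have hl : ∀ i j, ‖rotD i j v (r • ω)‖ ≤ 2 * r * D := fun i j =>
    (norm_rotD_le i j v _).trans (by rw [hnr]; gcongr)
  rw [hnr] at hZ
  have hφ0 := w.phi'_nonneg r hr
  have hφ := w.phi'_le r hr
  have hμ0 := (w.mu_pos r hr).le
  have hμ := w.mu_le_mul r hr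
  have hexp := w.exp_le hh hr
  have hn3 : (3 : ℝ) ≤ n := by exact_mod_cast hn
  have hin : |r ^ 2 * (h ^ 2 * ‖w.radD h v (r • ω)‖ ^ 2 +
      (E + w.phi' r ^ 2 - W (r • ω)) * ‖v (r • ω)‖ ^ 2 -
      r⁻¹ ^ 2 * h ^ 2 * (1 / 2 * ∑ i, ∑ j, ‖rotD i j v (r • ω)‖ ^ 2 +
        ((n : ℝ) - 1) * (n - 1 - 2) / 4 * ‖v (r • ω)‖ ^ 2))| ≤ B * (1 + r) ^ 2 * D ^ 2 := by
    have e1 : |r ^ 2 * (h ^ 2 * ‖w.radD h v (r • ω)‖ ^ 2)| ≤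
        h ^ 2 * A ^ 2 * (1 + r) ^ 2 * D ^ 2 := by
      rw [abs_of_nonneg (by positivity)]
      calc r ^ 2 * (h ^ 2 * ‖w.radD h v (r • ω)‖ ^ 2) ≤
          r ^ 2 * (h ^ 2 * (A * (r⁻¹ + 1) * D) ^ 2) := by gcongr
        _ = _ := by field_simp
    have e2 : |r ^ 2 * ((E + w.phi' r ^ 2 - W (r • ω)) * ‖v (r • ω)‖ ^ 2)| ≤
        (E + M ^ 2 + K) * (1 + r) ^ 2 * D ^ 2 := by
      rw [abs_mul, abs_mul, abs_of_nonneg (by positivity : 0 ≤ r ^ 2),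
        abs_of_nonneg (by positivity : 0 ≤ ‖v (r • ω)‖ ^ 2)]
      calc _ ≤ (1 + r) ^ 2 * ((E + M ^ 2 + K) * D ^ 2) := by
            gcongr
            · linarith
            · refine (abs_sub _ _).trans (add_le_add ?_ (hW r hr))
              rw [abs_of_nonneg (by positivity)]
              gcongr
        _ = _ := by ring
    have e3 : |h ^ 2 * (1 / 2 * ∑ i, ∑ j, ‖rotD i j v (r • ω)‖ ^ 2 +
        ((n : ℝ) - 1) * (n - 1 - 2) / 4 * ‖v (r • ω)‖ ^ 2)| ≤
        h ^ 2 * (4 * n ^ 2) * (1 + r) ^ 2 * D ^ 2 := by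
      have hnn : 0 ≤ ((n : ℝ) - 1) * (n - 1 - 2) / 4 := by
        have h4 : (0 : ℝ) ≤ n - 1 := by linarith
        have h5 : (0 : ℝ) ≤ n - 1 - 2 := by linarith
        positivity
      rw [abs_of_nonneg (by positivity)]
      have hs : ∑ i : Fin n, ∑ j : Fin n, ‖rotD i j v (r • ω)‖ ^ 2 ≤
          ∑ i : Fin n, ∑ j : Fin n, (2 * r * D) ^ 2 := by
        gcongr with i _ j _
        exact hl i j
      simp only [Finset.sum_const, Finset.card_univ, Fintype.card_fin, nsmul_eq_mul] at hs
      calc _ ≤ h ^ 2 * (1 / 2 * (n * (n * (2 * r * D) ^ 2)) + n ^ 2 * D ^ 2) := by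
            gcongr
            nlinarith
        _ ≤ _ := by
            have : 0 ≤ h ^ 2 * n ^ 2 * D ^ 2 * (3 + 8 * r + 2 * r ^ 2) := by positivity
            linarith
    have e4 : r ^ 2 * (h ^ 2 * ‖w.radD h v (r • ω)‖ ^ 2 +
      (E + w.phi' r ^ 2 - W (r • ω)) * ‖v (r • ω)‖ ^ 2 -
      r⁻¹ ^ 2 * h ^ 2 * (1 / 2 * ∑ i, ∑ j, ‖rotD i j v (r • ω)‖ ^ 2 +
        ((n : ℝ) - 1) * (n - 1 - 2) / 4 * ‖v (r • ω)‖ ^ 2)) =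
        r ^ 2 * (h ^ 2 * ‖w.radD h v (r • ω)‖ ^ 2) +
        r ^ 2 * ((E + w.phi' r ^ 2 - W (r • ω)) * ‖v (r • ω)‖ ^ 2) -
        h ^ 2 * (1 / 2 * ∑ i, ∑ j, ‖rotD i j v (r • ω)‖ ^ 2 +
        ((n : ℝ) - 1) * (n - 1 - 2) / 4 * ‖v (r • ω)‖ ^ 2) := by
      field_simp
    rw [e4, hB, add_mul, add_mul, add_mul, add_mul]
    exact (abs_sub _ _).trans (add_le_add ((abs_add_le _ _).trans (add_le_add e1 e2)) e3)
  obtain ⟨k, rfl⟩ : ∃ k, n = k + 3 := ⟨n - 3, by omega⟩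
  have hpow : r ^ (k + 3 - 1) = r ^ k * r ^ 2 := by
    rw [← pow_add]
    rfl
  rw [CarlemanWeight.rayEnergy, hpow]
  have e5 : ∀ μ ex T : ℝ, μ * (r ^ k * r ^ 2 * ex) * T = μ * r ^ k * ex * (r ^ 2 * T) :=
    fun _ _ _ => by ring
  rw [e5, abs_mul, abs_of_nonneg (by positivity)]
  have hrk : r ^ k ≤ (1 + r) ^ k := by gcongr; linarith
  calc _ ≤ (M * r) * (1 + r) ^ k * Q * (B * (1 + r) ^ 2 * D ^ 2) := by gcongr
    _ = M * Q * B * C ^ 2 * (r / (1 + r) ^ 2) * ((1 + r) ^ (k + 10))⁻¹ := by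
      rw [hD, hnr]
      field_simp
      ring
    _ ≤ M * Q * B * C ^ 2 * (r / (1 + r) ^ 2) * 1 := by
      gcongr
      exact inv_le_one_of_one_le₀ (one_le_pow₀ (by linarith))
    _ = _ := mul_one _

theorem CarlemanWeight.continuousOn_rayEnergy (w : CarlemanWeight s M c₁ Φ) (h E : ℝ)
    (v : 𝓢(Rn n, ℂ)) {W : Rn n → ℝ} {ω : Rn n} (hω : ‖ω‖ = 1)
    (hW : ContinuousOn (fun r : ℝ => W (r • ω)) (Set.Ioi 0)) :
    ContinuousOn (w.rayEnergy h E W v ω) (Set.Ioi 0) := by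
  have hline : Continuous fun r : ℝ => r • ω := by fun_prop
  have hmaps : Set.MapsTo (fun r : ℝ => r • ω) (Set.Ioi 0) {0}ᶜ := fun r (hr : 0 < r) => by
    simp [hr.ne', ← norm_ne_zero_iff, hω]
  have hv : ContinuousOn (fun r : ℝ => ‖v (r • ω)‖ ^ 2) (Set.Ioi 0) :=
    ((v.continuous.comp hline).norm.pow 2).continuousOn
  have hrot : ContinuousOn (fun r : ℝ => ∑ i, ∑ j, ‖rotD i j v (r • ω)‖ ^ 2) (Set.Ioi 0) :=
    (continuous_finsetSum _ fun i _ => continuous_finsetSum _ fun j _ =>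
      ((continuous_rotD i j v).comp hline).norm.pow 2).continuousOn
  refine (w.continuousOn_mu.mul ((continuous_pow (n - 1)).continuousOn.mul
    ((continuousOn_const.mul w.continuousOn_phi).div_const h).rexp)).mul ?_
  refine ContinuousOn.sub (ContinuousOn.add (continuousOn_const.mul ?_)
    (((continuousOn_const.add (w.continuousOn_phi'.pow 2)).sub hW).mul hv))
    (((continuousOn_inv_Ioi.pow 2).mul continuousOn_const).mul
      ((continuousOn_const.mul hrot).add (continuousOn_const.mul hv)))
  exact ((w.continuousOn_radD h v).comp hline.continuousOn hmaps).norm.pow 2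

theorem MemLp.integrable_norm_mul_norm {α : Type*} [MeasurableSpace α] {μ : Measure α}
    {F G : Type*} [NormedAddCommGroup F] [NormedAddCommGroup G] {f : α → F} {g : α → G}
    (hf : MemLp f 2 μ) (hg : MemLp g 2 μ) : Integrable (fun x => ‖f x‖ * ‖g x‖) μ :=
  MemLp.integrable_mul (p := 2) (q := 2) hf.norm hg.norm

theorem memLp_fderiv_schwartz (v : 𝓢(Rn n, ℂ)) : MemLp (fderiv ℝ v) 2 volume := by
  have hv : (⇑(SchwartzMap.fderivCLM ℝ (Rn n) ℂ v)) = fderiv ℝ v := by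
    funext x
    exact SchwartzMap.fderivCLM_apply ..
  rw [← hv]
  exact SchwartzMap.memLp _ 2 volume

/-- The Carleman estimate for Schwartz functions, from the integrated radial energy. The error `e`
allows for approximation: the value of `P(h)` on a Schwartz function is only in `L²`, and need not
be `(‖x‖+1)^(-s)` times an `L²` function with a good norm. -/
theorem carleman_schwartz (hn : 3 ≤ n) (hs : 0 ≤ s) (w : CarlemanWeight s M c₁ Φ) (hc₁ : 0 < c₁)
    {h E r₀ K : ℝ} (hh : 0 < h) (hE : 0 < E) {Sb : ℝ → ℝ} {W dW S : Rn n → ℝ}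
    (hW : RadialSplit r₀ K Sb W dW S) (hdom : w.Dominates h E r₀ Sb W dW) (v : 𝓢(Rn n, ℂ))
    {τ : ℝ} {f e : Rn n → ℂ} (hf : MemLp f 2 volume) (he : MemLp e 2 volume)
    (hg : ∀ x, ‖-(h : ℂ) ^ 2 * Δ v x + (((W x + S x - E : ℝ) : ℂ) + τ * Complex.I) * v x‖ ≤
      (‖x‖ + 1) ^ (-s) * ‖f x‖ + ‖e x‖) :
    E * c₁ / 4 * ∫ x, ((‖x‖ + 1) ^ (-s) * ‖v x‖) ^ 2 ≤
      2 * Real.exp (2 * Φ / h) * M ^ 2 / (h ^ 2 * c₁) * (∫ x, ‖f x‖ ^ 2) +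
      2 * Real.exp (2 * Φ / h) * (M * (n + 1) + M ^ 2 / h) *
        ∫ x, (‖e x‖ + |τ| * ‖v x‖) * (‖fderiv ℝ v x‖ + ‖v x‖) := by
  have hM := w.M_nonneg
  have hn1 : 1 ≤ n := by omega
  set Q := Real.exp (2 * Φ / h) with hQ
  set K₁ := 2 * Q * M ^ 2 / (h ^ 2 * c₁) with hK₁
  set K₂ := 2 * Q * (M * (n + 1) + M ^ 2 / h) with hK₂
  have hK₂0 : 0 ≤ K₂ := by positivity
  set J₁ : Rn n → ℝ := fun x => ((‖x‖ + 1) ^ (-s) * ‖v x‖) ^ 2 with hJ₁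
  set J₂ : Rn n → ℝ := fun x => ‖f x‖ ^ 2 with hJ₂
  set J₃ : Rn n → ℝ := fun x => (‖e x‖ + |τ| * ‖v x‖) * (‖fderiv ℝ v x‖ + ‖v x‖) with hJ₃
  set J₄ : Rn n → ℝ := fun x => ∑ i, ∑ j, w.kappa h ‖x‖ * w.rotRem h v i j x with hJ₄
  have hv2 : MemLp v 2 volume := v.memLp 2 volume
  have hdv2 := memLp_fderiv_schwartz v
  have hi₁ : Integrable J₁ := by
    have h2 := hv2.integrable_norm_pow (p := 2) two_ne_zero
    refine h2.mono' (Continuous.aestronglyMeasurable ?_) (Eventually.of_forall fun x => ?_)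
    · have hwc : Continuous fun x : Rn n => (‖x‖ + 1) ^ (-s) :=
        Continuous.rpow_const (by fun_prop) fun x => Or.inl (by positivity)
      exact (hwc.mul v.continuous.norm).pow 2
    · have hw1 : (‖x‖ + 1) ^ (-s) ≤ 1 :=
        Real.rpow_le_one_of_one_le_of_nonpos (by linarith [norm_nonneg x]) (by linarith)
      rw [Real.norm_of_nonneg (by positivity)]
      simp only [hJ₁]
      gcongr
      exact mul_le_of_le_one_left (norm_nonneg _) hw1
  have hi₂ : Integrable J₂ := hf.integrable_norm_pow (p := 2) two_ne_zero
  have hi₃ : Integrable J₃ := by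
    have h1 := ((MemLp.integrable_norm_mul_norm he hdv2).add
      (MemLp.integrable_norm_mul_norm he hv2)).add
      (((MemLp.integrable_norm_mul_norm hv2 hdv2).add
        (MemLp.integrable_norm_mul_norm hv2 hv2)).const_mul |τ|)
    refine h1.congr (Eventually.of_forall fun x => ?_)
    simp only [hJ₃, Pi.add_apply]
    ring
  have hi₄ : Integrable J₄ := integrable_finsetSum _ fun i _ => integrable_finsetSum _ fun j _ =>
    (w.integrable_and_integral_kappa_rotRem hn hh v i j).1
  have h4 : ∫ x, J₄ x = 0 := by
    simp only [hJ₄]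
    rw [integral_finsetSum _ fun i _ => integrable_finsetSum _ fun j _ =>
      (w.integrable_and_integral_kappa_rotRem hn hh v i j).1]
    refine Finset.sum_eq_zero fun i _ => ?_
    rw [integral_finsetSum _ fun j _ => (w.integrable_and_integral_kappa_rotRem hn hh v i j).1]
    exact Finset.sum_eq_zero fun j _ => (w.integrable_and_integral_kappa_rotRem hn hh v i j).2
  have hJ : 0 ≤ ∫ x, ((K₁ * J₂ x + K₂ * J₃ x + J₄ x) - E * c₁ / 4 * J₁ x) := by
    refine integral_nonneg_of_rays hn1
      ((((hi₂.const_mul K₁).add (hi₃.const_mul K₂)).add hi₄).sub (hi₁.const_mul _)) ?_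
    filter_upwards [hW.ae_ray_le hn1] with ω hω hint
    have hω1 : ‖(ω : Rn n)‖ = 1 := by simp
    obtain ⟨C, hC⟩ := w.exists_abs_rayEnergy_le hn hh hE.le v hω1 hω
    refine integral_nonneg_of_neg_deriv_le hW.pos
      (w.continuousOn_rayEnergy h E v hω1 (hW.continuousOn ω hω1)) ?_ hint hC
    intro r hr hne
    have hnr : ‖r • (ω : Rn n)‖ = r := by rw [norm_smul, hω1, mul_one, Real.norm_of_nonneg hr.le]
    have hx : r • (ω : Rn n) ≠ 0 := norm_pos_iff.1 (by rw [hnr]; exact hr)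
    have hSb := hW.abs_le (r • (ω : Rn n))
    rw [hnr] at hSb
    have hgx := hg (r • (ω : Rn n))
    obtain ⟨D, hD, hle⟩ := exists_hasDerivAt_rayEnergy hn w hc₁ hh v hω1 hr
      (hW.hasDerivAt ω hω1 r hr hne) hSb hgx (hdom _ r hnr hr hne)
    refine ⟨D, hD, hle.trans ?_⟩
    rw [mul_assoc]
    refine mul_le_mul_of_nonneg_left ?_ (by positivity)
    set x := r • (ω : Rn n) with hxdef
    have hwx : 0 < (‖x‖ + 1) ^ (-s) := by positivity
    have hμ'l := w.mu'_lower r hr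
    have hμ' : 0 < w.mu' r := lt_of_lt_of_le (by positivity) hμ'l
    have hμ0 := (w.mu_pos r hr).le
    have hμM := w.mu_le r hr
    have hexp := w.exp_le hh hr
    have hexp1 : 1 ≤ Real.exp (2 * w.phi r / h) := by
      have := w.phi_nonneg r hr
      exact Real.one_le_exp (by positivity)
    rw [hnr] at hwx
    have b1 : E * c₁ / 4 * J₁ x ≤ Real.exp (2 * w.phi r / h) * (E / 4 * w.mu' r * ‖v x‖ ^ 2) := by
      simp only [hJ₁, hnr]
      calc E * c₁ / 4 * ((r + 1) ^ (-s) * ‖v x‖) ^ 2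
          = 1 * (E / 4 * (c₁ * ((r + 1) ^ (-s)) ^ 2) * ‖v x‖ ^ 2) := by ring
        _ ≤ _ := by gcongr
    have b2 : Real.exp (2 * w.phi r / h) * (2 / h ^ 2 * (w.mu r ^ 2 / w.mu' r) *
        ((‖x‖ + 1) ^ (-s) * ‖f x‖) ^ 2) ≤ K₁ * J₂ x := by
      rw [hnr]
      calc _ ≤ Q * (2 / h ^ 2 * (M ^ 2 / (c₁ * ((r + 1) ^ (-s)) ^ 2)) *
            ((r + 1) ^ (-s) * ‖f x‖) ^ 2) := by gcongr
        _ = K₁ * J₂ x := by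
          rw [hK₁, hJ₂]
          field_simp
    have b3 : Real.exp (2 * w.phi r / h) * (2 * w.mu r * (‖e x‖ + |τ| * ‖v x‖) *
        ‖w.radD h v x‖) ≤ K₂ * J₃ x := by
      have hrad : w.mu r * ‖w.radD h v x‖ ≤ (M * (n + 1) + M ^ 2 / h) *
          (‖fderiv ℝ v x‖ + ‖v x‖) := by
        have h1 := w.norm_radD_le hn1 hh v hx
        rw [hnr] at h1
        have h2 := w.mu_mul_inv_le hr
        calc w.mu r * ‖w.radD h v x‖ ≤ w.mu r * ((n * r⁻¹ + M / h) * ‖v x‖ + ‖fderiv ℝ v x‖) := by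
              gcongr
          _ = (n * (w.mu r * r⁻¹) + w.mu r * (M / h)) * ‖v x‖ + w.mu r * ‖fderiv ℝ v x‖ := by ring
          _ ≤ (n * M + M * (M / h)) * ‖v x‖ + M * ‖fderiv ℝ v x‖ := by gcongr
          _ ≤ _ := by
            have : 0 ≤ M * ‖v x‖ + (M * n + M ^ 2 / h) * ‖fderiv ℝ v x‖ := by positivity
            have e : M * (M / h) = M ^ 2 / h := by ring
            rw [e]
            linarith
      calc _ = 2 * Real.exp (2 * w.phi r / h) * (‖e x‖ + |τ| * ‖v x‖) *
            (w.mu r * ‖w.radD h v x‖) := by ring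
        _ ≤ 2 * Q * (‖e x‖ + |τ| * ‖v x‖) * ((M * (n + 1) + M ^ 2 / h) *
          (‖fderiv ℝ v x‖ + ‖v x‖)) := by gcongr
        _ = _ := by rw [hK₂, hJ₃]; ring
    have b4 : Real.exp (2 * w.phi r / h) * (w.mu r * r⁻¹ ^ 2 * h ^ 2 *
        ∑ i, ∑ j, w.rotRem h v i j x) = J₄ x := by
      simp only [hJ₄, hnr, CarlemanWeight.kappa, ← Finset.mul_sum]
      ring
    rw [mul_add, mul_add, mul_add, b4]
    linarith
  have hi₂₃ : Integrable fun x => K₁ * J₂ x + K₂ * J₃ x := (hi₂.const_mul K₁).add (hi₃.const_mul K₂)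
  have hi₂₃₄ : Integrable fun x => K₁ * J₂ x + K₂ * J₃ x + J₄ x := hi₂₃.add hi₄
  rw [integral_sub hi₂₃₄ (hi₁.const_mul _), integral_add hi₂₃ hi₄,
    integral_add (hi₂.const_mul K₁) (hi₃.const_mul K₂), integral_const_mul, integral_const_mul,
    integral_const_mul, h4] at hJ
  linarith

end SemiclassicalResolvent


/-! ### The weighted resolvent bound -/

namespace SemiclassicalResolvent

variable {n : ℕ} {s M c₁ Φ : ℝ}

theorem norm_sq_eq_integral (f : L2 n) : ‖f‖ ^ 2 = ∫ x, ‖f x‖ ^ 2 := by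
  have h := inner_self_eq_norm_sq_to_K (𝕜 := ℂ) f
  rw [L2.inner_def] at h
  simp_rw [inner_self_eq_norm_sq_to_K] at h
  have h2 : (((∫ x, ‖f x‖ ^ 2 : ℝ)) : ℂ) = ((‖f‖ ^ 2 : ℝ) : ℂ) := by
    rw [← integral_complex_ofReal]
    push_cast
    exact h
  exact_mod_cast h2.symm

theorem norm_eq_sqrt_integral (f : L2 n) : ‖f‖ = √(∫ x, ‖f x‖ ^ 2) := by
  rw [← norm_sq_eq_integral, Real.sqrt_sq (norm_nonneg _)]

/-- The Cauchy–Schwarz inequality for the norms of two `L²` functions. -/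
theorem integral_norm_mul_norm_le {α : Type*} [MeasurableSpace α] {μ : Measure α}
    {F G : Type*} [NormedAddCommGroup F] [NormedAddCommGroup G] {f : α → F} {g : α → G}
    (hf : MemLp f 2 μ) (hg : MemLp g 2 μ) :
    ∫ x, ‖f x‖ * ‖g x‖ ∂μ ≤ √(∫ x, ‖f x‖ ^ 2 ∂μ) * √(∫ x, ‖g x‖ ^ 2 ∂μ) := by
  have h := integral_mul_le_Lp_mul_Lq_of_nonneg (μ := μ) Real.HolderConjugate.two_two
    (f := fun x => ‖f x‖) (g := fun x => ‖g x‖) (Eventually.of_forall fun x => norm_nonneg _)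
    (Eventually.of_forall fun x => norm_nonneg _) (by simpa using hf.norm) (by simpa using hg.norm)
  simpa only [Real.rpow_two, ← Real.sqrt_eq_rpow] using h

theorem norm_mulOp_le (V : LInfty n) (u : L2 n) : ‖mulOp V u‖ ≤ ‖V‖ * ‖u‖ :=
  Lp.norm_smul_le V u

theorem coeFn_weightOp (hs : 0 ≤ s) (u : L2 n) :
    weightOp n s hs u =ᵐ[volume] fun x => (((‖x‖ + 1) ^ (-s) : ℝ) : ℂ) * u x := by
  filter_upwards [coeFn_mulOp (memLp_weight (n := n) hs).toLp u,
    (memLp_weight (n := n) hs).coeFn_toLp] with x h1 h2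
  rw [weightOp, h1, h2]

theorem norm_weightOp_apply_le (hs : 0 ≤ s) (u : L2 n) : ‖weightOp n s hs u‖ ≤ ‖u‖ := by
  refine Lp.norm_le_norm_of_ae_le ?_
  filter_upwards [coeFn_weightOp hs u] with x hx
  have hw1 : (‖x‖ + 1) ^ (-s) ≤ 1 :=
    Real.rpow_le_one_of_one_le_of_nonpos (by linarith [norm_nonneg x]) (by linarith)
  rw [hx, norm_mul, Complex.norm_real, Real.norm_of_nonneg (by positivity)]
  exact mul_le_of_le_one_left (norm_nonneg _) hw1

theorem norm_weightOp_sq (hs : 0 ≤ s) (v : 𝓢(Rn n, ℂ)) :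
    ‖weightOp n s hs (toL2 v)‖ ^ 2 = ∫ x, ((‖x‖ + 1) ^ (-s) * ‖v x‖) ^ 2 := by
  rw [norm_sq_eq_integral]
  refine integral_congr_ae ?_
  filter_upwards [coeFn_weightOp hs (toL2 v), v.coeFn_toLp 2 volume] with x h1 h2
  rw [h1, h2, norm_mul, Complex.norm_real, Real.norm_of_nonneg (by positivity)]

theorem norm_toL2 (v : 𝓢(Rn n, ℂ)) : ‖toL2 v‖ = √(∫ x, ‖v x‖ ^ 2) := by
  rw [norm_eq_sqrt_integral]
  congr 1
  refine integral_congr_ae ?_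
  filter_upwards [v.coeFn_toLp 2 volume] with x h
  rw [h]

/-- The `L²` norm of the gradient is controlled by the Dirichlet form. -/
theorem integral_norm_fderiv_sq_le (v : 𝓢(Rn n, ℂ)) :
    ∫ x, ‖fderiv ℝ v x‖ ^ 2 ≤ -(inner ℂ (toL2 v) (toL2 (Δ v))).re := by
  rw [inner_laplacian_self, Complex.neg_re, Complex.ofReal_re, neg_neg]
  have hmem := memLp_fderiv_schwartz v
  have hi : ∀ i : Fin n, Integrable fun x => ‖fderiv ℝ v x (EuclideanSpace.single i 1)‖ ^ 2 := by
    intro i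
    refine (hmem.integrable_norm_pow (p := 2) two_ne_zero).mono' ?_
      (Eventually.of_forall fun x => ?_)
    · exact (((continuous_fderiv_schwartz v).clm_apply continuous_const).norm.pow
        2).aestronglyMeasurable
    · rw [Real.norm_of_nonneg (by positivity)]
      gcongr
      simpa using (fderiv ℝ v x).le_opNorm (EuclideanSpace.single i 1)
  rw [← integral_finsetSum _ fun i _ => hi i]
  refine integral_mono (hmem.integrable_norm_pow (p := 2) two_ne_zero)
    (integrable_finsetSum _ fun i _ => hi i) fun x => ?_
  have hb : ‖fderiv ℝ v x‖ ≤ √(∑ i, ‖fderiv ℝ v x (EuclideanSpace.single i 1)‖ ^ 2) := by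
    refine ContinuousLinearMap.opNorm_le_bound _ (Real.sqrt_nonneg _) fun y => ?_
    have hy : y = ∑ k, y k • EuclideanSpace.single k (1 : ℝ) := by
      ext i
      simp [Pi.single_apply]
    calc ‖fderiv ℝ v x y‖ = ‖∑ k, y k • fderiv ℝ v x (EuclideanSpace.single k (1 : ℝ))‖ := by
          conv_lhs => rw [hy]
          simp
      _ ≤ ∑ k, ‖fderiv ℝ v x (EuclideanSpace.single k (1 : ℝ))‖ * ‖y k‖ := by
          refine (norm_sum_le _ _).trans_eq (Finset.sum_congr rfl fun k _ => ?_)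
          rw [norm_smul, mul_comm]
      _ ≤ √(∑ i, ‖fderiv ℝ v x (EuclideanSpace.single i 1)‖ ^ 2) * √(∑ i, ‖y i‖ ^ 2) :=
          Real.sum_mul_le_sqrt_mul_sqrt _ _ _
      _ = _ := by rw [EuclideanSpace.norm_eq y]
  calc ‖fderiv ℝ v x‖ ^ 2 ≤ (√(∑ i, ‖fderiv ℝ v x (EuclideanSpace.single i 1)‖ ^ 2)) ^ 2 := by
        gcongr
    _ = _ := Real.sq_sqrt (by positivity)

theorem coeFn_schrodinger_schwartz (h : ℝ) (V : LInfty n) (z : ℂ) (v : 𝓢(Rn n, ℂ)) :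
    ((schrodingerH2 h V (schwartzH2 v) - z • toL2 v : L2 n) : Rn n → ℂ) =ᵐ[volume]
      fun x => -(h : ℂ) ^ 2 * Δ v x + ((V x : ℂ) - z) * v x := by
  rw [schrodingerH2_apply, laplacianH2_schwartzH2]
  have hc : ((schwartzH2 v : H2 n) : L2 n) = toL2 v := rfl
  rw [hc]
  filter_upwards [Lp.coeFn_sub (-((h : ℂ) ^ 2) • toL2 (Δ v) + mulOp V (toL2 v)) (z • toL2 v),
    Lp.coeFn_add (-((h : ℂ) ^ 2) • toL2 (Δ v)) (mulOp V (toL2 v)),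
    Lp.coeFn_smul (-((h : ℂ) ^ 2)) (toL2 (Δ v)), Lp.coeFn_smul z (toL2 v),
    coeFn_mulOp V (toL2 v), v.coeFn_toLp 2 volume, (Δ v).coeFn_toLp 2 volume]
    with x h1 h2 h3 h4 h5 h6 h7
  rw [h1, Pi.sub_apply, h2, Pi.add_apply, h3, h4, Pi.smul_apply, Pi.smul_apply, h5, h6, h7,
    smul_eq_mul, smul_eq_mul]
  ring

/-- The gradient of a Schwartz function is controlled by `P(h) - z`. -/
theorem mul_sqrt_integral_fderiv_le {h : ℝ} (hh : 0 < h) (V : LInfty n) (z : ℂ)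
    (v : 𝓢(Rn n, ℂ)) :
    √(∫ x, ‖fderiv ℝ v x‖ ^ 2) ≤ (‖schrodingerH2 h V (schwartzH2 v) - z • toL2 v‖ +
      (‖V‖ + ‖z‖ + 1) * ‖toL2 v‖) / h := by
  set T : L2 n := schrodingerH2 h V (schwartzH2 v) - z • toL2 v with hT
  have hc : ((schwartzH2 v : H2 n) : L2 n) = toL2 v := rfl
  have hΔ : ((h ^ 2 : ℝ) : ℂ) • toL2 (Δ v) = mulOp V (toL2 v) - z • toL2 v - T := by
    rw [hT, schrodingerH2_apply, laplacianH2_schwartzH2, hc]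
    push_cast
    module
  have h1 : h ^ 2 * ∫ x, ‖fderiv ℝ v x‖ ^ 2 ≤
      ‖toL2 v‖ * (‖T‖ + (‖V‖ + ‖z‖) * ‖toL2 v‖) := by
    calc h ^ 2 * ∫ x, ‖fderiv ℝ v x‖ ^ 2 ≤ h ^ 2 * -(inner ℂ (toL2 v) (toL2 (Δ v))).re := by
          gcongr
          exact integral_norm_fderiv_sq_le v
      _ = -(inner ℂ (toL2 v) (((h ^ 2 : ℝ) : ℂ) • toL2 (Δ v))).re := by
          rw [inner_smul_right, Complex.re_ofReal_mul]
          ring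
      _ ≤ ‖toL2 v‖ * ‖((h ^ 2 : ℝ) : ℂ) • toL2 (Δ v)‖ :=
          (neg_le_abs _).trans ((Complex.abs_re_le_norm _).trans (norm_inner_le_norm _ _))
      _ ≤ _ := by
          rw [hΔ]
          gcongr
          refine (norm_sub_le _ _).trans ?_
          rw [add_comm ‖T‖, add_mul]
          gcongr
          refine (norm_sub_le _ _).trans ?_
          rw [norm_smul]
          gcongr
          exact norm_mulOp_le V _
  rw [le_div_iff₀ hh]
  refine abs_le_of_sq_le_sq' ?_ (by positivity) |>.2
  rw [mul_pow, Real.sq_sqrt (integral_nonneg fun x => by positivity), mul_comm]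
  refine h1.trans ?_
  have hV := norm_nonneg V
  have hz := norm_nonneg z
  have hT0 := norm_nonneg T
  have hv0 := norm_nonneg (toL2 v)
  nlinarith [mul_nonneg hT0 hv0, mul_nonneg (mul_nonneg hV hv0) hT0,
    mul_nonneg (mul_nonneg hz hv0) hT0, sq_nonneg (‖V‖ + ‖z‖), mul_nonneg hV (sq_nonneg ‖toL2 v‖),
    mul_nonneg hz (sq_nonneg ‖toL2 v‖), sq_nonneg ‖T‖, sq_nonneg ‖toL2 v‖,
    mul_nonneg (sq_nonneg (‖V‖ + ‖z‖)) (sq_nonneg ‖toL2 v‖)]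

/-- The Carleman estimate on `H²`. -/
theorem carleman_H2 (hn : 3 ≤ n) (hs : 0 ≤ s) (w : CarlemanWeight s M c₁ Φ) (hc₁ : 0 < c₁)
    {h E r₀ K : ℝ} (hh : 0 < h) (hE : 0 < E) {Sb : ℝ → ℝ} {W dW S : Rn n → ℝ}
    (hW : RadialSplit r₀ K Sb W dW S) (hdom : w.Dominates h E r₀ Sb W dW) (V : LInfty n)
    (hV : ∀ᵐ x, V x = W x + S x) (u : H2 n) (f : L2 n) (τ : ℝ)
    (hu : schrodingerH2 h V u - ((E : ℂ) - τ * Complex.I) • (u : L2 n) = weightOp n s hs f) :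
    E * c₁ / 4 * ‖weightOp n s hs u‖ ^ 2 ≤
      2 * Real.exp (2 * Φ / h) * M ^ 2 / (h ^ 2 * c₁) * ‖f‖ ^ 2 +
      2 * Real.exp (2 * Φ / h) * (M * (n + 1) + M ^ 2 / h) * (|τ| * ‖(u : L2 n)‖ *
        ((‖weightOp n s hs f‖ + (‖V‖ + ‖(E : ℂ) - τ * Complex.I‖ + 1) * ‖(u : L2 n)‖) / h +
          ‖(u : L2 n)‖)) := by
  have hM := w.M_nonneg
  set z : ℂ := (E : ℂ) - τ * Complex.I with hz
  obtain ⟨v, hv, hvΔ⟩ := exists_schwartz_tendsto u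
  set T : ℕ → L2 n := fun j => schrodingerH2 h V (schwartzH2 (v j)) - z • toL2 (v j) with hT
  have hTlim : Tendsto T atTop (𝓝 (weightOp n s hs f)) := by
    rw [← hu, schrodingerH2_apply]
    have h1 := ((hvΔ.const_smul (-((h : ℂ) ^ 2))).add
      (((mulOp V).continuous.tendsto _).comp hv)).sub (hv.const_smul z)
    refine h1.congr fun j => ?_
    simp only [hT, schrodingerH2_apply, laplacianH2_schwartzH2, Function.comp]
    rfl
  have hstep : ∀ j, E * c₁ / 4 * ‖weightOp n s hs (toL2 (v j))‖ ^ 2 ≤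
      2 * Real.exp (2 * Φ / h) * M ^ 2 / (h ^ 2 * c₁) * ‖f‖ ^ 2 +
      2 * Real.exp (2 * Φ / h) * (M * (n + 1) + M ^ 2 / h) *
        ((‖T j - weightOp n s hs f‖ + |τ| * ‖toL2 (v j)‖) *
        ((‖T j‖ + (‖V‖ + ‖z‖ + 1) * ‖toL2 (v j)‖) / h + ‖toL2 (v j)‖)) := by
    intro j
    -- a representative of `T j - weightOp f` that satisfies the equation at every point, as needed
    -- on individual rays
    set e : Rn n → ℂ := fun x => (-(h : ℂ) ^ 2 * Δ (v j) x +
      (((W x + S x - E : ℝ) : ℂ) + τ * Complex.I) * v j x) - (((‖x‖ + 1) ^ (-s) : ℝ) : ℂ) * f x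
      with he
    have hee : ((T j - weightOp n s hs f : L2 n) : Rn n → ℂ) =ᵐ[volume] e := by
      filter_upwards [Lp.coeFn_sub (T j) (weightOp n s hs f),
        coeFn_schrodinger_schwartz h V z (v j), coeFn_weightOp hs f, hV] with x h1 h2 h3 h4
      rw [h1, Pi.sub_apply, h3, he]
      simp only [hT]
      rw [h2, h4, hz]
      push_cast
      ring
    have hem : MemLp e 2 volume := (memLp_congr_ae hee).1 (Lp.memLp _)
    have hen : √(∫ x, ‖e x‖ ^ 2) = ‖T j - weightOp n s hs f‖ := by
      rw [norm_eq_sqrt_integral]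
      congr 1
      refine integral_congr_ae ?_
      filter_upwards [hee] with x hx
      rw [hx]
    have hvm : MemLp (v j) 2 volume := (v j).memLp 2 volume
    have hdm := memLp_fderiv_schwartz (v j)
    have hcar := carleman_schwartz hn hs w hc₁ hh hE hW hdom (v j) (τ := τ) (Lp.memLp f) hem
      (fun x => by
        have hx : -(h : ℂ) ^ 2 * Δ (v j) x + (((W x + S x - E : ℝ) : ℂ) + τ * Complex.I) * v j x =
            (((‖x‖ + 1) ^ (-s) : ℝ) : ℂ) * f x + e x := by rw [he]; ring
        rw [hx]
        refine (norm_add_le _ _).trans_eq ?_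
        rw [norm_mul, Complex.norm_real, Real.norm_of_nonneg (by positivity)])
    rw [← norm_weightOp_sq hs, ← norm_sq_eq_integral] at hcar
    refine hcar.trans ?_
    gcongr
    have i1 := MemLp.integrable_norm_mul_norm hem hdm
    have i2 := MemLp.integrable_norm_mul_norm hem hvm
    have i3 := (MemLp.integrable_norm_mul_norm hvm hdm).const_mul |τ|
    have i4 := (MemLp.integrable_norm_mul_norm hvm hvm).const_mul |τ|
    have hexpand : ∫ x, (‖e x‖ + |τ| * ‖v j x‖) * (‖fderiv ℝ (v j) x‖ + ‖v j x‖) =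
        ((∫ x, ‖e x‖ * ‖fderiv ℝ (v j) x‖) + ∫ x, ‖e x‖ * ‖v j x‖) +
          (|τ| * (∫ x, ‖v j x‖ * ‖fderiv ℝ (v j) x‖) + |τ| * ∫ x, ‖v j x‖ * ‖v j x‖) := by
      have i12 : Integrable fun x => ‖e x‖ * ‖fderiv ℝ (v j) x‖ + ‖e x‖ * ‖v j x‖ := i1.add i2
      have i34 : Integrable fun x => |τ| * (‖v j x‖ * ‖fderiv ℝ (v j) x‖) +
        |τ| * (‖v j x‖ * ‖v j x‖) := i3.add i4
      rw [← integral_const_mul, ← integral_const_mul, ← integral_add i1 i2, ← integral_add i3 i4,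
        ← integral_add i12 i34]
      refine integral_congr_ae (Eventually.of_forall fun x => ?_)
      simp only
      ring
    rw [hexpand]
    have c1 := integral_norm_mul_norm_le hem hdm
    have c2 := integral_norm_mul_norm_le hem hvm
    have c3 := integral_norm_mul_norm_le hvm hdm
    have c4 := integral_norm_mul_norm_le hvm hvm
    rw [hen, ← norm_toL2] at c2
    rw [hen] at c1
    rw [← norm_toL2] at c3 c4
    have hG := mul_sqrt_integral_fderiv_le hh V z (v j)
    set G := √(∫ x, ‖fderiv ℝ (v j) x‖ ^ 2)
    calc _ ≤ (‖T j - weightOp n s hs f‖ * G + ‖T j - weightOp n s hs f‖ * ‖toL2 (v j)‖) +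
          (|τ| * (‖toL2 (v j)‖ * G) + |τ| * (‖toL2 (v j)‖ * ‖toL2 (v j)‖)) := by gcongr
      _ = (‖T j - weightOp n s hs f‖ + |τ| * ‖toL2 (v j)‖) * (G + ‖toL2 (v j)‖) := by ring
      _ ≤ _ := by gcongr
  have hlimL : Tendsto (fun j => E * c₁ / 4 * ‖weightOp n s hs (toL2 (v j))‖ ^ 2) atTop
      (𝓝 (E * c₁ / 4 * ‖weightOp n s hs u‖ ^ 2)) :=
    ((((weightOp n s hs).continuous.tendsto _).comp hv).norm.pow 2).const_mul _
  have hlimR := (((((hTlim.sub_const (weightOp n s hs f)).norm.add (hv.norm.const_mul |τ|)).mul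
    (((hTlim.norm.add (hv.norm.const_mul (‖V‖ + ‖z‖ + 1))).div_const h).add hv.norm)).const_mul
    (2 * Real.exp (2 * Φ / h) * (M * (n + 1) + M ^ 2 / h))).const_add
    (2 * Real.exp (2 * Φ / h) * M ^ 2 / (h ^ 2 * c₁) * ‖f‖ ^ 2))
  have := le_of_tendsto_of_tendsto' hlimL hlimR hstep
  rwa [sub_self, norm_zero, zero_add] at this

/-- The weighted resolvent bound that results from a Carleman weight: with `u` the resolvent applied
to `w f`, `w = (‖x‖+1)^(-s)`, the error term of `carleman_H2` is controlled by
`|τ| ‖u‖² ≤ ‖w u‖ ‖f‖`. -/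
theorem exists_resolvent_norm_le (hn : 3 ≤ n) (hs : 0 ≤ s) (w : CarlemanWeight s M c₁ Φ)
    (hc₁ : 0 < c₁) {h E r₀ K : ℝ} (hh : 0 < h) (hE : 0 < E) {Sb : ℝ → ℝ} {W dW S : Rn n → ℝ}
    (hW : RadialSplit r₀ K Sb W dW S) (hdom : w.Dominates h E r₀ Sb W dW) (V : LInfty n)
    (hV : ∀ᵐ x, V x = W x + S x) {τ : ℝ} (hτ : τ ≠ 0) (hτ1 : |τ| ≤ 1) :
    ∃ R : L2 n →L[ℂ] L2 n, IsResolvent (schrodinger h V) ((E : ℂ) - τ * Complex.I) R ∧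
      ‖weightOp n s hs ∘L R ∘L weightOp n s hs‖ ≤
        1 + (2 * Real.exp (2 * Φ / h) * M ^ 2 / (h ^ 2 * c₁) +
          2 * Real.exp (2 * Φ / h) * (M * (n + 1) + M ^ 2 / h) *
            ((‖V‖ + E + 3) / h + 1)) / (E * c₁ / 4) := by
  have hM := w.M_nonneg
  have him : ((E : ℂ) - τ * Complex.I).im = -τ := by simp
  obtain ⟨R, hR⟩ := exists_isResolvent hh.ne' V (z := (E : ℂ) - τ * Complex.I)
    (by rw [him]; exact neg_ne_zero.2 hτ)
  refine ⟨R, hR, ContinuousLinearMap.opNorm_le_bound _ (by positivity) fun f => ?_⟩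
  obtain ⟨hmem, hsol⟩ := hR.1 (weightOp n s hs f)
  set u : H2 n := ⟨R (weightOp n s hs f), hmem⟩ with hu
  have hsol' : schrodingerH2 h V u - ((E : ℂ) - τ * Complex.I) • (u : L2 n) = weightOp n s hs f :=
    hsol
  change ‖weightOp n s hs u‖ ≤ _
  set z : ℂ := (E : ℂ) - τ * Complex.I with hz
  have hzn : ‖z‖ ≤ E + 1 := by
    refine (norm_sub_le _ _).trans ?_
    rw [norm_mul, Complex.norm_I, mul_one, Complex.norm_real, Complex.norm_real, Real.norm_eq_abs,
      Real.norm_eq_abs, abs_of_pos hE]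
    linarith
  have hcar := carleman_H2 hn hs w hc₁ hh hE hW hdom V hV u f τ hsol'
  rw [← hz] at hcar
  set Q := Real.exp (2 * Φ / h)
  set K₁ := 2 * Q * M ^ 2 / (h ^ 2 * c₁)
  set K₂ := 2 * Q * (M * (n + 1) + M ^ 2 / h)
  set a := ‖weightOp n s hs u‖
  set b := ‖f‖
  set U := ‖(u : L2 n)‖
  have hK₁ : 0 ≤ K₁ := by positivity
  have hK₂ : 0 ≤ K₂ := by positivity
  have ha : 0 ≤ a := norm_nonneg _
  have hb : 0 ≤ b := norm_nonneg _
  have hU : 0 ≤ U := norm_nonneg _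
  have hwf : ‖weightOp n s hs f‖ ≤ b := norm_weightOp_apply_le hs f
  have h1 : |τ| * U ≤ b := by
    have := abs_im_mul_norm_le h V z u
    rw [him, abs_neg, hsol'] at this
    exact this.trans hwf
  -- the weight is moved from `f` to `u`, which turns the error term into a multiple of `a`
  have h2 : |τ| * U ^ 2 ≤ a * b := by
    have := im_inner_schrodinger_sub h V z u
    rw [hsol', him, neg_neg, weightOp, ← inner_mulOp] at this
    change (inner ℂ (weightOp n s hs (u : L2 n)) f).im = _ at this
    have h3 := (Complex.abs_im_le_norm _).trans
      (norm_inner_le_norm (𝕜 := ℂ) (weightOp n s hs (u : L2 n)) f)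
    rwa [this, abs_mul, abs_of_nonneg (sq_nonneg U)] at h3
  have h3 : |τ| * U * ((‖weightOp n s hs f‖ + (‖V‖ + ‖z‖ + 1) * U) / h + U) ≤
      b ^ 2 / h + ((‖V‖ + E + 2) / h + 1) * (a * b) := by
    have hVz : 0 ≤ ‖V‖ + ‖z‖ + 1 := by positivity
    calc _ = (|τ| * U) * ‖weightOp n s hs f‖ / h +
          ((‖V‖ + ‖z‖ + 1) / h + 1) * (|τ| * U ^ 2) := by ring
      _ ≤ b * b / h + ((‖V‖ + (E + 1) + 1) / h + 1) * (a * b) := by gcongr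
      _ = _ := by ring
  have h4 : E * c₁ / 4 * a ^ 2 ≤ K₁ * b ^ 2 +
      K₂ * (b ^ 2 / h + ((‖V‖ + E + 2) / h + 1) * (a * b)) := hcar.trans (by gcongr)
  set c := E * c₁ / 4 with hc
  have hc0 : 0 < c := by positivity
  set L := K₁ + K₂ * ((‖V‖ + E + 3) / h + 1) with hL
  have hV0 := norm_nonneg V
  have hL0 : 0 ≤ L := by positivity
  rcases le_or_gt a b with hab | hab
  · exact hab.trans (le_mul_of_one_le_left hb (by linarith [div_nonneg hL0 hc0.le]))
  · have h5 : c * a ^ 2 ≤ L * (a * b) := by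
      refine h4.trans ?_
      have hbb : b ^ 2 ≤ a * b := by nlinarith
      calc _ ≤ K₁ * (a * b) + K₂ * ((a * b) / h + ((‖V‖ + E + 2) / h + 1) * (a * b)) := by gcongr
        _ = _ := by rw [hL]; ring
    have ha0 : 0 < a := hb.trans_lt hab
    have h6 : c * a ≤ L * b := by
      refine le_of_mul_le_mul_right ?_ ha0
      linarith [h5]
    have h7 : a ≤ L / c * b := by
      rw [div_mul_eq_mul_div, le_div_iff₀ hc0]
      linarith
    linarith

end SemiclassicalResolvent


/-! ### The radial multiplier and the radial phase -/

namespace SemiclassicalResolvent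

variable {ε a τ k r : ℝ}

/-- The variable `y` with `1 + y = 1 + ((r+1)² - 1)/a²` in terms of which the multiplier is
written. -/
noncomputable def scaledSq (a r : ℝ) : ℝ := (r ^ 2 + 2 * r) / a ^ 2

/-- The radial multiplier: comparable to `(r² + 2r)/a²` for `r ≪ a`, and tending to `1` at
infinity. -/
noncomputable def radialMu (ε a r : ℝ) : ℝ := 1 - (1 + scaledSq a r) ^ (-(ε / 2))

/-- The derivative of `radialMu`. -/
noncomputable def radialMu' (ε a r : ℝ) : ℝ :=
  ε / a ^ 2 * (r + 1) * (1 + scaledSq a r) ^ (-(ε / 2) - 1)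

/-- The harmonic truncation of `1 + r` at the scale `a`. -/
noncomputable def truncRadius (a r : ℝ) : ℝ := a * (1 + r) / (a + (1 + r))

/-- The radial phase: its derivative is comparable to `τ (1+r)^(-k)` for `r ≪ a` and is integrable
at infinity. -/
noncomputable def radialPhi (τ k a r : ℝ) : ℝ := τ / (1 - k) * truncRadius a r ^ (1 - k)

/-- The derivative of `radialPhi`. -/
noncomputable def radialPhi' (τ k a r : ℝ) : ℝ := τ * truncRadius a r ^ (2 - k) / (1 + r) ^ 2

/-- The second derivative of `radialPhi`. -/
noncomputable def radialPhi'' (τ k a r : ℝ) : ℝ :=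
  radialPhi' τ k a r * (((2 - k) * (a / (a + (1 + r))) - 2) / (1 + r))

theorem scaledSq_pos (ha : 0 < a) (hr : 0 < r) : 0 < scaledSq a r := by
  rw [scaledSq]; positivity

theorem hasDerivAt_scaledSq (a r : ℝ) : HasDerivAt (scaledSq a) (2 * (r + 1) / a ^ 2) r := by
  have := ((hasDerivAt_pow 2 r).add ((hasDerivAt_id r).const_mul 2)).div_const (a ^ 2)
  refine this.congr_deriv ?_
  push_cast
  ring

theorem hasDerivAt_radialMu (ha : 0 < a) (hr : 0 < r) :
    HasDerivAt (radialMu ε a) (radialMu' ε a r) r := by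
  have hy := scaledSq_pos ha hr
  have := (((hasDerivAt_scaledSq a r).const_add 1).rpow_const (p := -(ε / 2))
    (Or.inl (by positivity))).const_sub 1
  refine this.congr_deriv ?_
  rw [radialMu']
  ring

theorem truncRadius_pos (ha : 0 < a) (hr : 0 < r) : 0 < truncRadius a r := by
  rw [truncRadius]; positivity

theorem truncRadius_le_left (ha : 0 < a) (hr : 0 < r) : truncRadius a r ≤ a := by
  rw [truncRadius, div_le_iff₀ (by positivity)]
  nlinarith

theorem truncRadius_le_right (ha : 0 < a) (hr : 0 < r) : truncRadius a r ≤ 1 + r := by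
  rw [truncRadius, div_le_iff₀ (by positivity)]
  nlinarith

theorem hasDerivAt_truncRadius (ha : 0 < a) (hr : 0 < r) :
    HasDerivAt (truncRadius a) (truncRadius a r ^ 2 / (1 + r) ^ 2) r := by
  have h1 : HasDerivAt (fun r : ℝ => 1 + r) 1 r := (hasDerivAt_id r).const_add 1
  have := (h1.const_mul a).div (h1.const_add a) (by positivity)
  refine this.congr_deriv ?_
  rw [truncRadius]
  field_simp
  ring

theorem hasDerivAt_radialPhi (ha : 0 < a) (hk : k < 1) (hr : 0 < r) :
    HasDerivAt (radialPhi τ k a) (radialPhi' τ k a r) r := by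
  have hz := truncRadius_pos ha hr
  have h1k : 1 - k ≠ 0 := by linarith
  have := ((hasDerivAt_truncRadius ha hr).rpow_const (p := 1 - k) (Or.inl hz.ne')).const_mul
    (τ / (1 - k))
  refine this.congr_deriv ?_
  have e : truncRadius a r ^ (2 - k) = truncRadius a r ^ (1 - k - 1) * truncRadius a r ^ 2 := by
    rw [← Real.rpow_natCast, ← Real.rpow_add hz]
    congr 1
    push_cast
    ring
  rw [radialPhi', e]
  field_simp

theorem hasDerivAt_radialPhi' (ha : 0 < a) (hr : 0 < r) :
    HasDerivAt (radialPhi' τ k a) (radialPhi'' τ k a r) r := by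
  have hz := truncRadius_pos ha hr
  have h1 : HasDerivAt (fun r : ℝ => (1 + r) ^ 2) (2 * (1 + r)) r := by
    refine (((hasDerivAt_id r).const_add 1).pow 2).congr_deriv ?_
    simp
  have := (((hasDerivAt_truncRadius ha hr).rpow_const (p := 2 - k) (Or.inl hz.ne')).const_mul
    τ).div h1 (by positivity)
  refine this.congr_deriv ?_
  have e : truncRadius a r ^ (2 - k) = truncRadius a r ^ (2 - k - 1) * truncRadius a r := by
    rw [← Real.rpow_add_one hz.ne']
    congr 1
    ring
  rw [radialPhi'', radialPhi', e]
  rw [show truncRadius a r ^ 2 = truncRadius a r * (a * (1 + r) / (a + (1 + r))) by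
    rw [sq]; rfl]
  field_simp

theorem radialMu_pos (hε : 0 < ε) (ha : 0 < a) (hr : 0 < r) : 0 < radialMu ε a r := by
  have hy := scaledSq_pos ha hr
  have := Real.rpow_lt_one_of_one_lt_of_neg (x := 1 + scaledSq a r) (z := -(ε / 2))
    (by linarith) (by linarith)
  rw [radialMu]
  linarith

theorem radialMu_le_one (ha : 0 < a) (hr : 0 < r) : radialMu ε a r ≤ 1 := by
  have hy := scaledSq_pos ha hr
  have : 0 ≤ (1 + scaledSq a r) ^ (-(ε / 2)) := by positivity
  rw [radialMu]
  linarith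

/-- Bernoulli's inequality for the exponent `p ≤ 1`. -/
theorem one_sub_rpow_neg_le {p y : ℝ} (hp : 0 ≤ p) (hp1 : p ≤ 1) (hy : 0 < y) :
    1 - (1 + y) ^ (-p) ≤ p * y * (1 + y) * (1 + y) ^ (-p - 1) := by
  have h0 : 0 < 1 + y := by linarith
  have h1 := rpow_one_add_le_one_add_mul_self (s := y) (by linarith) hp hp1
  have e1 : (1 + y) * (1 + y) ^ (-p - 1) = (1 + y) ^ (-p) := by
    rw [mul_comm, ← Real.rpow_add_one h0.ne']
    congr 1
    ring
  have e2 : (1 + y) ^ p * (1 + y) ^ (-p) = 1 := by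
    rw [← Real.rpow_add h0, add_neg_cancel, Real.rpow_zero]
  have h2 : 0 < (1 + y) ^ (-p) := by positivity
  rw [mul_assoc, e1]
  nlinarith

/-- Bernoulli's inequality for the exponent `p + 1`. -/
theorem le_one_sub_rpow_neg {p y : ℝ} (hp : 0 ≤ p) (hy : 0 < y) :
    p * y * (1 + y) ^ (-p - 1) ≤ 1 - (1 + y) ^ (-p) := by
  have h0 : 0 < 1 + y := by linarith
  have h1 := one_add_mul_self_le_rpow_one_add (s := y) (by linarith) (p := p + 1) (by linarith)
  have e1 : (1 + y) * (1 + y) ^ (-p - 1) = (1 + y) ^ (-p) := by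
    rw [mul_comm, ← Real.rpow_add_one h0.ne']
    congr 1
    ring
  have e2 : (1 + y) ^ (p + 1) * (1 + y) ^ (-p - 1) = 1 := by
    rw [← Real.rpow_add h0]
    ring_nf
    exact Real.rpow_zero _
  have h2 : 0 < (1 + y) ^ (-p - 1) := by positivity
  rw [← e1]
  nlinarith

theorem sq_mul_scaledSq (ha : 0 < a) : a ^ 2 * scaledSq a r = (1 + r) ^ 2 - 1 := by
  rw [scaledSq]
  field_simp
  ring

/-- The multiplier is at most quadratic, up to the factor `1 + y`. -/
theorem radialMu_le_mul_radialMu' (hε : 0 < ε) (hε1 : ε ≤ 1) (ha : 0 < a) (hr : 0 < r) :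
    radialMu ε a r ≤ (1 + scaledSq a r) * ((1 + r) / 2) * radialMu' ε a r := by
  have hy := scaledSq_pos ha hr
  refine (one_sub_rpow_neg_le (by linarith) (by linarith) hy).trans ?_
  have hle : scaledSq a r ≤ (1 + r) ^ 2 / a ^ 2 := by
    rw [le_div_iff₀ (by positivity), mul_comm, sq_mul_scaledSq ha]
    linarith
  rw [radialMu']
  calc _ = ε / 2 * (1 + scaledSq a r) * (1 + scaledSq a r) ^ (-(ε / 2) - 1) * scaledSq a r := by
        ring
    _ ≤ ε / 2 * (1 + scaledSq a r) * (1 + scaledSq a r) ^ (-(ε / 2) - 1) *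
        ((1 + r) ^ 2 / a ^ 2) := by gcongr
    _ = _ := by ring

theorem radialMu_le_two_mul (hε : 0 < ε) (hε1 : ε ≤ 1) (ha : 1 ≤ a) (hr : 0 < r) :
    radialMu ε a r ≤ 2 * r := by
  have ha0 : 0 < a := by linarith
  have hy := scaledSq_pos ha0 hr
  rcases le_total 1 r with h1 | h1
  · linarith [radialMu_le_one (ε := ε) ha0 hr]
  · have h2 := one_sub_rpow_neg_le (p := ε / 2) (by linarith) (by linarith) hy
    have e1 : (1 + scaledSq a r) * (1 + scaledSq a r) ^ (-(ε / 2) - 1) ≤ 1 := by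
      rw [mul_comm, ← Real.rpow_add_one (by positivity)]
      exact Real.rpow_le_one_of_one_le_of_nonpos (by linarith) (by linarith)
    have h3 : scaledSq a r ≤ r ^ 2 + 2 * r := div_le_self (by positivity) (one_le_pow₀ ha)
    rw [mul_assoc] at h2
    have h4 : radialMu ε a r ≤ ε / 2 * scaledSq a r * 1 := h2.trans (by gcongr)
    nlinarith

theorem radialMu'_mul_le (hε : 0 < ε) (ha : 0 < a) (hr : 0 < r) :
    radialMu' ε a r * r ≤ 2 * radialMu ε a r := by
  have hy := scaledSq_pos ha hr
  have h1 := le_one_sub_rpow_neg (p := ε / 2) (by linarith) hy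
  have hle : (r + 1) * r / a ^ 2 ≤ scaledSq a r := by
    rw [scaledSq]
    gcongr
    nlinarith
  calc radialMu' ε a r * r = 2 * (ε / 2 * ((r + 1) * r / a ^ 2) *
        (1 + scaledSq a r) ^ (-(ε / 2) - 1)) := by rw [radialMu']; ring
    _ ≤ 2 * (ε / 2 * scaledSq a r * (1 + scaledSq a r) ^ (-(ε / 2) - 1)) := by gcongr
    _ ≤ _ := by rw [radialMu]; linarith

/-- A lower bound of `radialMu'` from an upper bound of `1 + y`. -/
theorem le_radialMu' {A : ℝ} (hε : 0 < ε) (ha : 0 < a) (hr : 0 < r) (hA : 0 < A)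
    (h : a ^ 2 - 1 + (1 + r) ^ 2 ≤ A * (1 + r) ^ 2) :
    ε * A ^ (-(ε / 2) - 1) * a ^ ε * (1 + r) ^ (-1 - ε) ≤ radialMu' ε a r := by
  have hy := scaledSq_pos ha hr
  have hle : 1 + scaledSq a r ≤ A * ((1 + r) / a) ^ 2 := by
    rw [div_pow, ← mul_div_assoc, le_div_iff₀ (by positivity), add_mul, mul_comm (scaledSq a r),
      sq_mul_scaledSq ha]
    linarith
  have h1 : (A * ((1 + r) / a) ^ 2) ^ (-(ε / 2) - 1) ≤ (1 + scaledSq a r) ^ (-(ε / 2) - 1) :=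
    Real.rpow_le_rpow_of_nonpos (by linarith) hle (by linarith)
  have e1 : (A * ((1 + r) / a) ^ 2) ^ (-(ε / 2) - 1) =
      A ^ (-(ε / 2) - 1) * (a ^ ε * a ^ 2) * ((1 + r) ^ (-1 - ε) / (1 + r)) := by
    rw [Real.mul_rpow hA.le (by positivity), ← Real.rpow_natCast ((1 + r) / a) 2,
      ← Real.rpow_mul (by positivity), Real.div_rpow (by positivity) ha.le, mul_assoc]
    congr 1
    have e2 : ((2 : ℕ) : ℝ) * (-(ε / 2) - 1) = -ε - 2 := by push_cast; ring
    have e3 : (1 + r) ^ (-ε - 2) = (1 + r) ^ (-1 - ε) / (1 + r) := by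
      rw [← Real.rpow_sub_one (by positivity)]
      congr 1
      ring
    have e4 : a ^ (-ε - 2) = (a ^ ε * a ^ 2)⁻¹ := by
      rw [← Real.rpow_natCast a 2, ← Real.rpow_add ha, ← Real.rpow_neg ha.le]
      congr 1
      push_cast
      ring
    rw [e2, e3, e4, div_inv_eq_mul, mul_comm]
  calc _ = ε / a ^ 2 * (r + 1) * (A ^ (-(ε / 2) - 1) * (a ^ ε * a ^ 2) *
        ((1 + r) ^ (-1 - ε) / (1 + r))) := by
        field_simp
        ring
    _ ≤ _ := by
        rw [← e1, radialMu']
        gcongr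

/-- The lower bound with the square of the weight of the resolvent estimate; the loss `a⁻²` is a
power of `h`, which is harmless. -/
theorem radialMu'_lower {s : ℝ} (hε : 0 < ε) (hεs : ε ≤ 2 * s - 1) (ha : 1 ≤ a) (hr : 0 < r) :
    ε / a ^ 2 * ((r + 1) ^ (-s)) ^ 2 ≤ radialMu' ε a r := by
  have ha0 : 0 < a := by linarith
  have h1 := le_radialMu' (A := a ^ 2) hε ha0 hr (by positivity) (by
    nlinarith [one_le_pow₀ ha (n := 2), mul_pos hr hr])
  refine le_trans ?_ h1
  have e1 : (a ^ 2) ^ (-(ε / 2) - 1) * a ^ ε = (a ^ 2)⁻¹ := by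
    rw [← Real.rpow_natCast a 2, ← Real.rpow_mul ha0.le, ← Real.rpow_add ha0,
      ← Real.rpow_neg ha0.le]
    congr 1
    push_cast
    ring
  have e2 : ((r + 1) ^ (-s)) ^ 2 = (1 + r) ^ (-(2 * s)) := by
    rw [← Real.rpow_natCast, ← Real.rpow_mul (by positivity), add_comm]
    congr 1
    push_cast
    ring
  rw [e2, mul_assoc ε, e1, div_eq_mul_inv]
  gcongr
  · linarith
  · linarith

theorem radialPhi'_pos (hτ : 0 < τ) (ha : 0 < a) (hr : 0 < r) : 0 < radialPhi' τ k a r := by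
  have := truncRadius_pos ha hr
  rw [radialPhi']
  positivity

theorem radialPhi'_le (hτ : 0 < τ) (hk : k ≤ 2) (ha : 0 < a) (hr : 0 < r) :
    radialPhi' τ k a r ≤ τ * (1 + r) ^ (-k) := by
  have hz := truncRadius_pos ha hr
  have h1 : truncRadius a r ^ (2 - k) ≤ (1 + r) ^ (2 - k) :=
    Real.rpow_le_rpow hz.le (truncRadius_le_right ha hr) (by linarith)
  have e1 : (1 + r) ^ (2 - k) = (1 + r) ^ (-k) * (1 + r) ^ 2 := by
    rw [← Real.rpow_natCast, ← Real.rpow_add (by positivity)]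
    congr 1
    push_cast
    ring
  rw [radialPhi', div_le_iff₀ (by positivity), mul_assoc, ← e1]
  gcongr

theorem le_radialPhi' (hτ : 0 < τ) (hk0 : 0 ≤ k) (hk : k ≤ 2) (ha : 0 < a) (hr : 0 < r)
    (hra : 1 + r ≤ a) :
    τ / 4 * (1 + r) ^ (-k) ≤ radialPhi' τ k a r := by
  have hz := truncRadius_pos ha hr
  have h0 : (1 + r) / 2 ≤ truncRadius a r := by
    rw [truncRadius, div_le_div_iff₀ (by positivity) (by positivity)]
    nlinarith
  have h1 : ((1 + r) / 2) ^ (2 - k) ≤ truncRadius a r ^ (2 - k) :=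
    Real.rpow_le_rpow (by positivity) h0 (by linarith)
  have e1 : (1 + r) ^ (2 - k) = (1 + r) ^ (-k) * (1 + r) ^ 2 := by
    rw [← Real.rpow_natCast, ← Real.rpow_add (by positivity)]
    congr 1
    push_cast
    ring
  have h2 : (2 : ℝ) ^ (2 - k) ≤ 4 := by
    calc (2 : ℝ) ^ (2 - k) ≤ 2 ^ (2 : ℝ) :=
          Real.rpow_le_rpow_of_exponent_le (by norm_num) (by linarith)
      _ = 4 := by norm_num
  rw [Real.div_rpow (by positivity) (by norm_num), e1] at h1
  rw [radialPhi', le_div_iff₀ (by positivity)]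
  calc τ / 4 * (1 + r) ^ (-k) * (1 + r) ^ 2 = τ * ((1 + r) ^ (-k) * (1 + r) ^ 2 / 4) := by ring
    _ ≤ τ * ((1 + r) ^ (-k) * (1 + r) ^ 2 / 2 ^ (2 - k)) := by gcongr
    _ ≤ _ := by gcongr

/-- The Carleman weight at the scale `a` with strength `τ`. -/
noncomputable def radialWeight {s : ℝ} (hε : 0 < ε) (hε1 : ε ≤ 1) (hεs : ε ≤ 2 * s - 1)
    (ha : 1 ≤ a) (hτ : 0 < τ) (hk0 : 0 < k) (hk : k < 1) :
    CarlemanWeight s (2 + τ) (ε / a ^ 2) (τ / (1 - k) * a ^ (1 - k)) where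
  mu := radialMu ε a
  mu' := radialMu' ε a
  phi := radialPhi τ k a
  phi' := radialPhi' τ k a
  phi'' := radialPhi'' τ k a
  hasDerivAt_mu r hr := hasDerivAt_radialMu (by linarith) hr
  hasDerivAt_phi r hr := hasDerivAt_radialPhi (by linarith) hk hr
  hasDerivAt_phi' r hr := hasDerivAt_radialPhi' (by linarith) hr
  mu_pos r hr := radialMu_pos hε (by linarith) hr
  mu_le r hr := (radialMu_le_one (by linarith) hr).trans (by linarith)
  mu_le_mul r hr := (radialMu_le_two_mul hε hε1 ha hr).trans (by nlinarith)
  mu'_lower r hr := radialMu'_lower hε hεs ha hr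
  mu'_mul_le r hr := radialMu'_mul_le hε (by linarith) hr
  phi_nonneg r hr := by
    have := truncRadius_pos (a := a) (by linarith) hr
    have h1 : 0 < 1 - k := by linarith
    rw [radialPhi]
    positivity
  phi_le r hr := by
    have := truncRadius_pos (a := a) (by linarith) hr
    have h1 : 0 < 1 - k := by linarith
    have h2 := truncRadius_le_left (a := a) (by linarith) hr
    rw [radialPhi]
    gcongr
  phi'_nonneg r hr := (radialPhi'_pos hτ (by linarith) hr).le
  phi'_le r hr := by
    refine (radialPhi'_le hτ (by linarith) (by linarith) hr).trans ?_
    have : (1 + r) ^ (-k) ≤ 1 := Real.rpow_le_one_of_one_le_of_nonpos (by linarith) (by linarith)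
    nlinarith

end SemiclassicalResolvent


/-! ### The weight inequality in abstract form -/

namespace SemiclassicalResolvent

/-- The weight inequality where the phase dominates the potential; `t` stands for `1 + r`. Half of
the gain `κ₀ φ'² μ'` from `hgrow` pays for the quotient term, a quarter for the potential. -/
theorem dominates_near {E μ μ' φ' φ'' t w w' b Sb h κ₀ : ℝ} (hh : 0 < h) (ht : 0 < t)
    (hμ : 0 < μ) (hμ' : 0 < μ') (hφ' : 0 < φ') (hμt : μ ≤ t * μ')
    (hφ'' : |φ''| ≤ 2 * φ' / t) (hgrow : κ₀ * φ' ^ 2 * μ' ≤ φ' ^ 2 * μ' + 2 * μ * φ' * φ'')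
    (hκ : 16 * h ≤ κ₀ * φ' * t) (hS : 4 * Sb ^ 2 * t ≤ κ₀ * h * φ' ^ 3) (hb : 0 ≤ b)
    (hw' : w' ≤ b) (hw : w + t * b ≤ 3 * E / 4 + κ₀ / 4 * φ' ^ 2) :
    E / 4 * μ' + w * μ' + μ * w' + 2 * (μ * (|φ''| + Sb / h)) ^ 2 / (μ' + 4 * φ' * μ / h) ≤
      E * μ' + φ' ^ 2 * μ' + 2 * μ * φ' * φ'' := by
  have h1 : μ * w' ≤ t * b * μ' := by
    calc μ * w' ≤ μ * b := by gcongr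
      _ ≤ (t * μ') * b := by gcongr
      _ = _ := by ring
  have h2 : (|φ''| + Sb / h) ^ 2 ≤ 2 * ((2 * φ' / t) ^ 2 + (Sb / h) ^ 2) := by
    have : |φ''| ^ 2 ≤ (2 * φ' / t) ^ 2 := by gcongr
    nlinarith [sq_nonneg (|φ''| - Sb / h)]
  have h3 : 2 * (μ * (|φ''| + Sb / h)) ^ 2 / (μ' + 4 * φ' * μ / h) ≤
      h * μ * φ' * 4 / t ^ 2 + μ * Sb ^ 2 / (h * φ') := by
    calc _ ≤ 2 * (μ ^ 2 * (2 * ((2 * φ' / t) ^ 2 + (Sb / h) ^ 2))) / (4 * φ' * μ / h) := by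
          rw [mul_pow]
          gcongr
          linarith
      _ = _ := by field_simp; ring
  have h4 : h * μ * φ' * 4 / t ^ 2 ≤ κ₀ / 4 * φ' ^ 2 * μ' := by
    calc h * μ * φ' * 4 / t ^ 2 ≤ h * (t * μ') * φ' * 4 / t ^ 2 := by gcongr
      _ = (16 * h) / t * (φ' * μ' / 4) := by field_simp; ring
      _ ≤ (κ₀ * φ' * t) / t * (φ' * μ' / 4) := by gcongr
      _ = _ := by field_simp
  have h5 : μ * Sb ^ 2 / (h * φ') ≤ κ₀ / 4 * φ' ^ 2 * μ' := by
    calc μ * Sb ^ 2 / (h * φ') ≤ (t * μ') * Sb ^ 2 / (h * φ') := by gcongr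
      _ = 4 * Sb ^ 2 * t * (μ' / (4 * (h * φ'))) := by field_simp
      _ ≤ (κ₀ * h * φ' ^ 3) * (μ' / (4 * (h * φ'))) := by gcongr
      _ = _ := by field_simp
  have h6 := mul_le_mul_of_nonneg_right hw hμ'.le
  have h7 : 0 ≤ κ₀ * φ' ^ 2 * μ' := by
    have : 0 ≤ κ₀ * φ' * t := by linarith
    have h8 : 0 ≤ κ₀ := by
      by_contra hneg
      push Not at hneg
      nlinarith [mul_pos hφ' ht]
    positivity
  linarith

/-- The weight inequality where the potential is small; `t` stands for `1 + r`. Each of the four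
terms besides `E / 4 * μ'` and `φ'² μ'` is at most `E μ' / 8` on its harmful side. -/
theorem dominates_far {E μ μ' φ' φ'' t w w' Sb h : ℝ} (hh : 0 < h) (ht : 0 < t)
    (hμ : 0 < μ) (hμ1 : μ ≤ 1) (hμ' : 0 < μ') (hE : 0 < E) (hφ' : 0 < φ')
    (hφ'' : |φ''| ≤ 2 * φ' / t) (hw : w ≤ E / 8) (hw' : w' ≤ E / 8 * μ')
    (h1 : 4 * φ' ^ 2 / t ≤ E / 8 * μ') (h2 : 16 * φ' ^ 2 / t ^ 2 ≤ E / 16 * μ' ^ 2)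
    (h3 : 4 * Sb ^ 2 / h ^ 2 ≤ E / 16 * μ' ^ 2) :
    E / 4 * μ' + w * μ' + μ * w' + 2 * (μ * (|φ''| + Sb / h)) ^ 2 / (μ' + 4 * φ' * μ / h) ≤
      E * μ' + φ' ^ 2 * μ' + 2 * μ * φ' * φ'' := by
  have e1 : w * μ' ≤ E / 8 * μ' := by gcongr
  have e2 : μ * w' ≤ E / 8 * μ' := by
    calc μ * w' ≤ μ * (E / 8 * μ') := by gcongr
      _ ≤ 1 * (E / 8 * μ') := by gcongr
      _ = _ := one_mul _
  have e3 : -(E / 8 * μ') ≤ 2 * μ * φ' * φ'' := by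
    have : 2 * μ * φ' * |φ''| ≤ E / 8 * μ' := by
      calc 2 * μ * φ' * |φ''| ≤ 2 * 1 * φ' * (2 * φ' / t) := by gcongr
        _ = 4 * φ' ^ 2 / t := by ring
        _ ≤ _ := h1
    have h4 := neg_abs_le φ''
    have h5 : 0 ≤ 2 * μ * φ' := by positivity
    nlinarith
  have e4 : 2 * (μ * (|φ''| + Sb / h)) ^ 2 / (μ' + 4 * φ' * μ / h) ≤ E / 8 * μ' := by
    have h6 : (|φ''| + Sb / h) ^ 2 ≤ 2 * ((2 * φ' / t) ^ 2 + (Sb / h) ^ 2) := by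
      have : |φ''| ^ 2 ≤ (2 * φ' / t) ^ 2 := by gcongr
      nlinarith [sq_nonneg (|φ''| - Sb / h)]
    calc _ ≤ 2 * (1 ^ 2 * (2 * ((2 * φ' / t) ^ 2 + (Sb / h) ^ 2))) / μ' := by
          rw [mul_pow]
          gcongr
          have : 0 ≤ 4 * φ' * μ / h := by positivity
          linarith
      _ = (16 * φ' ^ 2 / t ^ 2 + 4 * Sb ^ 2 / h ^ 2) / μ' := by field_simp; ring
      _ ≤ (E / 16 * μ' ^ 2 + E / 16 * μ' ^ 2) / μ' := by gcongr
      _ = _ := by field_simp; ring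
  have e5 : 0 ≤ φ' ^ 2 * μ' := by positivity
  have e6 : 0 < E * μ' := by positivity
  linarith

variable {ε a τ k r : ℝ}

theorem abs_radialPhi''_le (hτ : 0 < τ) (hk0 : 0 ≤ k) (hk : k < 1) (ha : 0 < a) (hr : 0 < r) :
    |radialPhi'' τ k a r| ≤ 2 * radialPhi' τ k a r / (1 + r) := by
  have hp := radialPhi'_pos (k := k) hτ ha hr
  have h1 : a / (a + (1 + r)) ≤ 1 := by rw [div_le_one (by positivity)]; linarith
  have h2 : 0 ≤ a / (a + (1 + r)) := by positivity
  have h3 : |(2 - k) * (a / (a + (1 + r))) - 2| ≤ 2 := by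
    rw [abs_le]
    have h4 : 0 ≤ (2 - k) * (a / (a + (1 + r))) := mul_nonneg (by linarith) h2
    constructor <;> nlinarith
  rw [radialPhi'', abs_mul, abs_of_pos hp, abs_div, abs_of_pos (by linarith : 0 < 1 + r),
    mul_comm 2, mul_div_assoc]
  gcongr

/-- For `r ≪ a` the phase is close to the pure power, for which the factor would be `k`; the
weaker factor `(1 + k) / 2` is still less than `1`. -/
theorem le_radialPhi'' (hτ : 0 < τ) (ha : 0 < a) (hr : 0 < r)
    (hra : (3 - k) * (1 + r) ≤ (1 - k) * a) :
    -((1 + k) / 2 * radialPhi' τ k a r / (1 + r)) ≤ radialPhi'' τ k a r := by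
  have hp := radialPhi'_pos (k := k) hτ ha hr
  have h1 : (3 - k) / 2 ≤ (2 - k) * (a / (a + (1 + r))) := by
    rw [← mul_div_assoc, div_le_div_iff₀ (by norm_num) (by positivity)]
    nlinarith
  have h2 : -((1 + k) / 2) / (1 + r) ≤ ((2 - k) * (a / (a + (1 + r))) - 2) / (1 + r) := by
    gcongr
    linarith
  calc _ = radialPhi' τ k a r * (-((1 + k) / 2) / (1 + r)) := by ring
    _ ≤ _ := by rw [radialPhi'']; gcongr

theorem scaledSq_le (hk0 : 0 ≤ k) (hk : k < 1) (ha : 0 < a) (hr : 0 < r)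
    (hra : (3 - k) * (1 + r) ≤ (1 - k) * a) : scaledSq a r ≤ (1 - k) / 2 := by
  have h1 : a ^ 2 * scaledSq a r ≤ a ^ 2 * ((1 - k) / 2) := by
    rw [sq_mul_scaledSq ha]
    have h2 : 2 * (1 + r) ≤ (1 - k) * a := by nlinarith
    have h3 : (2 * (1 + r)) ^ 2 ≤ ((1 - k) * a) ^ 2 := by gcongr
    have h4 : (1 - k) ^ 2 ≤ 1 - k := by nlinarith
    nlinarith [mul_le_mul_of_nonneg_right h4 (sq_nonneg a)]
  exact le_of_mul_le_mul_left h1 (by positivity)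

/-- For `r ≪ a` the product `phi'² mu` grows like `phi'² mu'`. -/
theorem radial_growth (hε : 0 < ε) (hε1 : ε ≤ 1) (hτ : 0 < τ) (hk0 : 0 ≤ k) (hk : k < 1)
    (ha : 0 < a) (hr : 0 < r) (hra : (3 - k) * (1 + r) ≤ (1 - k) * a) :
    (1 - k) ^ 2 / 4 * radialPhi' τ k a r ^ 2 * radialMu' ε a r ≤
      radialPhi' τ k a r ^ 2 * radialMu' ε a r +
        2 * radialMu ε a r * radialPhi' τ k a r * radialPhi'' τ k a r := by
  have hp := radialPhi'_pos (k := k) hτ ha hr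
  have hμ := radialMu_pos hε ha hr
  have h1 := le_radialPhi'' hτ ha hr hra
  have h2 := scaledSq_le hk0 hk ha hr hra
  have hy := scaledSq_pos ha hr
  have h3 := radialMu_le_mul_radialMu' hε hε1 ha hr
  have hμ' : 0 < radialMu' ε a r := by
    rw [radialMu']
    positivity
  set μ := radialMu ε a r
  set μ' := radialMu' ε a r
  set p := radialPhi' τ k a r
  have h4 : 2 * μ * p * ((1 + k) / 2 * p / (1 + r)) ≤ (1 - (1 - k) ^ 2 / 4) * p ^ 2 * μ' := by
    calc 2 * μ * p * ((1 + k) / 2 * p / (1 + r))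
        ≤ 2 * ((1 + (1 - k) / 2) * ((1 + r) / 2) * μ') * p * ((1 + k) / 2 * p / (1 + r)) := by
          gcongr
          exact h3.trans (by gcongr)
      _ = _ := by field_simp; ring
  have h5 := mul_le_mul_of_nonneg_left h1 (by positivity : 0 ≤ 2 * μ * p)
  linarith

theorem eventually_mul_rpow_le {q : ℝ} (hq : 0 < q) (A B : ℝ) (hB : 0 < B) :
    ∀ᶠ h in 𝓝[>] (0 : ℝ), A * h ^ q ≤ B := by
  have h1 : Tendsto (fun h : ℝ => A * h ^ q) (𝓝[>] 0) (𝓝 (A * 0 ^ q)) :=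
    ((Real.continuousAt_rpow_const 0 q (Or.inr hq.le)).tendsto.mono_left
      nhdsWithin_le_nhds).const_mul A
  rw [Real.zero_rpow hq.ne', mul_zero] at h1
  exact h1.eventually (Iic_mem_nhds hB)

end SemiclassicalResolvent


/-! ### The weight dominates the potential -/

namespace SemiclassicalResolvent

variable {n : ℕ}

theorem rpow_le_mul_rpow_of_nonpos {a c t q : ℝ} (ha : 0 < a) (hc : 0 < c) (h : c * a ≤ t)
    (hq : q ≤ 0) : t ^ q ≤ c ^ q * a ^ q := by
  rw [← Real.mul_rpow hc.le ha.le]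
  exact Real.rpow_le_rpow_of_nonpos (by positivity) h hq

/-- Far from the origin the multiplier beats all other terms, provided four quantities, which are
positive powers of `h`, are small. -/
theorem radial_far {E ε a τ k c A h r w w' Sb C δ β : ℝ} (hh : 0 < h) (hE : 0 < E) (hε : 0 < ε)
    (hk0 : 0 < k) (hk : k < 1) (hεk : ε ≤ k) (hεβ : ε ≤ β - 1) (hεδ : ε ≤ δ - 1) (ha : 0 < a)
    (hτ : 0 < τ) (hr : 0 < r) (hc : 0 < c) (hA : A = (c ^ 2)⁻¹ + 1) (hra : c * a ≤ 1 + r)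
    (hC : 0 ≤ C) (hw : w ≤ E / 8) (hw' : w' ≤ C * (1 + r) ^ (-β)) (hSb : Sb = C * (1 + r) ^ (-δ))
    (h1 : 8 * C ≤ E * (ε * A ^ (-(ε / 2) - 1)) * a ^ ε)
    (h2 : 32 * c ^ (ε - 2 * k) * (τ ^ 2 * a ^ (-(2 * k))) ≤ E * (ε * A ^ (-(ε / 2) - 1)))
    (h3 : 256 * c ^ (2 * ε - 2 * k) * (τ ^ 2 * a ^ (-(2 * k))) ≤
      E * (ε * A ^ (-(ε / 2) - 1)) ^ 2)
    (h4 : 64 * C ^ 2 * c ^ (2 + 2 * ε - 2 * δ) * (a ^ (2 - 2 * δ) / h ^ 2) ≤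
      E * (ε * A ^ (-(ε / 2) - 1)) ^ 2) :
    E / 4 * radialMu' ε a r + w * radialMu' ε a r + radialMu ε a r * w' +
        2 * (radialMu ε a r * (|radialPhi'' τ k a r| + Sb / h)) ^ 2 /
          (radialMu' ε a r + 4 * radialPhi' τ k a r * radialMu ε a r / h) ≤
      E * radialMu' ε a r + radialPhi' τ k a r ^ 2 * radialMu' ε a r +
        2 * radialMu ε a r * radialPhi' τ k a r * radialPhi'' τ k a r := by
  have hA0 : 0 < A := by rw [hA]; positivity
  have ht : 0 < 1 + r := by linarith
  have hlow := le_radialMu' hε ha hr hA0 (by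
    have : a ^ 2 ≤ (c ^ 2)⁻¹ * (1 + r) ^ 2 := by
      rw [inv_mul_eq_div, le_div_iff₀ (by positivity), mul_comm, ← mul_pow]
      gcongr
    rw [hA]
    linarith)
  have hφ := radialPhi'_pos (k := k) hτ ha hr
  have hφle := radialPhi'_le (k := k) hτ (by linarith) ha hr
  set B : ℝ := ε * A ^ (-(ε / 2) - 1) with hB
  have hB0 : 0 < B := by positivity
  set u : ℝ := (1 + r) ^ (-1 - ε) with hu
  have hu0 : 0 < u := by positivity
  have hae : 0 < a ^ ε := by positivity
  have hμ' : 0 < radialMu' ε a r := lt_of_lt_of_le (by positivity) hlow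
  have hφ2 : radialPhi' τ k a r ^ 2 ≤ τ ^ 2 * ((1 + r) ^ (-k)) ^ 2 := by
    rw [← mul_pow]; gcongr
  have hlow2 : B ^ 2 * (a ^ ε) ^ 2 * u ^ 2 ≤ radialMu' ε a r ^ 2 := by
    rw [← mul_pow, ← mul_pow]; gcongr
  refine dominates_far hh ht (radialMu_pos hε ha hr) (radialMu_le_one ha hr) hμ' hE hφ
    (abs_radialPhi''_le hτ hk0.le hk ha hr) hw (hw'.trans ?_) ?_ ?_ ?_
  · have e1 : (1 + r) ^ (-β) = (1 + r) ^ (1 + ε - β) * u := by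
      rw [hu, ← Real.rpow_add ht]
      ring_nf
    have e2 : (1 + r) ^ (1 + ε - β) ≤ 1 :=
      Real.rpow_le_one_of_one_le_of_nonpos (by linarith) (by linarith)
    calc C * (1 + r) ^ (-β) = C * ((1 + r) ^ (1 + ε - β) * u) := by rw [e1]
      _ ≤ C * (1 * u) := by gcongr
      _ = 8 * C * (u / 8) := by ring
      _ ≤ (E * B * a ^ ε) * (u / 8) := by gcongr
      _ = E / 8 * (B * a ^ ε * u) := by ring
      _ ≤ _ := by gcongr
  · have e1 : ((1 + r) ^ (-k)) ^ 2 / (1 + r) = (1 + r) ^ (ε - 2 * k) * u := by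
      rw [hu, ← Real.rpow_add ht, ← Real.rpow_natCast, ← Real.rpow_mul ht.le,
        ← Real.rpow_sub_one ht.ne']
      congr 1
      push_cast
      ring
    have e2 := rpow_le_mul_rpow_of_nonpos ha hc hra (q := ε - 2 * k) (by linarith)
    have e3 : a ^ (ε - 2 * k) = a ^ (-(2 * k)) * a ^ ε := by
      rw [← Real.rpow_add ha]; ring_nf
    calc 4 * radialPhi' τ k a r ^ 2 / (1 + r) ≤ 4 * (τ ^ 2 * ((1 + r) ^ (-k)) ^ 2) / (1 + r) := by
          gcongr
      _ = 4 * τ ^ 2 * ((1 + r) ^ (ε - 2 * k) * u) := by rw [← e1]; ring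
      _ ≤ 4 * τ ^ 2 * (c ^ (ε - 2 * k) * a ^ (ε - 2 * k) * u) := by gcongr
      _ = (32 * c ^ (ε - 2 * k) * (τ ^ 2 * a ^ (-(2 * k)))) * (a ^ ε * u / 8) := by rw [e3]; ring
      _ ≤ (E * B) * (a ^ ε * u / 8) := by gcongr
      _ = E / 8 * (B * a ^ ε * u) := by ring
      _ ≤ _ := by gcongr
  · have e1 : ((1 + r) ^ (-k)) ^ 2 / (1 + r) ^ 2 = (1 + r) ^ (2 * ε - 2 * k) * u ^ 2 := by
      rw [hu, ← Real.rpow_natCast, ← Real.rpow_natCast, ← Real.rpow_natCast, ← Real.rpow_mul ht.le,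
        ← Real.rpow_mul ht.le, ← Real.rpow_add ht, ← Real.rpow_sub ht]
      congr 1
      push_cast
      ring
    have e2 := rpow_le_mul_rpow_of_nonpos ha hc hra (q := 2 * ε - 2 * k) (by linarith)
    have e3 : a ^ (2 * ε - 2 * k) = a ^ (-(2 * k)) * (a ^ ε) ^ 2 := by
      rw [← Real.rpow_natCast, ← Real.rpow_mul ha.le, ← Real.rpow_add ha]
      congr 1
      push_cast
      ring
    calc 16 * radialPhi' τ k a r ^ 2 / (1 + r) ^ 2
        ≤ 16 * (τ ^ 2 * ((1 + r) ^ (-k)) ^ 2) / (1 + r) ^ 2 := by gcongr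
      _ = 16 * τ ^ 2 * ((1 + r) ^ (2 * ε - 2 * k) * u ^ 2) := by rw [← e1]; ring
      _ ≤ 16 * τ ^ 2 * (c ^ (2 * ε - 2 * k) * a ^ (2 * ε - 2 * k) * u ^ 2) := by gcongr
      _ = (256 * c ^ (2 * ε - 2 * k) * (τ ^ 2 * a ^ (-(2 * k)))) * ((a ^ ε) ^ 2 * u ^ 2 / 16) := by
          rw [e3]; ring
      _ ≤ (E * B ^ 2) * ((a ^ ε) ^ 2 * u ^ 2 / 16) := by gcongr
      _ = E / 16 * (B ^ 2 * (a ^ ε) ^ 2 * u ^ 2) := by ring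
      _ ≤ _ := by gcongr
  · have e1 : ((1 + r) ^ (-δ)) ^ 2 = (1 + r) ^ (2 + 2 * ε - 2 * δ) * u ^ 2 := by
      rw [hu, ← Real.rpow_natCast, ← Real.rpow_natCast, ← Real.rpow_mul ht.le,
        ← Real.rpow_mul ht.le, ← Real.rpow_add ht]
      congr 1
      push_cast
      ring
    have e2 := rpow_le_mul_rpow_of_nonpos ha hc hra (q := 2 + 2 * ε - 2 * δ) (by linarith)
    have e3 : a ^ (2 + 2 * ε - 2 * δ) = a ^ (2 - 2 * δ) * (a ^ ε) ^ 2 := by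
      rw [← Real.rpow_natCast, ← Real.rpow_mul ha.le, ← Real.rpow_add ha]
      congr 1
      push_cast
      ring
    calc 4 * Sb ^ 2 / h ^ 2 = 4 * C ^ 2 * ((1 + r) ^ (2 + 2 * ε - 2 * δ) * u ^ 2) / h ^ 2 := by
          rw [hSb, mul_pow, e1]; ring
      _ ≤ 4 * C ^ 2 * (c ^ (2 + 2 * ε - 2 * δ) * a ^ (2 + 2 * ε - 2 * δ) * u ^ 2) / h ^ 2 := by
          gcongr
      _ = (64 * C ^ 2 * c ^ (2 + 2 * ε - 2 * δ) * (a ^ (2 - 2 * δ) / h ^ 2)) *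
          ((a ^ ε) ^ 2 * u ^ 2 / 16) := by rw [e3]; ring
      _ ≤ (E * B ^ 2) * ((a ^ ε) ^ 2 * u ^ 2 / 16) := by gcongr
      _ = E / 16 * (B ^ 2 * (a ^ ε) ^ 2 * u ^ 2) := by ring
      _ ≤ _ := by gcongr

/-- For `r ≪ a` the phase beats all other terms, provided `τ` is large. -/
theorem radial_near {E ε a τ k h r w w' Sb C P R δ β : ℝ} (hh : 0 < h) (hh1 : h ≤ 1)
    (hε : 0 < ε) (hε1 : ε ≤ 1)
    (hE : 0 < E) (hk0 : 0 < k) (hk : k < 1) (hβ : 1 < β) (hkδ : 3 * k ≤ 2 * δ - 1) (ha : 0 < a)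
    (hτ : 0 < τ) (hr : 0 < r) (hra : (3 - k) * (1 + r) ≤ (1 - k) * a) (hC : 0 ≤ C)
    (hR : 0 ≤ R) (hwP : w ≤ P) (hwE : R ≤ r → w ≤ E / 8 ∧ C * (1 + r) ^ (1 - β) ≤ E / 8)
    (hw' : w' ≤ C * (1 + r) ^ (-β)) (hSb : Sb = C * (1 + r) ^ (-δ))
    (h1 : 64 ≤ (1 - k) ^ 2 / 4 * τ) (h2 : 256 * C ^ 2 ≤ (1 - k) ^ 2 / 4 * (h * τ ^ 3))
    (h3 : 64 * (1 + R) ^ 2 * (P + C) ≤ (1 - k) ^ 2 / 4 * τ ^ 2) :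
    E / 4 * radialMu' ε a r + w * radialMu' ε a r + radialMu ε a r * w' +
        2 * (radialMu ε a r * (|radialPhi'' τ k a r| + Sb / h)) ^ 2 /
          (radialMu' ε a r + 4 * radialPhi' τ k a r * radialMu ε a r / h) ≤
      E * radialMu' ε a r + radialPhi' τ k a r ^ 2 * radialMu' ε a r +
        2 * radialMu ε a r * radialPhi' τ k a r * radialPhi'' τ k a r := by
  have ht : 0 < 1 + r := by linarith
  have hy := scaledSq_pos ha hr
  have hφ := radialPhi'_pos (k := k) hτ ha hr
  have hφlow := le_radialPhi' hτ hk0.le (by linarith) ha hr (by nlinarith)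
  have hμ' : 0 < radialMu' ε a r := by
    rw [radialMu']
    positivity
  have hgrow := radial_growth hε hε1 hτ hk0.le hk ha hr hra
  have hμt : radialMu ε a r ≤ (1 + r) * radialMu' ε a r := by
    refine (radialMu_le_mul_radialMu' hε hε1 ha hr).trans ?_
    have := scaledSq_le hk0.le hk ha hr hra
    gcongr
    nlinarith
  set κ₀ : ℝ := (1 - k) ^ 2 / 4 with hκ₀
  have hκ0 : 0 < κ₀ := by
    have : 0 < 1 - k := by linarith
    positivity
  set p := radialPhi' τ k a r
  refine dominates_near hh ht (radialMu_pos hε ha hr) hμ' hφ hμt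
    (abs_radialPhi''_le hτ hk0.le hk ha hr) hgrow ?_ ?_ (b := C * (1 + r) ^ (-β)) (by positivity)
    hw' ?_
  · have e1 : 1 ≤ (1 + r) ^ (-k) * (1 + r) := by
      rw [← Real.rpow_add_one ht.ne']
      exact Real.one_le_rpow (by linarith) (by linarith)
    calc 16 * h ≤ 16 * 1 := by gcongr
      _ ≤ κ₀ * τ / 4 * 1 := by linarith
      _ ≤ κ₀ * τ / 4 * ((1 + r) ^ (-k) * (1 + r)) := by gcongr
      _ = κ₀ * (τ / 4 * (1 + r) ^ (-k)) * (1 + r) := by ring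
      _ ≤ κ₀ * p * (1 + r) := by gcongr
  · have e1 : ((1 + r) ^ (-δ)) ^ 2 * (1 + r) ≤ ((1 + r) ^ (-k)) ^ 3 := by
      rw [← Real.rpow_natCast, ← Real.rpow_natCast, ← Real.rpow_mul ht.le, ← Real.rpow_mul ht.le,
        ← Real.rpow_add_one ht.ne']
      refine Real.rpow_le_rpow_of_exponent_le (by linarith) ?_
      push_cast
      linarith
    calc 4 * Sb ^ 2 * (1 + r) = 4 * C ^ 2 * (((1 + r) ^ (-δ)) ^ 2 * (1 + r)) := by rw [hSb]; ring
      _ ≤ 4 * C ^ 2 * ((1 + r) ^ (-k)) ^ 3 := by gcongr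
      _ = 256 * C ^ 2 * (((1 + r) ^ (-k)) ^ 3 / 64) := by ring
      _ ≤ (κ₀ * (h * τ ^ 3)) * (((1 + r) ^ (-k)) ^ 3 / 64) := by gcongr
      _ = κ₀ * h * (τ / 4 * (1 + r) ^ (-k)) ^ 3 := by ring
      _ ≤ κ₀ * h * p ^ 3 := by gcongr
  · have e1 : (1 + r) * (C * (1 + r) ^ (-β)) = C * (1 + r) ^ (1 - β) := by
      rw [sub_eq_neg_add, Real.rpow_add_one ht.ne']
      ring
    rw [e1]
    rcases le_or_gt R r with hRr | hRr
    · obtain ⟨h4, h5⟩ := hwE hRr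
      have : 0 ≤ κ₀ / 4 * p ^ 2 := by positivity
      linarith
    · have e2 : C * (1 + r) ^ (1 - β) ≤ C * 1 := by
        gcongr
        exact Real.rpow_le_one_of_one_le_of_nonpos (by linarith) (by linarith)
      have e3 : (1 + R)⁻¹ ≤ (1 + r) ^ (-k) := by
        calc (1 + R)⁻¹ ≤ (1 + r)⁻¹ := by gcongr
          _ = (1 + r) ^ (-1 : ℝ) := (Real.rpow_neg_one _).symm
          _ ≤ _ := Real.rpow_le_rpow_of_exponent_le (by linarith) (by linarith)
      have e4 : P + C ≤ κ₀ / 4 * p ^ 2 := by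
        calc P + C = 64 * (1 + R) ^ 2 * (P + C) / (64 * (1 + R) ^ 2) := by field_simp
          _ ≤ κ₀ * τ ^ 2 / (64 * (1 + R) ^ 2) := by gcongr
          _ = κ₀ / 4 * (τ / 4 * (1 + R)⁻¹) ^ 2 := by field_simp; norm_num
          _ ≤ κ₀ / 4 * (τ / 4 * (1 + r) ^ (-k)) ^ 2 := by gcongr
          _ ≤ _ := by gcongr
      linarith

/-- The parameters can be chosen such that the weight dominates the potential for all small `h`. -/
theorem exists_dominating_weight {W dW : Rn n → ℝ} {E s k m δ β C P R r₀ : ℝ} (hE : 0 < E)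
    (hs : 1 / 2 < s) (hk0 : 0 < k) (hk : k < 1) (hm : 0 < m) (hkδ : 3 * k ≤ 2 * δ - 1)
    (hmδ : 1 < m * (δ - 1)) (hmk : 1 / 3 < m * k) (hβ : 1 < β) (hC : 0 ≤ C) (hP : 0 ≤ P)
    (hWP : ∀ x, W x ≤ P) (hWR : ∀ x, R ≤ ‖x‖ → W x ≤ E / 8)
    (hdW : ∀ x, x ≠ 0 → dW x ≤ C * (1 + ‖x‖) ^ (-β)) :
    ∃ ε τ₀ h₀, 0 < ε ∧ 0 < τ₀ ∧ 0 < h₀ ∧ h₀ ≤ 1 ∧ ∀ h, 0 < h → h ≤ h₀ →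
      ∃ w : CarlemanWeight s (2 + τ₀ * h ^ (-(1 / 3) : ℝ)) (ε / (h ^ (-m)) ^ 2)
        (τ₀ * h ^ (-(1 / 3) : ℝ) / (1 - k) * (h ^ (-m)) ^ (1 - k)),
      w.Dominates h E r₀ (fun r => C * (1 + r) ^ (-δ)) W dW := by
  have hδ : 1 < δ := by
    by_contra hneg
    push Not at hneg
    nlinarith
  -- `ε ≤ 2s - 1` is needed for the weight, the other bounds for the decay of `dW`, `S` and `phi'`
  -- relative to `mu' ≳ r^(-1-ε)`
  set ε : ℝ := min 1 (min (2 * s - 1) (min (β - 1) (min (δ - 1) k))) with hεdef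
  have hε : 0 < ε := by
    simp only [hεdef, lt_min_iff]
    exact ⟨one_pos, by linarith, by linarith, by linarith, hk0⟩
  have hε1 : ε ≤ 1 := min_le_left _ _
  have hεs : ε ≤ 2 * s - 1 := (min_le_right _ _).trans (min_le_left _ _)
  have hε' : ε ≤ min (β - 1) (min (δ - 1) k) := (min_le_right _ _).trans (min_le_right _ _)
  have hεβ : ε ≤ β - 1 := hε'.trans (min_le_left _ _)
  have hεδ : ε ≤ δ - 1 := hε'.trans ((min_le_right _ _).trans (min_le_left _ _))
  have hεk : ε ≤ k := hε'.trans ((min_le_right _ _).trans (min_le_right _ _))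
  obtain ⟨R₁, hR₁0, hR₁R, hR₁⟩ : ∃ R₁, 0 ≤ R₁ ∧ R ≤ R₁ ∧
      ∀ r, R₁ ≤ r → C * (1 + r) ^ (1 - β) ≤ E / 8 := by
    have h1 : Tendsto (fun r : ℝ => C * (1 + r) ^ (-(β - 1))) atTop (𝓝 (C * 0)) :=
      ((tendsto_rpow_neg_atTop (by linarith : 0 < β - 1)).comp
        (tendsto_atTop_add_const_left atTop 1 tendsto_id)).const_mul C
    rw [mul_zero] at h1
    obtain ⟨R₂, hR₂⟩ := eventually_atTop.1
      (h1.eventually (Iic_mem_nhds (by positivity : 0 < E / 8)))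
    refine ⟨max 0 (max R R₂), le_max_left _ _, (le_max_left _ _).trans (le_max_right _ _),
      fun r hr => ?_⟩
    have := hR₂ r (((le_max_right _ _).trans (le_max_right _ _)).trans hr)
    rwa [neg_sub] at this
  have hk1 : 0 < 1 - k := by linarith
  set κ₀ : ℝ := (1 - k) ^ 2 / 4 with hκ₀
  have hκ0 : 0 < κ₀ := by positivity
  have hκ1 : κ₀ ≤ 1 := by rw [hκ₀]; nlinarith
  -- `τ₀` is the sum of what the three largeness conditions of `radial_near` require
  set τ₀ : ℝ := (64 + 256 * C ^ 2 + 64 * (1 + R₁) ^ 2 * (P + C)) / κ₀ with hτ₀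
  have hτκ : κ₀ * τ₀ = 64 + 256 * C ^ 2 + 64 * (1 + R₁) ^ 2 * (P + C) := by
    rw [hτ₀]; field_simp
  have hτ0 : 0 < τ₀ := by positivity
  have hc1 : 0 ≤ 256 * C ^ 2 := by positivity
  have hc2 : 0 ≤ 64 * (1 + R₁) ^ 2 * (P + C) := by positivity
  have hτ1 : 1 ≤ τ₀ := by nlinarith
  -- `1 + r = c a` separates the regions of `radial_near` and `radial_far`
  set c : ℝ := (1 - k) / (3 - k) with hcdef
  have h3k : 0 < 3 - k := by linarith
  have hc : 0 < c := by positivity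
  set A : ℝ := (c ^ 2)⁻¹ + 1 with hA
  have hA0 : 0 < A := by positivity
  set B : ℝ := ε * A ^ (-(ε / 2) - 1) with hB
  have hB0 : 0 < B := by positivity
  -- the four smallness conditions of `radial_far`, and the potential is small for `1 + r ≥ c a`
  have hev : ∀ᶠ h in 𝓝[>] (0 : ℝ), h ≤ 1 ∧ 8 * C * h ^ (m * ε) ≤ E * B ∧
      32 * c ^ (ε - 2 * k) * τ₀ ^ 2 * h ^ (2 * (m * k) - 2 / 3) ≤ E * B ∧
      256 * c ^ (2 * ε - 2 * k) * τ₀ ^ 2 * h ^ (2 * (m * k) - 2 / 3) ≤ E * B ^ 2 ∧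
      64 * C ^ 2 * c ^ (2 + 2 * ε - 2 * δ) * h ^ (2 * (m * (δ - 1)) - 2) ≤ E * B ^ 2 ∧
      (1 + R₁) * h ^ m ≤ c := by
    have h0 : ∀ᶠ h in 𝓝[>] (0 : ℝ), h ≤ 1 := by
      filter_upwards [eventually_mul_rpow_le one_pos 1 1 one_pos] with h hh
      simpa using hh
    filter_upwards [h0, eventually_mul_rpow_le (mul_pos hm hε) (8 * C) (E * B) (by positivity),
      eventually_mul_rpow_le (by linarith : 0 < 2 * (m * k) - 2 / 3)
        (32 * c ^ (ε - 2 * k) * τ₀ ^ 2) (E * B) (by positivity),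
      eventually_mul_rpow_le (by linarith : 0 < 2 * (m * k) - 2 / 3)
        (256 * c ^ (2 * ε - 2 * k) * τ₀ ^ 2) (E * B ^ 2) (by positivity),
      eventually_mul_rpow_le (by linarith : 0 < 2 * (m * (δ - 1)) - 2)
        (64 * C ^ 2 * c ^ (2 + 2 * ε - 2 * δ)) (E * B ^ 2) (by positivity),
      eventually_mul_rpow_le hm (1 + R₁) c hc] with h g0 g1 g2 g3 g4 g5
    exact ⟨g0, g1, g2, g3, g4, g5⟩
  obtain ⟨h₁, hh₁, hsub⟩ := mem_nhdsGT_iff_exists_Ioc_subset.1 hev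
  refine ⟨ε, τ₀, h₁, hε, hτ0, hh₁, (hsub ⟨hh₁, le_rfl⟩).1, fun h hh hhle => ?_⟩
  obtain ⟨g0, g1, g2, g3, g4, g5⟩ := hsub ⟨hh, hhle⟩
  set a : ℝ := h ^ (-m) with ha
  set τ : ℝ := τ₀ * h ^ (-(1 / 3) : ℝ) with hτ
  have ha1 : 1 ≤ a := Real.one_le_rpow_of_pos_of_le_one_of_nonpos hh g0 (by linarith)
  have ha0 : 0 < a := by linarith
  have hh3 : 1 ≤ h ^ (-(1 / 3) : ℝ) :=
    Real.one_le_rpow_of_pos_of_le_one_of_nonpos hh g0 (by norm_num)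
  have hτpos : 0 < τ := by positivity
  have hττ₀ : τ₀ ≤ τ := le_mul_of_one_le_right hτ0.le hh3
  have hcube : h * τ ^ 3 = τ₀ ^ 3 := by
    rw [hτ, mul_pow, ← Real.rpow_natCast (h ^ _), ← Real.rpow_mul hh.le]
    norm_num
    rw [Real.rpow_neg_one]
    field_simp
  have hsq : τ ^ 2 * a ^ (-(2 * k)) = τ₀ ^ 2 * h ^ (2 * (m * k) - 2 / 3) := by
    rw [hτ, ha, mul_pow, ← Real.rpow_natCast (h ^ _), ← Real.rpow_mul hh.le, ← Real.rpow_mul hh.le,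
      mul_assoc, ← Real.rpow_add hh]
    congr 2
    push_cast
    ring
  refine ⟨radialWeight hε hε1 hεs ha1 hτpos hk0 hk, ?_⟩
  intro x r hx hr hne
  have hx0 : x ≠ 0 := norm_pos_iff.1 (by rw [hx]; exact hr)
  have hdx := hdW x hx0
  rw [hx] at hdx
  have hWfar : R₁ ≤ r → W x ≤ E / 8 := fun h => hWR x (hx ▸ hR₁R.trans h)
  change E / 4 * radialMu' ε a r + W x * radialMu' ε a r + radialMu ε a r * dW x +
        2 * (radialMu ε a r * (|radialPhi'' τ k a r| + C * (1 + r) ^ (-δ) / h)) ^ 2 /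
          (radialMu' ε a r + 4 * radialPhi' τ k a r * radialMu ε a r / h) ≤
      E * radialMu' ε a r + radialPhi' τ k a r ^ 2 * radialMu' ε a r +
        2 * radialMu ε a r * radialPhi' τ k a r * radialPhi'' τ k a r
  rcases le_or_gt ((3 - k) * (1 + r)) ((1 - k) * a) with hra | hra
  · refine radial_near hh g0 hε hε1 hE hk0 hk hβ hkδ ha0 hτpos hr hra hC hR₁0 (hWP x)
      (fun h => ⟨hWfar h, hR₁ r h⟩) hdx rfl ?_ ?_ ?_
    · calc (64 : ℝ) ≤ κ₀ * τ₀ := by linarith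
        _ ≤ κ₀ * τ := by gcongr
    · rw [hcube]
      calc 256 * C ^ 2 ≤ κ₀ * τ₀ * 1 := by linarith
        _ ≤ κ₀ * τ₀ * τ₀ ^ 2 := by gcongr; exact one_le_pow₀ hτ1
        _ = _ := by ring
    · calc 64 * (1 + R₁) ^ 2 * (P + C) ≤ κ₀ * (τ₀ * 1) := by linarith
        _ ≤ κ₀ * (τ * τ) := by gcongr; linarith
        _ = _ := by ring
  · have hra' : c * a ≤ 1 + r := by
      rw [hcdef, div_mul_eq_mul_div, div_le_iff₀ h3k]
      linarith
    have hRr : R₁ ≤ r := by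
      have h1 : 1 + R₁ ≤ c * a := by
        rw [ha, Real.rpow_neg hh.le, ← div_eq_mul_inv, le_div_iff₀ (by positivity)]
        exact g5
      linarith
    refine radial_far hh hE hε hk0 hk hεk hεβ hεδ ha0 hτpos hr hc hA hra' hC (hWfar hRr) hdx rfl
      ?_ ?_ ?_ ?_
    · have h1 : h ^ (m * ε) * a ^ ε = 1 := by
        rw [ha, ← Real.rpow_mul hh.le, ← Real.rpow_add hh]
        ring_nf
        exact Real.rpow_zero h
      calc 8 * C = 8 * C * h ^ (m * ε) * a ^ ε := by rw [mul_assoc, h1, mul_one]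
        _ ≤ _ := by gcongr
    · rw [hsq]
      exact le_of_eq_of_le (by ring) g2
    · rw [hsq]
      exact le_of_eq_of_le (by ring) g3
    · have h1 : a ^ (2 - 2 * δ) / h ^ 2 = h ^ (2 * (m * (δ - 1)) - 2) := by
        rw [ha, ← Real.rpow_mul hh.le, ← Real.rpow_natCast h 2, ← Real.rpow_sub hh]
        congr 1
        push_cast
        ring
      rw [h1]
      exact g4

end SemiclassicalResolvent


/-! ### Splitting the potential -/

namespace SemiclassicalResolvent

variable {n : ℕ}

/-- An element of `L^∞` is almost everywhere bounded by its norm. -/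
theorem ae_abs_le_norm (V : LInfty n) : ∀ᵐ x, |V x| ≤ ‖V‖ := by
  have h : ∀ᵐ x, ‖V x‖ₑ ≤ eLpNormEssSup V volume := ae_le_eLpNormEssSup
  have hfin : eLpNormEssSup V volume ≠ ∞ := by
    rw [← eLpNorm_exponent_top]
    exact Lp.eLpNorm_ne_top V
  filter_upwards [h] with x hx
  rw [Lp.norm_def, eLpNorm_exponent_top, ← Real.norm_eq_abs, ← toReal_enorm]
  exact ENNReal.toReal_mono hfin hx

/-- A radial cut-off that vanishes at `r₀` and tends to `1` at the rate `r^(-N)`. -/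
noncomputable def radialCutoff (N r₀ r : ℝ) : ℝ := 1 - (r₀ + 1) ^ N * (r + 1) ^ (-N)

theorem radialCutoff_self {N r₀ : ℝ} (hr₀ : 0 < r₀) : radialCutoff N r₀ r₀ = 0 := by
  rw [radialCutoff, ← Real.rpow_add (by linarith), add_neg_cancel, Real.rpow_zero, sub_self]

theorem radialCutoff_nonneg {N r₀ r : ℝ} (hN : 0 ≤ N) (hr₀ : 0 < r₀) (hr : r₀ ≤ r) :
    0 ≤ radialCutoff N r₀ r := by
  have h : (r + 1) ^ (-N) ≤ (r₀ + 1) ^ (-N) :=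
    Real.rpow_le_rpow_of_nonpos (by linarith) (by linarith) (by linarith)
  have h2 := radialCutoff_self (N := N) hr₀
  rw [radialCutoff] at h2 ⊢
  have : (r₀ + 1) ^ N * (r + 1) ^ (-N) ≤ (r₀ + 1) ^ N * (r₀ + 1) ^ (-N) := by gcongr
  linarith

theorem radialCutoff_le_one {N r₀ r : ℝ} (hr₀ : 0 < r₀) (hr : r₀ ≤ r) :
    radialCutoff N r₀ r ≤ 1 := by
  have : 0 ≤ (r₀ + 1) ^ N * (r + 1) ^ (-N) := by
    have : 0 < r + 1 := by linarith
    positivity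
  rw [radialCutoff]
  linarith

theorem hasDerivAt_radialCutoff {N r₀ r : ℝ} (hr : 0 < r) :
    HasDerivAt (radialCutoff N r₀) (N * (r₀ + 1) ^ N * (r + 1) ^ (-N - 1)) r := by
  have h1 : HasDerivAt (fun r : ℝ => r + 1) 1 r := (hasDerivAt_id r).add_const 1
  have := ((h1.rpow_const (p := -N) (Or.inl (by linarith))).const_mul ((r₀ + 1) ^ N)).const_sub 1
  refine this.congr_deriv ?_
  ring

/-- The potential splits into a regular long-range part supported in `‖x‖ ≥ r₀` and a short-range
part; cutting off near `r₀` only changes the potential by a term of order `‖x‖^(-N)`. -/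
theorem exists_radialSplit {V : LInfty n} {VL VS : Rn n → ℝ} (hV : ∀ᵐ x, V x = VL x + VS x)
    {r₀ C₁ C₂ δ β : ℝ} (hr₀ : 0 < r₀) (hC₁ : 0 < C₁) (hC₂ : 0 < C₂) (hδ : 1 < δ)
    (hVS : ∀ᵐ x, |VS x| ≤ C₁ * (‖x‖ + 1) ^ (-δ))
    (hVL_C1 : ∀ ω : Rn n, ‖ω‖ = 1 → ContDiffOn ℝ 1 (fun r : ℝ => VL (r • ω)) (Set.Ici r₀))
    {p : ℝ → ℝ} (hp_anti : AntitoneOn p (Set.Ici r₀)) (hp_pos : ∀ r, r₀ ≤ r → 0 < p r)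
    (hp_lim : Tendsto p atTop (𝓝 0)) (hVL : ∀ x, r₀ ≤ ‖x‖ → VL x ≤ p ‖x‖)
    (hVL_deriv : ∀ ω : Rn n, ‖ω‖ = 1 → ∀ r, r₀ ≤ r →
      derivWithin (fun t : ℝ => VL (t • ω)) (Set.Ici r₀) r ≤ C₂ * (r + 1) ^ (-β))
    {E : ℝ} (hE : 0 < E) :
    ∃ (W dW S : Rn n → ℝ) (C K P R : ℝ),
      RadialSplit r₀ K (fun r => C * (1 + r) ^ (-δ)) W dW S ∧ (∀ᵐ x, V x = W x + S x) ∧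
      0 ≤ C ∧ 0 ≤ P ∧ (∀ x, W x ≤ P) ∧ (∀ x, R ≤ ‖x‖ → W x ≤ E / 8) ∧
      ∀ x, x ≠ 0 → dW x ≤ C * (1 + ‖x‖) ^ (-β) := by
  set N : ℝ := max δ β with hN
  have hNδ : δ ≤ N := le_max_left _ _
  have hNβ : β ≤ N := le_max_right _ _
  have hN0 : 0 < N := by linarith [hδ]
  set η := radialCutoff N r₀ with hη
  set W : Rn n → ℝ := fun x => if r₀ ≤ ‖x‖ then η ‖x‖ * VL x else 0 with hW
  set dW : Rn n → ℝ := fun x => if r₀ < ‖x‖ then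
    N * (r₀ + 1) ^ N * (‖x‖ + 1) ^ (-N - 1) * VL x + η ‖x‖ *
      derivWithin (fun t : ℝ => VL (t • (‖x‖⁻¹ • x))) (Set.Ici r₀) ‖x‖ else 0 with hdW
  -- `Cs` bounds the short-range part and `Cd` the radial derivative
  set Cs : ℝ := (r₀ + 1) ^ N * (‖V‖ + C₁) + C₁ with hCs
  set Cd : ℝ := N * (r₀ + 1) ^ N * p r₀ + C₂ with hCd
  have hp0 := hp_pos r₀ le_rfl
  have hVn := norm_nonneg V
  have hCs0 : 0 ≤ Cs := by positivity
  have hCd0 : 0 ≤ Cd := by positivity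
  set C : ℝ := max Cs Cd with hC
  have hC0 : 0 ≤ C := hCs0.trans (le_max_left _ _)
  -- modified on a null set, so that the bound of `S` holds everywhere
  set S : Rn n → ℝ := fun x => if |V x - W x| ≤ C * (1 + ‖x‖) ^ (-δ) then V x - W x else 0 with hS
  have hclose : ∀ᵐ x, |V x - W x| ≤ C * (1 + ‖x‖) ^ (-δ) := by
    filter_upwards [hV, hVS, ae_abs_le_norm V] with x h1 h2 h3
    have hx := norm_nonneg x
    have hx1 : 0 < 1 + ‖x‖ := by linarith
    refine le_trans ?_ (mul_le_mul_of_nonneg_right (le_max_left Cs Cd) (by positivity))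
    have hone : 1 ≤ (r₀ + 1) ^ N := Real.one_le_rpow (by linarith) hN0.le
    rw [add_comm ‖x‖ 1] at h2
    by_cases hrx : r₀ ≤ ‖x‖
    · have hVL' : |VL x| ≤ ‖V‖ + C₁ := by
        have h4 : |VS x| ≤ C₁ := h2.trans (mul_le_of_le_one_right hC₁.le
          (Real.rpow_le_one_of_one_le_of_nonpos (by linarith) (by linarith)))
        have h5 : VL x = V x - VS x := by linarith
        rw [h5]
        exact (abs_sub _ _).trans (add_le_add h3 h4)
      have e1 : V x - W x = (r₀ + 1) ^ N * (1 + ‖x‖) ^ (-N) * VL x + VS x := by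
        simp only [hW, if_pos hrx, h1, hη, radialCutoff, add_comm ‖x‖ 1]
        ring
      have e2 : (1 + ‖x‖) ^ (-N) ≤ (1 + ‖x‖) ^ (-δ) :=
        Real.rpow_le_rpow_of_exponent_le (by linarith) (by linarith)
      rw [e1]
      calc _ ≤ |(r₀ + 1) ^ N * (1 + ‖x‖) ^ (-N) * VL x| + |VS x| := abs_add_le _ _
        _ = (r₀ + 1) ^ N * (1 + ‖x‖) ^ (-N) * |VL x| + |VS x| := by
          rw [abs_mul, abs_of_nonneg (by positivity : 0 ≤ (r₀ + 1) ^ N * (1 + ‖x‖) ^ (-N))]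
        _ ≤ (r₀ + 1) ^ N * (1 + ‖x‖) ^ (-δ) * (‖V‖ + C₁) + C₁ * (1 + ‖x‖) ^ (-δ) := by gcongr
        _ = _ := by rw [hCs]; ring
    · push Not at hrx
      have e1 : W x = 0 := by simp only [hW, if_neg (not_le.2 hrx)]
      have e2 : 1 ≤ (r₀ + 1) ^ N * (1 + ‖x‖) ^ (-δ) := by
        have h4 : (r₀ + 1) ^ (-δ) ≤ (1 + ‖x‖) ^ (-δ) :=
          Real.rpow_le_rpow_of_nonpos hx1 (by linarith) (by linarith)
        have h5 : (r₀ + 1) ^ δ ≤ (r₀ + 1) ^ N :=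
          Real.rpow_le_rpow_of_exponent_le (by linarith) hNδ
        calc (1 : ℝ) = (r₀ + 1) ^ δ * (r₀ + 1) ^ (-δ) := by
              rw [← Real.rpow_add (by linarith), add_neg_cancel, Real.rpow_zero]
          _ ≤ _ := by gcongr
      rw [e1, sub_zero]
      calc |V x| ≤ ‖V‖ * 1 := by rw [mul_one]; exact h3
        _ ≤ ‖V‖ * ((r₀ + 1) ^ N * (1 + ‖x‖) ^ (-δ)) := by gcongr
        _ ≤ ‖V‖ * ((r₀ + 1) ^ N * (1 + ‖x‖) ^ (-δ)) +
            ((r₀ + 1) ^ N * C₁ + C₁) * (1 + ‖x‖) ^ (-δ) := le_add_of_nonneg_right (by positivity)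
        _ = _ := by rw [hCs]; ring
  have hWp : ∀ x, r₀ ≤ ‖x‖ → W x ≤ p ‖x‖ := by
    intro x hx
    simp only [hW, if_pos hx]
    have h0 := radialCutoff_nonneg hN0.le hr₀ hx
    have h1 := radialCutoff_le_one (N := N) hr₀ hx
    calc η ‖x‖ * VL x ≤ η ‖x‖ * p ‖x‖ := by gcongr; exact hVL x hx
      _ ≤ p ‖x‖ := mul_le_of_le_one_left (hp_pos _ hx).le h1
  have hray : ∀ ω : Rn n, ‖ω‖ = 1 → ∀ r : ℝ, 0 < r → ‖r • ω‖ = r := fun ω hω r hr => by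
    rw [norm_smul, hω, mul_one, Real.norm_of_nonneg hr.le]
  obtain ⟨R, hR⟩ := eventually_atTop.1
    (hp_lim.eventually (Iic_mem_nhds (by positivity : 0 < E / 8)))
  refine ⟨W, dW, S, C, ‖V‖ + C, p r₀, max R r₀, ⟨hr₀, ?_, ?_, ?_, ?_⟩, ?_, hC0, hp0.le,
    ?_, ?_, ?_⟩
  · intro ω hω
    have h1 : ContinuousOn (fun r : ℝ => η r * VL (r • ω)) (Set.Ici r₀) :=
      ContinuousOn.mul (fun r (hr : r₀ ≤ r) =>
        (hasDerivAt_radialCutoff (hr₀.trans_le hr)).continuousAt.continuousWithinAt)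
        (hVL_C1 ω hω).continuousOn
    -- `η` vanishes at `r₀`, so that `W` is the constant extension of `η * VL` to `r ≤ r₀`
    have h2 : Continuous fun r : ℝ => η (max r r₀) * VL (max r r₀ • ω) :=
      h1.comp_continuous (continuous_id.max continuous_const) fun r =>
      Set.mem_Ici.2 (le_max_right r r₀)
    refine h2.continuousOn.congr fun r (hr : 0 < r) => ?_
    simp only [hW, hray ω hω r hr]
    split_ifs with h
    · rw [max_eq_left h]
    · rw [max_eq_right (not_le.1 h).le, hη, radialCutoff_self hr₀, zero_mul]
  · intro ω hω r hr hne
    rcases lt_or_gt_of_ne hne with hlt | hgt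
    · have hz : dW (r • ω) = 0 := by
        simp only [hdW, hray ω hω r hr, if_neg (not_lt.2 hlt.le)]
      rw [hz]
      refine (hasDerivAt_const r (0 : ℝ)).congr_of_eventuallyEq ?_
      filter_upwards [lt_mem_nhds hr, gt_mem_nhds hlt] with t ht htr
      simp only [hW, hray ω hω t ht, if_neg (not_le.2 htr)]
    · have hd : HasDerivAt (fun t : ℝ => VL (t • ω))
          (derivWithin (fun t : ℝ => VL (t • ω)) (Set.Ici r₀) r) r :=
        (((hVL_C1 ω hω).differentiableOn (by norm_num) r hgt.le).hasDerivWithinAt).hasDerivAt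
          (Ici_mem_nhds hgt)
      have := (hasDerivAt_radialCutoff (N := N) (r₀ := r₀) hr).mul hd
      refine (this.congr_of_eventuallyEq ?_).congr_deriv ?_
      · filter_upwards [lt_mem_nhds hr, lt_mem_nhds hgt] with t ht htr
        simp only [hW, hη, hray ω hω t ht, if_pos htr.le, Pi.mul_apply]
      · have e1 : r⁻¹ • (r • ω) = ω := inv_smul_smul₀ hr.ne' ω
        simp only [hdW, hray ω hω r hr, if_pos hgt, e1]
        rfl
  · intro x
    simp only [hS]
    split_ifs with h
    · exact h
    · rw [abs_zero]
      positivity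
  · filter_upwards [hclose, ae_abs_le_norm V] with x h1 h2
    have h3 : C * (1 + ‖x‖) ^ (-δ) ≤ C := mul_le_of_le_one_right hC0
      (Real.rpow_le_one_of_one_le_of_nonpos (by linarith [norm_nonneg x]) (by linarith))
    have h4 : W x = V x - (V x - W x) := by ring
    rw [h4]
    exact (abs_sub _ _).trans (add_le_add h2 (h1.trans h3))
  · filter_upwards [hclose] with x h1
    simp only [hS, if_pos h1]
    ring
  · intro x
    by_cases h : r₀ ≤ ‖x‖
    · exact (hWp x h).trans (hp_anti Set.self_mem_Ici h h)
    · simp only [hW, if_neg h]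
      exact hp0.le
  · intro x hx
    exact (hWp x ((le_max_right _ _).trans hx)).trans (hR _ ((le_max_left _ _).trans hx))
  · intro x hx
    have hx0 : 0 < ‖x‖ := norm_pos_iff.2 hx
    simp only [hdW]
    split_ifs with h
    · refine le_trans ?_ (mul_le_mul_of_nonneg_right (le_max_right Cs Cd) (by positivity))
      have h0 := radialCutoff_nonneg hN0.le hr₀ h.le
      have h1 := radialCutoff_le_one (N := N) hr₀ h.le
      have hu : ‖‖x‖⁻¹ • x‖ = 1 := by
        rw [norm_smul, norm_inv, norm_norm, inv_mul_cancel₀ hx0.ne']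
      have h2 := hVL_deriv _ hu ‖x‖ h.le
      have h3 : VL x ≤ p r₀ := (hVL x h.le).trans (hp_anti Set.self_mem_Ici h.le h.le)
      have h4 : (‖x‖ + 1) ^ (-N - 1) ≤ (‖x‖ + 1) ^ (-β) :=
        Real.rpow_le_rpow_of_exponent_le (by linarith) (by linarith)
      rw [add_comm 1 ‖x‖]
      calc _ ≤ N * (r₀ + 1) ^ N * (‖x‖ + 1) ^ (-N - 1) * p r₀ + η ‖x‖ *
            (C₂ * (‖x‖ + 1) ^ (-β)) := by gcongr
        _ ≤ N * (r₀ + 1) ^ N * (‖x‖ + 1) ^ (-β) * p r₀ + 1 * (C₂ * (‖x‖ + 1) ^ (-β)) := by gcongr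
        _ = _ := by rw [hCd]; ring
    · positivity

end SemiclassicalResolvent


/-! ### The logarithmic bound -/

namespace SemiclassicalResolvent

variable {n : ℕ}

/-- Powers of `1/h` in the constants of the resolvent estimate only contribute a logarithm. -/
theorem log_le_mul_rpow_of_le_exp {h κ m Φ B x : ℝ} (hh : 0 < h) (hh1 : h ≤ 1) (hm : 0 ≤ m)
    (hκ : 1 ≤ κ) (hB : 1 ≤ B) (hΦ : 0 ≤ Φ) (hx : 0 ≤ x)
    (hxB : x ≤ Real.exp (Φ * h ^ (-κ)) * (((h ^ (-m)) ^ 2) ^ 2 * h⁻¹ ^ 4 * B)) :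
    Real.log x ≤ (Φ + B + 4 * m + 4) * h ^ (-κ) := by
  have hpow : 0 < h ^ (-κ) := by positivity
  -- for `x = 0` the left-hand side is `log 0 = 0`
  rcases hx.eq_or_lt with h0 | hpos
  · rw [← h0, Real.log_zero]
    positivity
  have ham : 0 < h ^ (-m) := by positivity
  have hone : 1 ≤ h ^ (-κ) :=
    Real.one_le_rpow_of_pos_of_le_one_of_nonpos hh hh1 (by linarith)
  have hlogB : Real.log B ≤ B * h ^ (-κ) :=
    ((Real.log_le_sub_one_of_pos (by linarith)).trans (by linarith)).trans
      (le_mul_of_one_le_right (by linarith) hone)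
  have hlog : Real.log h⁻¹ ≤ h ^ (-κ) := by
    refine ((Real.log_le_sub_one_of_pos (inv_pos.2 hh)).trans (by linarith : _ ≤ h⁻¹)).trans ?_
    rw [← Real.rpow_neg_one]
    exact Real.rpow_le_rpow_of_exponent_ge hh hh1 (by linarith)
  have hlogm : Real.log (h ^ (-m)) = m * Real.log h⁻¹ := by
    rw [Real.log_rpow hh, Real.log_inv]
    ring
  refine (Real.log_le_log hpos hxB).trans ?_
  rw [Real.log_mul (by positivity) (by positivity), Real.log_exp, Real.log_mul (by positivity)
    (by positivity), Real.log_mul (by positivity) (by positivity), Real.log_pow, Real.log_pow,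
    Real.log_pow, hlogm]
  push_cast
  have : m * Real.log h⁻¹ ≤ m * h ^ (-κ) := by gcongr
  linarith

/-- The resolvent estimate for a split potential, in terms of the decay rate `k` of the derivative
of the phase and of the exponent `m` of the scale `h^(-m)` at which the phase becomes flat. -/
theorem logResolventBound_of_split (hn : 3 ≤ n) {V : LInfty n} {W dW S : Rn n → ℝ}
    {E s k m κ δ β C K P R r₀ : ℝ} (hE : 0 < E) (hs : 1 / 2 < s) (hs0 : 0 ≤ s) (hk0 : 0 < k)
    (hk : k < 1) (hm : 0 < m) (hkδ : 3 * k ≤ 2 * δ - 1) (hmδ : 1 < m * (δ - 1))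
    (hmk : 1 / 3 < m * k) (hβ : 1 < β) (hκ : 4 / 3 + m * (1 - k) ≤ κ)
    (hsplit : RadialSplit r₀ K (fun r => C * (1 + r) ^ (-δ)) W dW S)
    (hV : ∀ᵐ x, V x = W x + S x) (hC : 0 ≤ C) (hP : 0 ≤ P)
    (hWP : ∀ x, W x ≤ P) (hWR : ∀ x, R ≤ ‖x‖ → W x ≤ E / 8)
    (hdW : ∀ x, x ≠ 0 → dW x ≤ C * (1 + ‖x‖) ^ (-β)) :
    LogResolventBound V E s hs0 κ := by
  obtain ⟨ε, τ₀, h₀, hε, hτ₀, hh₀, hh₀1, hw⟩ :=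
    exists_dominating_weight (r₀ := r₀) hE hs hk0 hk hm hkδ hmδ hmk hβ hC hP hWP hWR hdW
  have hk1 : 0 < 1 - k := by linarith
  have hmk1 : 0 < m * (1 - k) := by positivity
  have hVn := norm_nonneg V
  set M₀ : ℝ := 2 + τ₀ with hM₀
  set V₁ : ℝ := ‖V‖ + E + 3 with hV₁
  set B : ℝ := 1 + (2 * M₀ ^ 2 / ε + 2 * (M₀ * (n + 1) + M₀ ^ 2) * (V₁ + 1)) * (4 / (E * ε))
    with hB
  have hB1 : 1 ≤ B := le_add_of_nonneg_right (by positivity)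
  set Φ₀ : ℝ := 2 * (τ₀ / (1 - k)) with hΦ₀
  refine ⟨Φ₀ + B + 4 * m + 4, by positivity, h₀, hh₀, fun h hh hhle θ hθ hθ1 σ hσ => ?_⟩
  have hh1 : h ≤ 1 := hhle.trans hh₀1
  have hwh := hw h hh hhle
  set a : ℝ := h ^ (-m) with ha
  obtain ⟨w, hdom⟩ := hwh
  have ha1 : 1 ≤ a := Real.one_le_rpow_of_pos_of_le_one_of_nonpos hh hh1 (by linarith)
  have ha0 : 0 < a := by linarith
  have habs : |σ * θ| = θ := by
    rcases hσ with rfl | rfl <;> simp [abs_of_pos hθ]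
  obtain ⟨R, hR, hbd⟩ := exists_resolvent_norm_le hn hs0 w (by positivity) hh hE hsplit hdom V hV
    (τ := σ * θ) (abs_pos.1 (hθ.trans_eq habs.symm)) (habs.trans_le hθ1.le)
  refine ⟨R, by simpa using hR, ?_⟩
  refine log_le_mul_rpow_of_le_exp hh hh1 hm.le (by linarith) hB1 (by positivity) (norm_nonneg _)
    (hbd.trans ?_)
  set H : ℝ := h⁻¹ with hH
  have hH1 : 1 ≤ H := one_le_inv_iff₀.2 ⟨hh, hh1⟩
  set M : ℝ := 2 + τ₀ * h ^ (-(1 / 3) : ℝ) with hM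
  have hM0 : 0 < M := by positivity
  have hMle : M ≤ M₀ * H := by
    have h1 : h ^ (-(1 / 3) : ℝ) ≤ H := by
      rw [hH, ← Real.rpow_neg_one]
      exact Real.rpow_le_rpow_of_exponent_ge hh hh1 (by norm_num)
    calc M ≤ 2 * H + τ₀ * H := by rw [hM]; gcongr; linarith
      _ = _ := by rw [hM₀]; ring
  have hQ : Real.exp (2 * (τ₀ * h ^ (-(1 / 3) : ℝ) / (1 - k) * a ^ (1 - k)) / h) ≤
      Real.exp (Φ₀ * h ^ (-κ)) := by
    have h1 : h ^ (-(1 / 3) : ℝ) * a ^ (1 - k) / h = h ^ (-(4 / 3 + m * (1 - k))) := by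
      rw [ha, ← Real.rpow_mul hh.le, ← Real.rpow_add hh, ← Real.rpow_sub_one hh.ne']
      congr 1
      ring
    have h2 : h ^ (-(4 / 3 + m * (1 - k))) ≤ h ^ (-κ) :=
      Real.rpow_le_rpow_of_exponent_ge hh hh1 (by linarith)
    gcongr
    calc _ = Φ₀ * (h ^ (-(1 / 3) : ℝ) * a ^ (1 - k) / h) := by rw [hΦ₀]; ring
      _ ≤ _ := by rw [h1]; gcongr
  set Q₀ := Real.exp (2 * (τ₀ * h ^ (-(1 / 3) : ℝ) / (1 - k) * a ^ (1 - k)) / h)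
  set Q := Real.exp (Φ₀ * h ^ (-κ)) with hQdef
  have hQ1 : 1 ≤ Q := Real.one_le_exp (by positivity)
  have ht1 : 2 * Q₀ * M ^ 2 / (h ^ 2 * (ε / a ^ 2)) ≤ Q * a ^ 2 * H ^ 4 * (2 * M₀ ^ 2 / ε) := by
    calc 2 * Q₀ * M ^ 2 / (h ^ 2 * (ε / a ^ 2))
        ≤ 2 * Q * (M₀ * H) ^ 2 / (h ^ 2 * (ε / a ^ 2)) := by gcongr
      _ = _ := by rw [hH]; field_simp
  have ht2 : 2 * Q₀ * (M * (n + 1) + M ^ 2 / h) * (V₁ / h + 1) ≤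
      Q * a ^ 2 * H ^ 4 * (2 * (M₀ * (n + 1) + M₀ ^ 2) * (V₁ + 1)) := by
    have hHH : H ≤ H ^ 3 := le_self_pow₀ hH1 (by norm_num)
    have ha2 : 1 ≤ a ^ 2 := one_le_pow₀ ha1
    have h1 : M * (n + 1) + M ^ 2 / h ≤ (M₀ * (n + 1) + M₀ ^ 2) * H ^ 3 := by
      calc M * (n + 1) + M ^ 2 / h = M * (n + 1) + M ^ 2 * H := by rw [hH]; ring
        _ ≤ (M₀ * H) * (n + 1) + (M₀ * H) ^ 2 * H := by gcongr
        _ = M₀ * (n + 1) * H + M₀ ^ 2 * H ^ 3 := by ring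
        _ ≤ M₀ * (n + 1) * H ^ 3 + M₀ ^ 2 * H ^ 3 := by gcongr
        _ = _ := by ring
    have h2 : V₁ / h + 1 ≤ (V₁ + 1) * H := by
      have : V₁ / h = V₁ * H := by rw [hH]; ring
      rw [this]
      linarith
    calc 2 * Q₀ * (M * (n + 1) + M ^ 2 / h) * (V₁ / h + 1)
        ≤ 2 * Q * ((M₀ * (n + 1) + M₀ ^ 2) * H ^ 3) * ((V₁ + 1) * H) := by gcongr
      _ = 1 * (Q * H ^ 4 * (2 * (M₀ * (n + 1) + M₀ ^ 2) * (V₁ + 1))) := by ring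
      _ ≤ a ^ 2 * (Q * H ^ 4 * (2 * (M₀ * (n + 1) + M₀ ^ 2) * (V₁ + 1))) := by gcongr
      _ = _ := by ring
  have hone : 1 ≤ Q * ((a ^ 2) ^ 2 * H ^ 4) := by
    have h1 : 1 ≤ (a ^ 2) ^ 2 := one_le_pow₀ (one_le_pow₀ ha1)
    have h2 : 1 ≤ H ^ 4 := one_le_pow₀ hH1
    exact one_le_mul_of_one_le_of_one_le hQ1 (one_le_mul_of_one_le_of_one_le h1 h2)
  calc _ ≤ 1 + (Q * a ^ 2 * H ^ 4 * (2 * M₀ ^ 2 / ε) +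
        Q * a ^ 2 * H ^ 4 * (2 * (M₀ * (n + 1) + M₀ ^ 2) * (V₁ + 1))) / (E * (ε / a ^ 2) / 4) := by
        gcongr
    _ = 1 + Q * ((a ^ 2) ^ 2 * H ^ 4) * ((2 * M₀ ^ 2 / ε +
        2 * (M₀ * (n + 1) + M₀ ^ 2) * (V₁ + 1)) * (4 / (E * ε))) := by
        field_simp
    _ ≤ Q * ((a ^ 2) ^ 2 * H ^ 4) + Q * ((a ^ 2) ^ 2 * H ^ 4) * ((2 * M₀ ^ 2 / ε +
        2 * (M₀ * (n + 1) + M₀ ^ 2) * (V₁ + 1)) * (4 / (E * ε))) := by gcongr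
    _ = _ := by rw [hB]; ring

end SemiclassicalResolvent


theorem theorem1p2 (n : ℕ) (hn : 3 ≤ n)
    (V : SemiclassicalResolvent.LInfty n) (VL VS : SemiclassicalResolvent.Rn n → ℝ)
    (hVL_meas : AEStronglyMeasurable VL volume)
    (hV : ∀ᵐ x, V x = VL x + VS x)
    (r₀ C₁ C₂ δ β : ℝ) (hr₀ : 0 < r₀) (hC₁ : 0 < C₁) (hC₂ : 0 < C₂) (hδ : 1 < δ) (hβ : 1 < β)
    (hVS : ∀ᵐ x, |VS x| ≤ C₁ * (‖x‖ + 1) ^ (-δ))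
    (hVL_C1 : ∀ ω : SemiclassicalResolvent.Rn n, ‖ω‖ = 1 →
      ContDiffOn ℝ 1 (fun r : ℝ => VL (r • ω)) (Set.Ici r₀))
    (p : ℝ → ℝ) (hp_anti : AntitoneOn p (Set.Ici r₀)) (hp_pos : ∀ r, r₀ ≤ r → 0 < p r)
    (hp_lim : Tendsto p atTop (𝓝 0))
    (hVL : ∀ x, r₀ ≤ ‖x‖ → VL x ≤ p ‖x‖)
    (hVL_deriv : ∀ ω : SemiclassicalResolvent.Rn n, ‖ω‖ = 1 → ∀ r, r₀ ≤ r →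
      derivWithin (fun t : ℝ => VL (t • ω)) (Set.Ici r₀) r ≤ C₂ * (r + 1) ^ (-β))
    (E s : ℝ) (hE : 0 < E) (hs : 1 / 2 < s) :
    (δ ≤ 3 →
      7 / 6 ≤ max (7 / (3 * (δ - 1))) (4 / (3 * (β - 1))) ∧
      SemiclassicalResolvent.LogResolventBound V E s (by linarith)
        (2 / 3 + max (7 / (3 * (δ - 1))) (4 / (3 * (β - 1))))) ∧
    (3 < δ → β < 3 →
      2 / 3 < max (1 / (δ - β)) (4 / (3 * (β - 1))) ∧
      SemiclassicalResolvent.LogResolventBound V E s (by linarith)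
        (4 / 3 + 1 / 2 * (3 - β) * max (1 / (δ - β)) (4 / (3 * (β - 1))))) := by
  obtain ⟨W, dW, S, C, K, P, R, hsplit, hVs, hC, hP, hWP, hWR, hdW⟩ :=
    SemiclassicalResolvent.exists_radialSplit hV hr₀ hC₁ hC₂ hδ hVS hVL_C1 hp_anti hp_pos
      hp_lim hVL hVL_deriv hE
  refine ⟨fun hδ3 => ⟨?_, ?_⟩, fun hδ3 hβ3 => ?_⟩
  · refine le_max_of_le_left ?_
    rw [div_le_div_iff₀ (by norm_num) (by linarith)]
    linarith
  -- `m = 2 / (δ - 1)` and the largest decay rate `k ≤ 1/2` with `3 k ≤ 2 δ - 1`: the exponent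
  -- `4/3 + m (1 - k)` is then at most `2/3 + 7 / (3 (δ - 1))`
  · have hδ1 : 0 < δ - 1 := by linarith
    have hk0 : 0 < min (1 / 2) ((2 * δ - 1) / 3) := lt_min (by norm_num) (by linarith)
    have hk2 := min_le_right (1 / 2) ((2 * δ - 1) / 3)
    have hk1 := min_le_left (1 / 2) ((2 * δ - 1) / 3)
    have hk3 : δ - 1 < 6 * min (1 / 2) ((2 * δ - 1) / 3) := by
      rcases min_choice (1 / 2) ((2 * δ - 1) / 3) with h | h <;> rw [h] <;> linarith
    have hk4 : 6 * (1 - min (1 / 2) ((2 * δ - 1) / 3)) ≤ 9 - 2 * δ := by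
      rcases min_choice (1 / 2) ((2 * δ - 1) / 3) with h | h <;> rw [h] <;> linarith
    set k := min (1 / 2) ((2 * δ - 1) / 3)
    refine SemiclassicalResolvent.logResolventBound_of_split (k := k) (m := 2 / (δ - 1)) hn hE hs
      _ hk0 (by linarith) (by positivity) (by linarith) ?_ ?_ hβ ?_ hsplit hVs hC hP hWP hWR hdW
    · rw [div_mul_cancel₀ _ hδ1.ne']
      norm_num
    · rw [div_mul_eq_mul_div, div_lt_div_iff₀ (by norm_num) hδ1]
      linarith
    · have h1 : 4 / 3 + 2 / (δ - 1) * (1 - k) ≤ 2 / 3 + 7 / (3 * (δ - 1)) := by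
        have e : 2 / 3 + 7 / (3 * (δ - 1)) - (4 / 3 + 2 / (δ - 1) * (1 - k)) =
            (9 - 2 * δ - 6 * (1 - k)) / (3 * (δ - 1)) := by
          field_simp
          ring
        have : 0 ≤ (9 - 2 * δ - 6 * (1 - k)) / (3 * (δ - 1)) :=
          div_nonneg (by linarith) (by linarith)
        linarith
      exact h1.trans (by gcongr; exact le_max_left _ _)
  · have hm₂ : 2 / 3 < max (1 / (δ - β)) (4 / (3 * (β - 1))) := by
      refine lt_max_of_lt_right ?_
      rw [div_lt_div_iff₀ (by norm_num) (by linarith)]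
      linarith
    refine ⟨hm₂, ?_⟩
    -- `m = 1` satisfies `m (δ - 1) > 1`, and the rate `k = 1 - η` gives the exponent `4/3 + η`;
    -- `η ≤ 1/2` ensures `m k > 1/3`
    set m₂ := max (1 / (δ - β)) (4 / (3 * (β - 1)))
    have hη : 0 < 1 / 2 * (3 - β) * m₂ := by
      have : 0 < 3 - β := by linarith
      positivity
    have hη0 : 0 < min (1 / 2) (1 / 2 * (3 - β) * m₂) := lt_min (by norm_num) hη
    have hη1 := min_le_left (1 / 2) (1 / 2 * (3 - β) * m₂)
    have hη2 := min_le_right (1 / 2) (1 / 2 * (3 - β) * m₂)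
    set η := min (1 / 2) (1 / 2 * (3 - β) * m₂)
    exact SemiclassicalResolvent.logResolventBound_of_split (k := 1 - η) (m := 1) hn hE hs _
      (by linarith) (by linarith) one_pos (by linarith) (by linarith) (by linarith) hβ
      (by linarith) hsplit hVs hC hP hWP hWR hdW
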